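/- Let $p\neq\ell$ be primes, let $k\ge 0$ be an integer, and let $\theta$ be a Dirichlet character with $\theta(-1)(-1)^k=-1$. Let $\mathbb Q_\infty$ be the cyclotomic $\mathbb Z_p$-extension of $\mathbb Q$, i.e. the subfield of $\mathbb Q(\mu_{p^\infty})\subset\mathbb C$ fixed by the torsion subgroup of $\mathrm{Gal}(\mathbb Q(\mu_{p^\infty})/\mathbb Q)\cong\mathbb Z_p^\times$. View each continuous character $\psi:\mathrm{Gal}(\mathbb Q_\infty/\mathbb Q)\to\mathbb C^\times$ as a Dirichlet character of $p$-power modulus: $\psi(a)=\psi(\sigma_a|_{\mathbb Q_\infty})$, where $\sigma_a$ raises the $p$-power roots of unity of order dividing the modulus to the power $a$. Let $L(-k,\theta\psi)$ be the value at $s=-k$ of the analytically continued Dirichlet $L$-function of the primitive character inducing the product $\theta\psi$. Fix a field isomorphism $\iota:\mathbb C\cong\overline{\mathbb Q}_\ell$, by which $L$-values are regarded as elements of $\overline{\mathbb Q}_\ell$, and let $\mathrm{ord}_\ell$ be the valuation of $\overline{\mathbb Q}_\ell$ with $\mathrm{ord}_\ell(\ell)=1$ (and $\mathrm{ord}_\ell(0)=\infty$);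 an $\ell$-adic unit is an element with $\mathrm{ord}_\ell=0$. Then: (1) $\mathrm{ord}_\ell\bigl(\tfrac12 L(-k,\theta\psi)\bigr)>0$ holds for only finitely many characters $\psi$ of $\mathrm{Gal}(\mathbb Q_\infty/\mathbb Q)$. If $\ell$ does not divide the conductor of $\theta$, then $\tfrac12 L(-k,\theta\psi)$ is an $\ell$-adic unit for all but finitely many such $\psi$. (2) If $\ell\neq 2$, the factor $\tfrac12$ may be dropped: $\mathrm{ord}_\ell(L(-k,\theta\psi))>0$ holds for only finitely many such $\psi$, and if $\ell$ does not divide the conductor of $\theta$, then $L(-k,\theta\psi)$ is an $\ell$-adic unit for all but finitely many such $\psi$. -/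

import Mathlib

/-- The field `ℚ(μ_{p^∞})` inside `ℂ`, generated by all roots of unity of `p`-power order. -/
noncomputable def CycPField (p : ℕ) : IntermediateField ℚ ℂ :=
  IntermediateField.adjoin ℚ {z : ℂ | ∃ n : ℕ, z ^ p ^ n = 1}

instance CycPField.isGalois (p : ℕ) [Fact p.Prime] : IsGalois ℚ (CycPField p) := by
  have hp : p ≠ 0 := (Fact.out : p.Prime).ne_zero
  have hset : {z : ℂ | ∃ n : ℕ, z ^ p ^ n = 1} =
      {b : ℂ | ∃ n ∈ Set.range (fun i : ℕ => p ^ i), n ≠ 0 ∧ b ^ n = 1} := by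
    ext z
    constructor
    · rintro ⟨n, hn⟩
      exact ⟨p ^ n, ⟨n, rfl⟩, pow_ne_zero _ hp, hn⟩
    · rintro ⟨_, ⟨n, rfl⟩, -, hn⟩
      exact ⟨n, hn⟩
  have h := IntermediateField.isCyclotomicExtension_adjoin_of_exists_isPrimitiveRoot
    (Set.range (fun i : ℕ => p ^ i)) ℚ ℂ
    (fun n _ hn0 => ⟨_, Complex.isPrimitiveRoot_exp n hn0⟩)
  rw [← hset] at h
  exact @IsCyclotomicExtension.isGalois (Set.range (fun i : ℕ => p ^ i)) ℚ (CycPField p) _ _ _ h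

/-- The torsion of `Gal(ℚ(μ_{p^∞})/ℚ) ≅ ℤ_p^×`. -/
noncomputable def cycTorsion (p : ℕ) : Subgroup Gal(CycPField p/ℚ) :=
  Subgroup.closure {σ | IsOfFinOrder σ}

instance cycTorsion.normal (p : ℕ) : (cycTorsion p).Normal := by
  apply Subgroup.Normal.mk
  intro σ hσ τ
  refine Subgroup.closure_induction
    (p := fun x _ => τ * x * τ⁻¹ ∈ cycTorsion p) ?_ ?_ ?_ ?_ hσ
  · intro x hx
    refine Subgroup.subset_closure ?_
    have := (MulAut.conj τ).toMonoidHom.isOfFinOrder (x := x) hx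
    simpa using this
  · simp
  · intro x y _ _ hx hy
    have := mul_mem hx hy
    simpa [mul_assoc] using this
  · intro x _ hx
    have := inv_mem hx
    simpa [mul_assoc] using this

/-- The cyclotomic `ℤ_p`-extension `ℚ_∞` of `ℚ`: the subfield of `ℚ(μ_{p^∞})` fixed by the torsion
subgroup of the Galois group. -/
noncomputable def QInf (p : ℕ) : IntermediateField ℚ (CycPField p) :=
  IntermediateField.fixedField (cycTorsion p)

instance QInf.isGalois (p : ℕ) [Fact p.Prime] : IsGalois ℚ (QInf p) :=
  IsGalois.of_fixedField_normal_subgroup (cycTorsion p)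

/-- The (continuous, complex) characters of `Gal(ℚ_∞/ℚ)` with its Krull topology. -/
abbrev QInfChar (p : ℕ) : Type := Gal(QInf p/ℚ) →ₜ* ℂˣ

/-- The Dirichlet character `χ` modulo `p ^ n` is the one that corresponds to the character `ψ` of
`Gal(ℚ_∞/ℚ)`: if `σ` raises the `p ^ n`-th roots of unity to the power `a`, then `ψ` takes the value
`χ a` at the restriction of `σ` to `ℚ_∞`. -/
def Corresponds {p : ℕ} [Fact p.Prime] (ψ : QInfChar p) {n : ℕ}
    (χ : DirichletCharacter ℂ (p ^ n)) : Prop :=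
  ∀ (σ : Gal(CycPField p/ℚ)) (a : (ZMod (p ^ n))ˣ),
    (∀ z : CycPField p, z ^ p ^ n = 1 → σ z = z ^ (a : ZMod (p ^ n)).val) →
      (ψ (AlgEquiv.restrictNormalHom (QInf p) σ) : ℂ) = χ (a : ZMod (p ^ n))

theorem complex_eq_one_of_pow_near_one (z : ℂ) (h : ∀ n : ℕ, ‖z ^ n - 1‖ < 1 / 2) : z = 1 := by
  have key : ∀ j : ℕ, (3 / 2 : ℝ) ^ j * ‖z - 1‖ ≤ ‖z ^ 2 ^ j - 1‖ := by
    intro j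
    induction j with
    | zero => simp
    | succ j ih =>
      have h1 : z ^ 2 ^ (j + 1) - 1 = (z ^ 2 ^ j - 1 + 2) * (z ^ 2 ^ j - 1) := by
        rw [pow_succ, pow_mul]; ring
      have h2 : (3 / 2 : ℝ) ≤ ‖z ^ 2 ^ j - 1 + 2‖ := by
        have h3 := norm_sub_le (z ^ 2 ^ j - 1 + 2) (z ^ 2 ^ j - 1)
        have h4 : z ^ 2 ^ j - 1 + 2 - (z ^ 2 ^ j - 1) = 2 := by ring
        rw [h4] at h3
        have h5 : ‖(2 : ℂ)‖ = 2 := by simp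
        have h6 := h (2 ^ j)
        linarith
      rw [h1, norm_mul, pow_succ]
      calc (3 / 2 : ℝ) ^ j * (3 / 2) * ‖z - 1‖ = 3 / 2 * ((3 / 2) ^ j * ‖z - 1‖) := by ring
        _ ≤ _ := mul_le_mul h2 ih (by positivity) (norm_nonneg _)
  by_contra hne
  have hpos : 0 < ‖z - 1‖ := norm_pos_iff.mpr (sub_ne_zero.mpr hne)
  obtain ⟨j, hj⟩ := pow_unbounded_of_one_lt (1 / ‖z - 1‖) (by norm_num : (1 : ℝ) < 3 / 2)
  have h1 : 1 < (3 / 2 : ℝ) ^ j * ‖z - 1‖ := by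
    rwa [div_lt_iff₀ hpos] at hj
  have h2 := h (2 ^ j)
  have h3 := key j
  linarith

theorem QInfChar.exists_trivial {p : ℕ} (ψ : QInfChar p) :
    ∃ E : IntermediateField ℚ (QInf p), FiniteDimensional ℚ E ∧
      ∀ τ ∈ E.fixingSubgroup, ψ τ = 1 := by
  have hU : {u : ℂˣ | ‖(u : ℂ) - 1‖ < 1 / 2} ∈ nhds (1 : ℂˣ) := by
    refine IsOpen.mem_nhds ?_ (by simp)
    exact isOpen_lt (by fun_prop) continuous_const
  have hV : ψ ⁻¹' {u : ℂˣ | ‖(u : ℂ) - 1‖ < 1 / 2} ∈ nhds (1 : Gal(QInf p/ℚ)) := by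
    apply ψ.continuous_toFun.continuousAt
    simpa using hU
  obtain ⟨E, hE, hsub⟩ := (krullTopology_mem_nhds_one_iff _ _ _).1 hV
  refine ⟨E, hE, fun τ hτ => ?_⟩
  apply Units.ext
  apply complex_eq_one_of_pow_near_one
  intro n
  have := hsub (pow_mem hτ n)
  simpa using this

theorem CycPField.exists_level {p : ℕ} (x : CycPField p) :
    ∃ n : ℕ, ∀ m, n ≤ m → ∀ σ : Gal(CycPField p/ℚ),
      (∀ z : CycPField p, z ^ p ^ m = 1 → σ z = z) → σ x = x := by
  obtain ⟨x, hx⟩ := x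
  refine IntermediateField.adjoin_induction (F := ℚ)
    (p := fun (y : ℂ) (hy : y ∈ CycPField p) => ∃ n : ℕ, ∀ m, n ≤ m → ∀ σ : Gal(CycPField p/ℚ),
      (∀ z : CycPField p, z ^ p ^ m = 1 → σ z = z) → σ ⟨y, hy⟩ = ⟨y, hy⟩)
    ?_ ?_ ?_ ?_ ?_ hx
  · rintro y ⟨n, hn⟩
    refine ⟨n, fun m hm σ hσ => hσ _ ?_⟩
    apply Subtype.ext
    obtain ⟨d, rfl⟩ := Nat.exists_eq_add_of_le hm
    simp [pow_add, pow_mul, hn]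
  · intro q
    exact ⟨0, fun m _ σ _ => σ.commutes q⟩
  · rintro y z hy hz ⟨n, hn⟩ ⟨k, hk⟩
    refine ⟨max n k, fun m hm σ hσ => ?_⟩
    have h1 := hn m (le_trans (le_max_left _ _) hm) σ hσ
    have h2 := hk m (le_trans (le_max_right _ _) hm) σ hσ
    have := map_add σ ⟨y, hy⟩ ⟨z, hz⟩
    rw [h1, h2] at this
    exact this
  · rintro y hy ⟨n, hn⟩
    refine ⟨n, fun m hm σ hσ => ?_⟩
    have := map_inv₀ σ ⟨y, hy⟩
    rw [hn m hm σ hσ] at this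
    exact this
  · rintro y z hy hz ⟨n, hn⟩ ⟨k, hk⟩
    refine ⟨max n k, fun m hm σ hσ => ?_⟩
    have h1 := hn m (le_trans (le_max_left _ _) hm) σ hσ
    have h2 := hk m (le_trans (le_max_right _ _) hm) σ hσ
    have := map_mul σ ⟨y, hy⟩ ⟨z, hz⟩
    rw [h1, h2] at this
    exact this

theorem QInfChar.exists_level {p : ℕ} [Fact p.Prime] (ψ : QInfChar p) :
    ∃ n : ℕ, ∀ σ : Gal(CycPField p/ℚ),
      (∀ z : CycPField p, z ^ p ^ n = 1 → σ z = z) →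
        ψ (AlgEquiv.restrictNormalHom (QInf p) σ) = 1 := by
  obtain ⟨E, hE, hψ⟩ := ψ.exists_trivial
  let b := Module.finBasis ℚ E
  choose N hN using fun i => CycPField.exists_level (p := p) ((b i : QInf p) : CycPField p)
  refine ⟨Finset.univ.sup N, fun σ hσ => hψ _ ?_⟩
  rw [IntermediateField.mem_fixingSubgroup_iff]
  intro x hx
  let f : QInf p →ₗ[ℚ] QInf p := (AlgEquiv.restrictNormalHom (QInf p) σ).toLinearMap
  have hf : f ∘ₗ E.val.toLinearMap = E.val.toLinearMap := by
    refine b.ext fun i => ?_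
    apply Subtype.ext
    change ((AlgEquiv.restrictNormalHom (QInf p) σ (b i : QInf p) : QInf p) : CycPField p) = _
    refine (AlgEquiv.restrictNormal_commutes σ (QInf p) (b i : QInf p)).trans ?_
    exact hN i _ (Finset.le_sup (Finset.mem_univ i)) σ hσ
  exact LinearMap.congr_fun hf (⟨x, hx⟩ : E)

theorem CycPField.exists_primitive (p : ℕ) [Fact p.Prime] (n : ℕ) :
    ∃ ζ : CycPField p, IsPrimitiveRoot ζ (p ^ n) := by
  have hp : p ≠ 0 := (Fact.out : p.Prime).ne_zero
  have h := Complex.isPrimitiveRoot_exp (p ^ n) (pow_ne_zero _ hp)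
  have hmem := IntermediateField.subset_adjoin ℚ {z : ℂ | ∃ n : ℕ, z ^ p ^ n = 1}
    (⟨n, h.pow_eq_one⟩ : _ ∈ {z : ℂ | ∃ n : ℕ, z ^ p ^ n = 1})
  exact ⟨⟨_, hmem⟩, IsPrimitiveRoot.of_map_of_injective (f := (CycPField p).val) h
    (CycPField p).val.injective⟩

theorem CycPField.exists_cycHom (p : ℕ) [Fact p.Prime] (n : ℕ) :
    ∃ c : Gal(CycPField p/ℚ) →* (ZMod (p ^ n))ˣ, Function.Surjective c ∧
      ∀ σ (z : CycPField p), z ^ p ^ n = 1 → σ z = z ^ (c σ : ZMod (p ^ n)).val := by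
  have : NeZero (p ^ n) := ⟨pow_ne_zero _ (Fact.out : p.Prime).ne_zero⟩
  obtain ⟨ζ, hζ⟩ := CycPField.exists_primitive p n
  let L : IntermediateField ℚ (CycPField p) := IntermediateField.adjoin ℚ {ζ}
  have : IsCyclotomicExtension {p ^ n} ℚ L :=
    (IntermediateField.isCyclotomicExtension_singleton_iff_eq_adjoin (p ^ n) ℚ _ L hζ).2 rfl
  have : NumberField L := IsCyclotomicExtension.numberField {p ^ n} ℚ L
  have : IsGalois ℚ L := IsCyclotomicExtension.isGalois {p ^ n} ℚ L
  have : Normal ℚ L := IsGalois.to_normal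
  refine ⟨(IsCyclotomicExtension.Rat.galEquivZMod (p ^ n) L).toMonoidHom.comp
    (AlgEquiv.restrictNormalHom L), ?_, ?_⟩
  · exact (IsCyclotomicExtension.Rat.galEquivZMod (p ^ n) L).surjective.comp
      (AlgEquiv.restrictNormalHom_surjective _)
  · intro σ z hz
    obtain ⟨i, -, rfl⟩ := hζ.eq_pow_of_pow_eq_one hz
    have hmem : ζ ^ i ∈ L := pow_mem (IntermediateField.mem_adjoin_simple_self ℚ ζ) i
    have h := IsCyclotomicExtension.Rat.galEquivZMod_apply_of_pow_eq (p ^ n) L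
      (AlgEquiv.restrictNormalHom L σ) (x := ⟨ζ ^ i, hmem⟩) (Subtype.ext hz)
    have h' := congrArg (Subtype.val) h
    exact (AlgEquiv.restrictNormal_commutes σ L ⟨ζ ^ i, hmem⟩).symm.trans h'

/-- Every character of `Gal(ℚ_∞/ℚ)` corresponds to a Dirichlet character of `p`-power modulus. -/
theorem QInfChar.exists_corresponds {p : ℕ} [Fact p.Prime] (ψ : QInfChar p) :
    ∃ (n : ℕ) (χ : DirichletCharacter ℂ (p ^ n)), Corresponds ψ χ := by
  obtain ⟨n, hn⟩ := ψ.exists_level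
  have : NeZero (p ^ n) := ⟨pow_ne_zero _ (Fact.out : p.Prime).ne_zero⟩
  obtain ⟨c, hc, hcz⟩ := CycPField.exists_cycHom p n
  let φ : Gal(CycPField p/ℚ) →* ℂˣ :=
    (ψ : Gal(QInf p/ℚ) →* ℂˣ).comp (AlgEquiv.restrictNormalHom (QInf p))
  have hker : c.ker ≤ φ.ker := by
    intro σ hσ
    refine hn σ fun z hz => ?_
    obtain ⟨ζ, hζ⟩ := CycPField.exists_primitive p n
    rw [hcz σ z hz, MonoidHom.mem_ker.1 hσ, Units.val_one]
    rcases Nat.eq_or_lt_of_le (NeZero.pos (p ^ n) : 1 ≤ p ^ n) with h1 | h1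
    · rw [← h1, pow_one] at hz
      simp [hz]
    · rw [ZMod.val_one'' (by omega), pow_one]
  let χ' : (ZMod (p ^ n))ˣ →* ℂˣ := c.liftOfSurjective hc ⟨φ, hker⟩
  refine ⟨n, MulChar.ofUnitHom χ', fun σ a ha => ?_⟩
  have hca : c σ = a := by
    obtain ⟨ζ, hζ⟩ := CycPField.exists_primitive p n
    have h := (hcz σ ζ hζ.pow_eq_one).symm.trans (ha ζ hζ.pow_eq_one)
    exact Units.ext (ZMod.val_injective _ (hζ.pow_inj (ZMod.val_lt _) (ZMod.val_lt _) h))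
  rw [MulChar.ofUnitHom_coe, ← hca]
  have := c.liftOfRightInverse_comp_apply _ (Function.rightInverse_surjInv hc) ⟨φ, hker⟩ σ
  exact congrArg Units.val this.symm

/-- The exponent of a modulus `p ^ n` of definition of the Dirichlet character that corresponds
to `ψ`. -/
noncomputable def QInfChar.level {p : ℕ} [Fact p.Prime] (ψ : QInfChar p) : ℕ :=
  ψ.exists_corresponds.choose

/-- The Dirichlet character that corresponds to `ψ`, with a modulus that is a power of `p`. -/
noncomputable def QInfChar.dirichlet {p : ℕ} [Fact p.Prime] (ψ : QInfChar p) :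
    DirichletCharacter ℂ (p ^ ψ.level) :=
  ψ.exists_corresponds.choose_spec.choose

theorem QInfChar.dirichlet_corresponds {p : ℕ} [Fact p.Prime] (ψ : QInfChar p) :
    Corresponds ψ ψ.dirichlet :=
  ψ.exists_corresponds.choose_spec.choose_spec

/-- `L(-k, θψ)`: the value at `-k` of the (analytically continued) Dirichlet `L`-function of the
primitive Dirichlet character that induces the product of `θ` and `ψ`. -/
noncomputable def twistedLValue {p : ℕ} [Fact p.Prime] {N : ℕ} [NeZero N]
    (θ : DirichletCharacter ℂ N) (ψ : QInfChar p) (k : ℕ) : ℂ :=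
  haveI : NeZero (Nat.lcm N (p ^ ψ.level)) :=
    ⟨Nat.lcm_ne_zero (NeZero.ne N) (pow_ne_zero _ (Fact.out : p.Prime).ne_zero)⟩
  haveI : NeZero (DirichletCharacter.mul θ ψ.dirichlet).conductor :=
    ⟨DirichletCharacter.conductor_ne_zero _⟩
  (DirichletCharacter.primitive_mul θ ψ.dirichlet).LFunction (-(k : ℂ))

open Classical in
/-- The additive valuation on an algebraic closure of `ℚ_ℓ`, normalized by `ord_ℓ(ℓ) = 1`. The norm
is the one that extends the `ℓ`-adic norm of `ℚ_ℓ`. -/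
noncomputable def ordEll (ℓ : ℕ) [Fact ℓ.Prime] (x : PadicAlgCl ℓ) : WithTop ℝ :=
  if x = 0 then ⊤ else ((-Real.logb ℓ ‖x‖ : ℝ) : WithTop ℝ)

/-! Let O be the valuation ring of ℂ that `ι` defines above ℓ, with residue field K. For all but
finitely many ψ the primitive character χ attached to θψ has conductor d p^n, with n large and d a
divisor of the prime-to-p part of the modulus of θ. The core is that L(-k, χ)/2 is then a unit of O
(`DirichletCharacter.exists_unit_eq_LFunction_neg`).

Split χ into a character θ' modulo d and a primitive character ψ' modulo p^n. The exponential
generating series of the L(-k, χ) is ∑ χ(a) e^{at} / (1 - e^{ft}), f being the modulus. Expanding ψ'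
by its Gauss sum τ turns τ times this series into ∑ ψ'⁻¹(u) F(ζ^u e^t), where F is a rational
function with denominator 1 - X^D and D does not depend on n. Since θ has parity opposite to k, the
terms of ζ^u and ζ^{-u} combine: this produces the factor 2 and leaves only the exponents a < D/2 in
the numerator (`DirichletCharacter.exists_LFunction_neg_formula`). The Gauss sum divides p^n, so it
is a unit of O. If ℓ divides D, the k-th coefficient reduces in K to R(ζ^u), where R(w) = ∑ c(a) w^a
/ (1 - w^D) and c(a) = θ'(a) a^k for a < D/2 prime to p, c(a) = 0 otherwise.

Suppose that ∑ ψ'⁻¹(u) R(ζ^u) vanishes in K. The coefficients of R lie in a finite field 𝔽_q, so the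
q-Frobenius permutes the values R(ζ^u). Averaging over its powers cuts the sum down to the u with
ψ'(u)^{q-1} = 1, and to every translate of this set (`sum_eq_zero_of_frobenius`). With p^e the exact
power of p in q - 1, these u are the δ(1 + p^{n-e} j), where δ is a torsion element of ℤ_p^×
(`sum_ker_eq_sum_rootsOfUnity`). The sum over j selects the exponents a in one residue class modulo
p^e, and what remains is ∑_δ R_δ(ζ^{yδ}) = 0 for all y ≡ 1 mod p^e.

After clearing denominators, this is an element of the group algebra K[ℤ_p], with support bounded
independently of n, that many characters kill. For n large the characters separate the support, so
by Artin's independence of characters the element is 0. No δ other than ±1 is rational, so the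
contribution of ±1 can be isolated modulo X^D - 1, and the outcome is c(a) = ±c(D - a) for all a in
a residue class prime to p (`exists_symmetry_of_sum_eq_zero`). This is absurd: c vanishes on the
upper half of the interval, but not at every such a in the lower half. -/

/-! ### Values of Dirichlet L-functions at non-positive integers -/

open Finset in
theorem hasSum_periodic_geometric {f : ℕ} (hf : 0 < f) (v : ℕ → ℂ) (hv : ∀ n, v (n + f) = v n)
    (C : ℝ) (hC : ∀ n, ‖v n‖ ≤ C) {x : ℝ} (hx0 : 0 ≤ x) (hx1 : x < 1) :
    HasSum (fun n => v n * (x : ℂ) ^ n) ((∑ a ∈ range f, v a * (x : ℂ) ^ a) / (1 - (x : ℂ) ^ f)) := by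
  have hsum : Summable fun n => v n * (x : ℂ) ^ n := by
    refine Summable.of_norm_bounded ((summable_geometric_of_lt_one hx0 hx1).mul_left C) fun n => ?_
    rw [norm_mul, norm_pow, Complex.norm_real, Real.norm_of_nonneg hx0]
    exact mul_le_mul_of_nonneg_right (hC n) (by positivity)
  have hne : (1 : ℂ) - (x : ℂ) ^ f ≠ 0 := by
    have : x ^ f < 1 := pow_lt_one₀ hx0 hx1 hf.ne'
    rw [sub_ne_zero]
    exact_mod_cast this.ne'
  have h := hsum.sum_add_tsum_nat_add f
  have h2 : ∑' n, v (n + f) * (x : ℂ) ^ (n + f) = (x : ℂ) ^ f * ∑' n, v n * (x : ℂ) ^ n := by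
    rw [← tsum_mul_left]
    exact tsum_congr fun n => by rw [hv, pow_add]; ring
  rw [h2] at h
  convert hsum.hasSum using 1
  rw [div_eq_iff hne]
  linear_combination h

open Finset Filter Topology Asymptotics Set in
/-- `L(0, χ) = -∑ a χ(a) / f` for a nontrivial Dirichlet character `χ` modulo `f`. -/
theorem DirichletCharacter.LFunction_zero_eq_sum {f : ℕ} [NeZero f] (χ : DirichletCharacter ℂ f)
    (hχ : χ ≠ 1) : χ.LFunction 0 = -(∑ a ∈ Finset.range f, χ a * a) / f := by
  have hf0 : 0 < f := NeZero.pos f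
  have hf1 : f ≠ 1 := fun h => hχ (DirichletCharacter.level_one' χ h)
  have hχ0 : χ ((0 : ℕ) : ZMod f) = 0 := by simpa using DirichletCharacter.map_zero' χ hf1
  have hsum0 : ∑ a ∈ Finset.range f, χ a = 0 := by
    have := MulChar.sum_eq_zero_of_ne_one hχ
    rw [← this]
    refine Finset.sum_nbij (fun a => (a : ZMod f)) (by simp) ?_ ?_ (by simp)
    · intro a ha b hb h
      have := congrArg ZMod.val h
      simp only [coe_range, Set.mem_Iio] at ha hb
      simpa [ZMod.val_cast_of_lt ha, ZMod.val_cast_of_lt hb] using this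
    · intro b _
      exact ⟨b.val, by simpa using ZMod.val_lt b, by simp⟩
  -- `R` is the generating function ∑ χ(n) x^n in a form regular at x = 1: as ∑ χ(a) = 0, numerator
  -- and denominator have been divided by 1 - x.
  set nu : ℝ → ℂ := fun x => ∑ a ∈ Finset.range f, χ a * ∑ i ∈ Finset.range a, (x : ℂ) ^ i with hnu
  set de : ℝ → ℂ := fun x => ∑ i ∈ Finset.range f, (x : ℂ) ^ i with hde
  set R : ℝ → ℂ := fun x => -nu x / de x with hR
  have hden : ∀ x : ℝ, 0 ≤ x → de x ≠ 0 := by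
    intro x hx
    have : 0 < ∑ i ∈ Finset.range f, x ^ i := by
      refine Finset.sum_pos' (fun i _ => by positivity) ⟨0, by simpa using hf0, by simp⟩
    have h2 : de x = ((∑ i ∈ Finset.range f, x ^ i : ℝ) : ℂ) := by simp [hde]
    rw [h2]
    exact_mod_cast this.ne'
  have hdif : ∀ x : ℝ, 0 ≤ x → DifferentiableAt ℝ R x := by
    intro x hx
    have h0 : DifferentiableAt ℝ (fun y : ℝ => (y : ℂ)) x := Complex.ofRealCLM.differentiableAt
    have h1 : DifferentiableAt ℝ nu x := by
      simp only [hnu]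
      fun_prop
    have h2 : DifferentiableAt ℝ de x := by
      simp only [hde]
      fun_prop
    exact h1.neg.div h2 (hden x hx)
  have hRx : ∀ x : ℝ, 0 ≤ x → x < 1 →
      R x = (∑ a ∈ Finset.range f, χ a * (x : ℂ) ^ a) / (1 - (x : ℂ) ^ f) := by
    intro x hx0 hx1
    have hne : (1 : ℂ) - (x : ℂ) ^ f ≠ 0 := by
      have : x ^ f < 1 := pow_lt_one₀ hx0 hx1 hf0.ne'
      rw [sub_ne_zero]
      exact_mod_cast this.ne'
    have h1 : de x * (x - 1) = (x : ℂ) ^ f - 1 := geom_sum_mul _ _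
    have h2 : nu x * (x - 1) = ∑ a ∈ Finset.range f, χ a * (x : ℂ) ^ a := by
      simp only [hnu]
      rw [Finset.sum_mul]
      simp only [mul_assoc, geom_sum_mul]
      simp only [mul_sub, mul_one, Finset.sum_sub_distrib, hsum0, sub_zero]
    have h3 : (x : ℂ) - 1 ≠ 0 := by
      rw [sub_ne_zero]
      exact_mod_cast hx1.ne
    simp only [hR]
    rw [div_eq_div_iff (hden x hx0) hne, ← h2]
    linear_combination -nu x * h1
  have hR0 : R 0 = 0 := by
    rw [hRx 0 le_rfl one_pos]
    have : ∑ a ∈ Finset.range f, χ a * ((0 : ℝ) : ℂ) ^ a = 0 := by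
      refine Finset.sum_eq_zero fun a _ => ?_
      rcases Nat.eq_zero_or_pos a with rfl | h
      · simp only [hχ0, zero_mul]
      · simp [h.ne']
    rw [this, zero_div]
  have hR1 : R 1 = -(∑ a ∈ Finset.range f, χ a * a) / f := by simp [hR, hnu, hde]
  -- Subtracting R(1) e^{-t} makes `G` vanish at 0, so its Mellin transform is holomorphic for Re s
  -- > -1. For Re s > 1 it equals Γ(s) (L(s, χ) - R(1)), and 1/Γ vanishes at 0.
  set G : ℝ → ℂ := fun t => R (Real.exp (-t)) - R 1 * (Real.exp (-t) : ℝ) with hG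
  have hGd : ∀ t, DifferentiableAt ℝ G t := by
    intro t
    have h1 : DifferentiableAt ℝ (fun t : ℝ => Real.exp (-t)) t := by fun_prop
    have h2 : DifferentiableAt ℝ (fun t : ℝ => R (Real.exp (-t))) t :=
      DifferentiableAt.comp t (g := R) (hdif _ (Real.exp_pos _).le) h1
    have h3 : DifferentiableAt ℝ (fun t : ℝ => ((Real.exp (-t) : ℝ) : ℂ)) t :=
      (Complex.ofRealCLM.differentiableAt).comp t h1
    exact h2.sub (h3.const_mul _)
  have hGc : Continuous G := continuous_iff_continuousAt.2 fun t => (hGd t).continuousAt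
  have hbot : G =O[𝓝[>] 0] (fun t : ℝ => t ^ (-(-1) : ℝ)) := by
    have h := (hGd 0).isBigO_sub
    have hG0 : G 0 = 0 := by simp [hG]
    simp only [hG0, sub_zero] at h
    simpa using h.mono nhdsWithin_le_nhds
  have htop : G =O[atTop] fun t => Real.exp (-1 * t) := by
    have h := (hdif 0 le_rfl).isBigO_sub
    simp only [hR0, sub_zero] at h
    have h1 : Tendsto (fun t : ℝ => Real.exp (-t)) atTop (𝓝 0) := Real.tendsto_exp_neg_atTop_nhds_zero
    have h2 := h.comp_tendsto h1
    have h3 : (fun t : ℝ => R 1 * (Real.exp (-t) : ℝ)) =O[atTop] fun t : ℝ => Real.exp (-t) := by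
      refine IsBigO.of_bound ‖R 1‖ (Eventually.of_forall fun t => ?_)
      rw [norm_mul, Complex.norm_real]
    have h4 := IsBigO.sub h2 h3
    simpa [Function.comp_def, hG] using h4
  have hmel : ∀ s : ℂ, -1 < s.re → DifferentiableAt ℂ (mellin G) s := fun s hs =>
    mellin_differentiableAt_of_isBigO_rpow_exp one_pos (hGc.locallyIntegrable.locallyIntegrableOn _)
      htop hbot hs
  have hχb : ∀ n : ℕ, ‖χ n‖ ≤ 1 := fun n => χ.norm_le_one _
  have hsumG : ∀ s : ℂ, 1 < s.re → mellin G s = Complex.Gamma s * (χ.LFunction s - R 1) := by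
    intro s hs
    set a : ℕ → ℂ := fun n => χ n - if n = 1 then R 1 else 0 with ha
    have hs1 : HasSum (fun n : ℕ => a n / (n : ℂ) ^ s) (χ.LFunction s - R 1) := by
      have h1 := (ZMod.LSeriesSummable_of_one_lt_re (χ : ZMod f → ℂ) hs).hasSum
      rw [← LSeries, ← ZMod.LFunction_eq_LSeries (χ : ZMod f → ℂ) hs] at h1
      have h2 : HasSum (fun n : ℕ => if n = 1 then R 1 else 0) (R 1) := by
        simpa using hasSum_ite_eq (1 : ℕ) (R 1)
      have he : (fun n : ℕ => a n / (n : ℂ) ^ s) = fun n : ℕ =>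
          LSeries.term (fun n => χ n) s n - if n = 1 then R 1 else 0 := by
        funext n
        rcases Nat.eq_zero_or_pos n with rfl | hn
        · simp only [ha, hχ0]
          simp
        · rw [LSeries.term_of_ne_zero hn.ne']
          simp only [ha, sub_div]
          congr 1
          by_cases h : n = 1 <;> simp [h]
      rw [he]
      exact h1.sub h2
    have hs2 := hasSum_mellin (a := a) (p := fun n => (n : ℝ)) (F := G) (s := s) ?_ (by linarith) ?_ ?_
    · have h3 := hs1.mul_left (Complex.Gamma s)
      refine hs2.unique ?_
      convert! h3 using 1
      funext n
      simp [mul_div_assoc]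
    · intro n
      rcases Nat.eq_zero_or_pos n with rfl | hn
      · left
        simp only [ha, hχ0]
        simp
      · right
        exact_mod_cast hn
    · intro t ht
      have hx1 : Real.exp (-t) < 1 := by
        rw [Real.exp_lt_one_iff]
        simpa using ht
      have h1 := hasSum_periodic_geometric hf0 (fun n => χ n) (by simp) 1 hχb (Real.exp_pos (-t)).le hx1
      rw [← hRx _ (Real.exp_pos (-t)).le hx1] at h1
      have h2 : HasSum (fun n : ℕ => if n = 1 then R 1 * (Real.exp (-t) : ℝ) else 0)
          (R 1 * (Real.exp (-t) : ℝ)) := by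
        simpa using hasSum_ite_eq (1 : ℕ) (R 1 * (Real.exp (-t) : ℝ))
      convert! h1.sub h2 using 1
      funext n
      have he : Real.exp (-(n : ℝ) * t) = Real.exp (-t) ^ n := by
        rw [← Real.exp_nat_mul]
        ring_nf
      rw [he]
      simp only [ha, sub_mul]
      by_cases h : n = 1 <;> simp [h]
    · have h1 := Real.summable_one_div_nat_rpow.2 hs
      refine Summable.of_norm_bounded (h1.mul_left (1 + ‖R 1‖)) fun n => ?_
      rw [Real.norm_of_nonneg (by positivity), div_eq_mul_one_div]
      refine mul_le_mul_of_nonneg_right ?_ (by positivity)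
      refine (norm_sub_le _ _).trans (add_le_add (hχb n) ?_)
      split_ifs <;> simp
  have hU : IsOpen {s : ℂ | -1 < s.re} := isOpen_lt continuous_const Complex.continuous_re
  have hpre : IsPreconnected {s : ℂ | -1 < s.re} := (convex_halfSpace_re_gt (-1)).isPreconnected
  have key : Set.EqOn (fun s => χ.LFunction s - R 1)
      (fun s => (Complex.Gamma s)⁻¹ * mellin G s) {s : ℂ | -1 < s.re} := by
    refine AnalyticOnNhd.eqOn_of_preconnected_of_eventuallyEq (𝕜 := ℂ) (z₀ := 2) ?_ ?_ hpre
      (by simp; norm_num) ?_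
    · exact DifferentiableOn.analyticOnNhd
        (((DirichletCharacter.differentiable_LFunction hχ).sub_const _).differentiableOn) hU
    · refine DifferentiableOn.analyticOnNhd (fun s hs => ?_) hU
      exact ((Complex.differentiable_one_div_Gamma s).mul (hmel s hs)).differentiableWithinAt
    · have : {s : ℂ | 1 < s.re} ∈ 𝓝 (2 : ℂ) :=
        (isOpen_lt continuous_const Complex.continuous_re).mem_nhds (by simp)
      filter_upwards [this] with s hs
      have hg : Complex.Gamma s ≠ 0 := Complex.Gamma_ne_zero_of_re_pos (by
        have : 1 < s.re := hs
        linarith)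
      rw [hsumG s hs, inv_mul_cancel_left₀ hg]
  have h0 := key (show (0 : ℂ) ∈ {s : ℂ | -1 < s.re} by simp)
  simp only [Complex.Gamma_zero, inv_zero, zero_mul] at h0
  rw [← hR1]
  exact sub_eq_zero.1 h0

open Finset in
theorem DirichletCharacter.sum_range_eq_zero {f : ℕ} [NeZero f] (χ : DirichletCharacter ℂ f)
    (hχ : χ ≠ 1) : ∑ a ∈ range f, χ a = 0 := by
  rw [← MulChar.sum_eq_zero_of_ne_one hχ]
  refine Finset.sum_nbij (fun a => (a : ZMod f)) (by simp) ?_ ?_ (by simp)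
  · intro a ha b hb h
    have := congrArg ZMod.val h
    simp only [coe_range, Set.mem_Iio] at ha hb
    simpa [ZMod.val_cast_of_lt ha, ZMod.val_cast_of_lt hb] using this
  · intro b _
    exact ⟨b.val, by simpa using ZMod.val_lt b, by simp⟩

open Finset in
/-- `L(-k, χ) = -f ^ k / (k + 1) ∑ χ(a) B_{k + 1}(a / f)`. -/
theorem DirichletCharacter.LFunction_neg_natCast {f : ℕ} [NeZero f] (χ : DirichletCharacter ℂ f)
    (hχ : χ ≠ 1) (k : ℕ) :
    χ.LFunction (-(k : ℂ)) = -((f : ℂ) ^ k / (k + 1)) *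
      ∑ a ∈ range f, χ a * Polynomial.aeval ((a : ℂ) / f) (Polynomial.bernoulli (k + 1)) := by
  have hf : (f : ℂ) ≠ 0 := NeZero.ne _
  -- For k = 0 the constant of B₁(x) = x - 1/2 drops out because ∑ χ(a) = 0; for k > 0 the values of
  -- the Hurwitz zeta function are summed.
  rcases Nat.eq_zero_or_pos k with rfl | hk
  · simp only [Nat.cast_zero, neg_zero, χ.LFunction_zero_eq_sum hχ, pow_zero, zero_add,
      Polynomial.bernoulli_one]
    simp only [map_sub, Polynomial.aeval_X, Polynomial.aeval_C, mul_sub, sum_sub_distrib,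
      ← sum_mul, χ.sum_range_eq_zero hχ]
    simp only [mul_div_assoc', ← sum_div]
    ring
  · rw [DirichletCharacter.LFunction, ZMod.LFunction, neg_neg, Complex.cpow_natCast]
    have h1 : ∑ j : ZMod f, χ j * HurwitzZeta.hurwitzZeta (ZMod.toAddCircle j) (-(k : ℂ)) =
        ∑ a ∈ range f, χ a * (-1 / (k + 1) *
          Polynomial.aeval ((a : ℂ) / f) (Polynomial.bernoulli (k + 1))) := by
      symm
      refine Finset.sum_nbij (fun a => (a : ZMod f)) (by simp) ?_ ?_ ?_
      · intro a ha b hb h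
        have := congrArg ZMod.val h
        simp only [coe_range, Set.mem_Iio] at ha hb
        simpa [ZMod.val_cast_of_lt ha, ZMod.val_cast_of_lt hb] using this
      · intro b _
        exact ⟨b.val, by simpa using ZMod.val_lt b, by simp⟩
      · intro a ha
        have ha' : a < f := by simpa using ha
        have hmem : ((a : ℝ) / f) ∈ Set.Icc (0 : ℝ) 1 :=
          ⟨by positivity, div_le_one_of_le₀ (by exact_mod_cast ha'.le) (by positivity)⟩
        rw [ZMod.toAddCircle_apply, ZMod.val_cast_of_lt ha',
          HurwitzZeta.hurwitzZeta_neg_nat hk.ne' hmem, Polynomial.eval_map_algebraMap]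
        simp
    rw [h1]
    simp only [mul_left_comm _ (-1 / ((k : ℂ) + 1)), ← mul_sum]
    ring

/-- The exponential generating function of the values `L(-k, χ)`. -/
noncomputable def DirichletCharacter.LSer {f : ℕ} [NeZero f] (χ : DirichletCharacter ℂ f) :
    PowerSeries ℂ :=
  PowerSeries.mk fun k => χ.LFunction (-(k : ℂ)) / (k.factorial : ℂ)

-- By the Bernoulli formula, -f t times the series is ∑ χ(a) times the Bernoulli generating function
-- at a/f, rescaled by f. Multiplying by e^{ft} - 1 clears all the denominators. The identity stays
-- in multiplied form since 1 - e^{ft} is not invertible.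
open Finset PowerSeries in
theorem DirichletCharacter.LSer_mul {f : ℕ} [NeZero f] (χ : DirichletCharacter ℂ f)
    (hχ : χ ≠ 1) :
    (1 - exp ℂ ^ f) * χ.LSer = ∑ a ∈ range f, C (χ a) * exp ℂ ^ a := by
  have hf : (f : ℂ) ≠ 0 := NeZero.ne _
  set B : ℂ → PowerSeries ℂ := fun x =>
    PowerSeries.mk fun n => Polynomial.aeval x ((1 / n.factorial : ℚ) • Polynomial.bernoulli n) with hB
  have h1 : ∀ x : ℂ, rescale (f : ℂ) (B x) * (exp ℂ ^ f - 1) =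
      C (f : ℂ) * X * rescale (x * f) (exp ℂ) := by
    intro x
    have := congrArg (rescale (f : ℂ)) (Polynomial.bernoulli_generating_function x)
    rw [map_mul, map_sub, map_one, map_mul, rescale_X, ← exp_pow_eq_rescale_exp, rescale_rescale]
      at this
    exact this
  have h2 : ∑ a ∈ range f, C (χ a) * rescale (f : ℂ) (B ((a : ℂ) / f)) =
      -(C (f : ℂ) * X * χ.LSer) := by
    ext n
    rw [map_sum, map_neg, mul_assoc, coeff_C_mul]
    simp only [coeff_C_mul, coeff_rescale, hB, coeff_mk, map_smul]
    cases n with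
    | zero => simp [χ.sum_range_eq_zero hχ]
    | succ k =>
      rw [coeff_succ_X_mul, LSer, coeff_mk, χ.LFunction_neg_natCast hχ]
      have h3 : (((k + 1).factorial : ℕ) : ℂ) = (k + 1) * (k.factorial : ℂ) := by
        rw [Nat.factorial_succ]; push_cast; ring
      have h4 : (k.factorial : ℂ) ≠ 0 := by exact_mod_cast k.factorial_ne_zero
      have h5 : (k : ℂ) + 1 ≠ 0 := by exact_mod_cast k.succ_ne_zero
      simp only [Rat.smul_def, mul_left_comm (χ _), ← mul_sum]
      push_cast
      rw [h3]
      field_simp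
      ring
  have h6 : C (f : ℂ) * X * ((1 - exp ℂ ^ f) * χ.LSer) =
      C (f : ℂ) * X * ∑ a ∈ range f, C (χ a) * exp ℂ ^ a := by
    have h7 := congrArg (· * (exp ℂ ^ f - 1)) h2
    simp only [sum_mul, mul_assoc, h1] at h7
    rw [mul_sum]
    have h8 : C (f : ℂ) * X * ((1 - exp ℂ ^ f) * χ.LSer) =
        -(C (f : ℂ) * (X * χ.LSer)) * (exp ℂ ^ f - 1) := by ring
    rw [h8, ← h7]
    refine Finset.sum_congr rfl fun a _ => ?_
    rw [div_mul_cancel₀ _ hf, ← exp_pow_eq_rescale_exp]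
    ring
  refine mul_left_cancel₀ (mul_ne_zero ?_ X_ne_zero) h6
  rw [Ne, map_eq_zero_iff _ C_injective]
  exact hf

/-! ### Twisted generating series and the splitting by parity -/

section GeneratingSeries

open Finset PowerSeries

/-- The rational function ∑ v(a) x^a / (1 - x^f) does not change if the period f is replaced by a
multiple. -/
theorem sum_range_mul_periodic {R : Type*} [CommRing R] (v : ℕ → R) (f : ℕ)
    (hv : ∀ n, v (n + f) = v n) (x : R) (r : ℕ) :
    (∑ a ∈ range (f * r), v a * x ^ a) * (1 - x ^ f) =
      (∑ a ∈ range f, v a * x ^ a) * (1 - x ^ (f * r)) := by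
  have hv' : ∀ r n, v (f * r + n) = v n := by
    intro r
    induction r with
    | zero => simp
    | succ r ih => intro n; rw [mul_add_one, add_right_comm, hv, ih]
  induction r with
  | zero => simp
  | succ r ih =>
    have h : ∑ a ∈ range f, v (f * r + a) * x ^ (f * r + a) =
        x ^ (f * r) * ∑ a ∈ range f, v a * x ^ a := by
      rw [mul_sum]
      exact Finset.sum_congr rfl fun a _ => by rw [hv', pow_add]; ring
    rw [mul_add_one, sum_range_add, add_mul, ih, h, pow_add]
    ring

/-- The power series `∑ v(a) (ω e^t)^a / (1 - (ω e^t)^D)`, the sum being over `a < D`. -/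
noncomputable def twistSer (D : ℕ) (v : ℕ → ℂ) (ω : ℂ) : PowerSeries ℂ :=
  (∑ a ∈ range D, C (v a) * (C ω * exp ℂ) ^ a) * (1 - (C ω * exp ℂ) ^ D)⁻¹

/-- The coefficients of the exponential generating series `twistSer D v ω`. -/
noncomputable def twistCoeff (D : ℕ) (v : ℕ → ℂ) (ω : ℂ) (k : ℕ) : ℂ :=
  (k.factorial : ℂ) * coeff k (twistSer D v ω)

theorem constantCoeff_one_sub_pow (D : ℕ) (ω : ℂ) :
    constantCoeff (1 - (C ω * exp ℂ) ^ D) = 1 - ω ^ D := by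
  simp

theorem twistSer_mul {D : ℕ} (v : ℕ → ℂ) {ω : ℂ} (hω : ω ^ D ≠ 1) :
    twistSer D v ω * (1 - (C ω * exp ℂ) ^ D) = ∑ a ∈ range D, C (v a) * (C ω * exp ℂ) ^ a := by
  rw [twistSer, mul_assoc, PowerSeries.inv_mul_cancel, mul_one]
  rw [constantCoeff_one_sub_pow]
  exact sub_ne_zero.2 hω.symm

theorem one_sub_pow_ne_zero {D : ℕ} {ω : ℂ} (hω : ω ^ D ≠ 1) :
    (1 - (C ω * exp ℂ) ^ D : PowerSeries ℂ) ≠ 0 := by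
  intro h
  have := constantCoeff_one_sub_pow D ω
  rw [h, map_zero] at this
  exact sub_ne_zero.2 hω.symm this.symm

theorem coeff_C_mul_exp_pow (ω : ℂ) (a k : ℕ) :
    coeff k ((C ω * exp ℂ) ^ a) = ω ^ a * (a : ℂ) ^ k / (k.factorial : ℂ) := by
  rw [mul_pow, ← map_pow, coeff_C_mul, exp_pow_eq_rescale_exp, coeff_rescale, coeff_exp]
  simp
  ring

/-- Comparison of the coefficients of t^k in `twistSer_mul`. The only denominator is 1 - ω^D, which
gives integrality, and every lower term carries a positive power of D, so it disappears modulo ℓ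
once ℓ divides D. -/
theorem twistCoeff_rec {D : ℕ} (v : ℕ → ℂ) {ω : ℂ} (hω : ω ^ D ≠ 1) (k : ℕ) :
    (1 - ω ^ D) * twistCoeff D v ω k = ∑ a ∈ range D, v a * ω ^ a * (a : ℂ) ^ k +
      ω ^ D * ∑ j ∈ range k, (k.choose j : ℂ) * (D : ℂ) ^ (k - j) * twistCoeff D v ω j := by
  have h := congrArg (coeff k) (twistSer_mul v hω)
  rw [mul_sub, mul_one, map_sub, map_sum, coeff_mul, Nat.sum_antidiagonal_eq_sum_range_succ_mk,
    sum_range_succ] at h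
  simp only [coeff_C_mul, coeff_C_mul_exp_pow, Nat.sub_self, pow_zero, Nat.factorial_zero,
    Nat.cast_one, div_one, mul_one] at h
  have hk : (k.factorial : ℂ) ≠ 0 := by exact_mod_cast k.factorial_ne_zero
  have h1 : ∑ a ∈ range D, v a * ω ^ a * (a : ℂ) ^ k = (k.factorial : ℂ) *
      ∑ a ∈ range D, v a * (ω ^ a * (a : ℂ) ^ k / (k.factorial : ℂ)) := by
    rw [mul_sum]
    exact Finset.sum_congr rfl fun a _ => by field_simp
  have h2 : ω ^ D * ∑ j ∈ range k, (k.choose j : ℂ) * (D : ℂ) ^ (k - j) * twistCoeff D v ω j =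
      (k.factorial : ℂ) * ∑ j ∈ range k, coeff j (twistSer D v ω) *
        (ω ^ D * (D : ℂ) ^ (k - j) / ((k - j).factorial : ℂ)) := by
    rw [mul_sum, mul_sum]
    refine Finset.sum_congr rfl fun j hj => ?_
    have hj' : j ≤ k := (mem_range.1 hj).le
    rw [twistCoeff, Nat.cast_choose ℂ hj']
    have h3 : (j.factorial : ℂ) ≠ 0 := by exact_mod_cast j.factorial_ne_zero
    have h4 : ((k - j).factorial : ℂ) ≠ 0 := by exact_mod_cast (k - j).factorial_ne_zero
    field_simp
  rw [h1, h2, ← h, twistCoeff]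
  ring

/-- Passing from the period D to D r turns the denominator into 1 - e^{D r t}, free of ω, so that
series for different ω can be added and compared with the series of L-values. -/
theorem one_sub_exp_pow_mul_twistSer {D : ℕ} (v : ℕ → ℂ) (hv : ∀ n, v (n + D) = v n) {ω : ℂ}
    (hω : ω ^ D ≠ 1) {r : ℕ} (hr : ω ^ r = 1) :
    (1 - exp ℂ ^ (D * r)) * twistSer D v ω =
      ∑ a ∈ range (D * r), C (v a * ω ^ a) * exp ℂ ^ a := by
  have h := sum_range_mul_periodic (fun a => (C (v a) : PowerSeries ℂ)) D (by simp [hv])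
    (C ω * exp ℂ) r
  rw [← twistSer_mul v hω, mul_pow _ _ (D * r), ← map_pow, mul_comm D r, pow_mul ω r D, hr,
    one_pow, map_one, one_mul] at h
  have h2 : ∑ a ∈ range (D * r), C (v a * ω ^ a) * exp ℂ ^ a =
      ∑ a ∈ range (r * D), (C (v a) : PowerSeries ℂ) * (C ω * exp ℂ) ^ a := by
    rw [mul_comm D r]
    exact Finset.sum_congr rfl fun a _ => by rw [map_mul, map_pow, mul_pow, mul_assoc]
  rw [h2]
  refine mul_right_cancel₀ (one_sub_pow_ne_zero hω) ?_
  rw [h, mul_comm D r]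
  ring

/-- The truncation of a function on `{0, …, D - 1}` to the lower half of this interval. -/
noncomputable def lowerHalf (D : ℕ) (v : ℕ → ℂ) (a : ℕ) : ℂ := if 2 * a < D then v a else 0

/-- The upper half is reflected by a ↦ D - a, under which 0 has no partner. -/
theorem sum_range_eq_lower_add_upper {M : Type*} [AddCommMonoid M] (D : ℕ) (w : ℕ → M)
    (hm : ∀ a, 2 * a = D → w a = 0) :
    ∑ a ∈ range D, w a = ∑ a ∈ range D with 2 * a < D, w a +
      ∑ a ∈ range D with 2 * a < D, (if a = 0 then 0 else w (D - a)) := by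
  rw [← Finset.sum_filter_add_sum_filter_not (range D) (fun a => 2 * a < D) w]
  congr 1
  rw [← Finset.sum_filter_of_ne (p := fun a => ¬ 2 * a = D) (fun a _ h h' => h (hm a h'))]
  rw [← Finset.sum_filter_of_ne (s := (range D).filter (fun a => 2 * a < D)) (p := fun a => ¬ a = 0)
    (fun a _ h h' => h (by simp [h']))]
  refine Finset.sum_nbij' (fun a => D - a) (fun a => D - a) ?_ ?_ ?_ ?_ ?_
  · intro a ha
    simp only [mem_filter, mem_range] at ha ⊢
    omega
  · intro a ha
    simp only [mem_filter, mem_range] at ha ⊢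
    omega
  · intro a ha
    simp only [mem_filter, mem_range] at ha
    omega
  · intro a ha
    simp only [mem_filter, mem_range] at ha
    omega
  · intro a ha
    simp only [mem_filter, mem_range] at ha
    rw [if_neg (by omega), Nat.sub_sub_self (by omega)]

/-- With Y = ω e^t, the reflection a ↦ D - a turns the upper half of the numerator into s Y^D ∑ v(a)
Y^{-a}, and Y^D / (1 - Y^D) = -1 / (1 - Y^{-D}). The substitution t ↦ -t, ω ↦ ω⁻¹ is Y ↦ Y⁻¹. -/
theorem twistSer_eq_lowerHalf {D : ℕ} (v : ℕ → ℂ) {ω s : ℂ} (hω0 : ω ≠ 0) (hω : ω ^ D ≠ 1)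
    (h0 : v 0 = 0) (hm : ∀ a, 2 * a = D → v a = 0) (hs : ∀ a ≤ D, v (D - a) = s * v a) :
    twistSer D v ω = twistSer D (lowerHalf D v) ω -
      C s * evalNegHom (twistSer D (lowerHalf D v) ω⁻¹) := by
  have hω' : ω⁻¹ ^ D ≠ 1 := by
    rw [inv_pow]
    exact inv_ne_one.2 hω
  set Y : PowerSeries ℂ := C ω * exp ℂ with hY
  set Z : PowerSeries ℂ := C ω⁻¹ * evalNegHom (exp ℂ) with hZ
  have hYZ : Y * Z = 1 := by
    calc Y * Z = C ω * C ω⁻¹ * (exp ℂ * evalNegHom (exp ℂ)) := by ring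
      _ = 1 := by rw [exp_mul_exp_neg_eq_one, ← map_mul, mul_inv_cancel₀ hω0, map_one, one_mul]
  have heC : ∀ c : ℂ, evalNegHom (C c) = (C c : PowerSeries ℂ) := by
    intro c
    ext n
    rw [evalNegHom, coeff_rescale, coeff_C]
    by_cases h : n = 0 <;> simp [h]
  have hlow : ∀ x : PowerSeries ℂ, ∑ a ∈ range D, C (lowerHalf D v a) * x ^ a =
      ∑ a ∈ range D with 2 * a < D, C (v a) * x ^ a := by
    intro x
    rw [Finset.sum_filter]
    refine Finset.sum_congr rfl fun a _ => ?_
    by_cases h : 2 * a < D <;> simp [lowerHalf, h]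
  have h1 := congrArg evalNegHom (twistSer_mul (lowerHalf D v) hω')
  rw [map_mul, map_sub, map_one, map_pow, map_mul, heC, ← hZ, map_sum] at h1
  simp only [map_mul, map_pow, heC] at h1
  rw [← hZ, hlow] at h1
  have h2 := twistSer_mul (lowerHalf D v) hω
  rw [← hY, hlow] at h2
  have h3 := twistSer_mul v hω
  rw [← hY, sum_range_eq_lower_add_upper D (fun a => C (v a) * Y ^ a)
    (fun a ha => by simp [hm a ha])] at h3
  have h4 : ∑ a ∈ range D with 2 * a < D, (if a = 0 then 0 else C (v (D - a)) * Y ^ (D - a)) =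
      C s * Y ^ D * ∑ a ∈ range D with 2 * a < D, C (v a) * Z ^ a := by
    rw [mul_sum]
    refine Finset.sum_congr rfl fun a ha => ?_
    simp only [mem_filter, mem_range] at ha
    by_cases ha0 : a = 0
    · simp [ha0, h0]
    · rw [if_neg ha0, hs a (by omega), map_mul]
      have h5 : Y ^ D * Z ^ a = Y ^ (D - a) := by
        conv_lhs => rw [← Nat.sub_add_cancel ha.1.le, pow_add, mul_assoc, ← mul_pow, hYZ, one_pow,
          mul_one]
      rw [← h5]
      ring
  rw [h4, ← h1, ← h2] at h3
  have h6 : Y ^ D * Z ^ D = 1 := by rw [← mul_pow, hYZ, one_pow]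
  refine mul_right_cancel₀ (one_sub_pow_ne_zero hω) ?_
  rw [← hY, h3]
  linear_combination -(C s * evalNegHom (twistSer D (lowerHalf D v) ω⁻¹)) * h6

theorem twistCoeff_eq_lowerHalf {D : ℕ} (v : ℕ → ℂ) {ω s : ℂ} (hω0 : ω ≠ 0) (hω : ω ^ D ≠ 1)
    (h0 : v 0 = 0) (hm : ∀ a, 2 * a = D → v a = 0) (hs : ∀ a ≤ D, v (D - a) = s * v a) (k : ℕ) :
    twistCoeff D v ω k = twistCoeff D (lowerHalf D v) ω k -
      s * (-1) ^ k * twistCoeff D (lowerHalf D v) ω⁻¹ k := by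
  rw [twistCoeff, twistSer_eq_lowerHalf v hω0 hω h0 hm hs, map_sub, coeff_C_mul, evalNegHom,
    coeff_rescale, twistCoeff, twistCoeff]
  ring

end GeneratingSeries

/-! ### Splitting off the p-part, Gauss sums and the formula for L(-k, χ) -/

/-- A Dirichlet character of modulus `m * n`, with `m` and `n` coprime, is a product of characters
of modulus `m` and `n`. -/
theorem DirichletCharacter.exists_changeLevel_mul {m n : ℕ} (h : m.Coprime n)
    (χ : DirichletCharacter ℂ (m * n)) :
    ∃ (θ : DirichletCharacter ℂ m) (ψ : DirichletCharacter ℂ n),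
      χ = changeLevel (dvd_mul_right m n) θ * changeLevel (dvd_mul_left n m) ψ := by
  let e : ZMod (m * n) ≃+* ZMod m × ZMod n := ZMod.chineseRemainder h
  let E : (ZMod (m * n))ˣ ≃* (ZMod m)ˣ × (ZMod n)ˣ :=
    (Units.mapEquiv e.toMulEquiv).trans MulEquiv.prodUnits
  let θ' : (ZMod m)ˣ →* ℂˣ := χ.toUnitHom.comp (E.symm.toMonoidHom.comp (MonoidHom.inl _ _))
  let ψ' : (ZMod n)ˣ →* ℂˣ := χ.toUnitHom.comp (E.symm.toMonoidHom.comp (MonoidHom.inr _ _))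
  refine ⟨MulChar.ofUnitHom θ', MulChar.ofUnitHom ψ', ?_⟩
  refine MulChar.ext fun u => ?_
  have h1 : (E u).1 = ZMod.unitsMap (dvd_mul_right m n) u := by
    apply Units.ext
    change (e (u : ZMod (m * n))).1 = ZMod.castHom (dvd_mul_right m n) (ZMod m) (u : ZMod (m * n))
    exact DFunLike.congr_fun (RingHom.ext_zmod ((RingHom.fst _ _).comp e.toRingHom)
      (ZMod.castHom (dvd_mul_right m n) (ZMod m))) _
  have h2 : (E u).2 = ZMod.unitsMap (dvd_mul_left n m) u := by
    apply Units.ext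
    change (e (u : ZMod (m * n))).2 = ZMod.castHom (dvd_mul_left n m) (ZMod n) (u : ZMod (m * n))
    exact DFunLike.congr_fun (RingHom.ext_zmod ((RingHom.snd _ _).comp e.toRingHom)
      (ZMod.castHom (dvd_mul_left n m) (ZMod n))) _
  have h3 : E.symm ((E u).1, 1) * E.symm (1, (E u).2) = u := by
    rw [← map_mul]
    simp
  rw [MulChar.mul_apply, changeLevel_eq_cast_of_dvd, changeLevel_eq_cast_of_dvd]
  have h4 : ((u : ZMod (m * n)).cast : ZMod m) = ((E u).1 : (ZMod m)ˣ) := by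
    rw [h1]; rfl
  have h5 : ((u : ZMod (m * n)).cast : ZMod n) = ((E u).2 : (ZMod n)ˣ) := by
    rw [h2]; rfl
  rw [h4, h5, MulChar.ofUnitHom_coe, MulChar.ofUnitHom_coe]
  have h6 : (χ.toUnitHom (E.symm ((E u).1, 1)) : ℂ) * χ.toUnitHom (E.symm (1, (E u).2)) = χ u := by
    rw [← Units.val_mul, ← map_mul, h3, MulChar.coe_toUnitHom]
  exact h6.symm

open Finset in
theorem DirichletCharacter.sum_mul_eq_sum_units {m : ℕ} [NeZero m] (ψ : DirichletCharacter ℂ m)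
    {M : Type*} [CommRing M] (c : ℂ →+* M) (g : ZMod m → M) :
    ∑ b, c (ψ b) * g b = ∑ u : (ZMod m)ˣ, c (ψ u) * g u := by
  classical
  symm
  rw [← Finset.sum_image (s := (univ : Finset (ZMod m)ˣ)) (g := fun u => (u : ZMod m))
    (f := fun b => c (ψ b) * g b) (fun _ _ _ _ h => Units.ext h)]
  refine Finset.sum_subset (subset_univ _) fun b _ hb => ?_
  rw [ψ.map_nonunit, map_zero, zero_mul]
  rintro ⟨u, rfl⟩
  exact hb (mem_image_of_mem _ (mem_univ u))

open Finset in
/-- The Gauss sum expansion of a primitive character. -/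
theorem DirichletCharacter.exists_gauss_expansion {m : ℕ} [NeZero m] (ψ : DirichletCharacter ℂ m)
    (hψ : ψ.IsPrimitive) {ζ : ℂ} (hζ : IsPrimitiveRoot ζ m) :
    ∃ τ τ' : ℂ, IsIntegral ℤ τ ∧ IsIntegral ℤ τ' ∧ τ * τ' = m ∧
      ∀ a : ℕ, ∑ u : (ZMod m)ˣ, ψ⁻¹ u * (ζ ^ (u : ZMod m).val) ^ a = τ * ψ a := by
  have hψ' : (ψ⁻¹).IsPrimitive := by
    rw [isPrimitive_def, conductor_inv]
    exact hψ
  let e : AddChar (ZMod m) ℂ := AddChar.zmodChar m hζ.pow_eq_one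
  have he : e.IsPrimitive := AddChar.zmodChar_primitive_of_primitive_root m hζ
  have heval : ∀ b : ZMod m, e b = ζ ^ b.val := fun b => AddChar.zmodChar_apply _ b
  have hroot : ∀ b : ZMod m, IsIntegral ℤ (e b) := fun b => by
    rw [heval]
    exact (hζ.isIntegral (NeZero.pos m)).pow _
  have hchar : ∀ (χ : DirichletCharacter ℂ m) (b : ZMod m), IsIntegral ℤ (χ b) := by
    intro χ b
    by_cases hb : IsUnit b
    · obtain ⟨u, rfl⟩ := hb
      refine IsIntegral.of_pow (orderOf_pos u) ?_
      rw [← map_pow, ← Units.val_pow_eq_pow_val, pow_orderOf_eq_one]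
      simpa using isIntegral_one
    · rw [χ.map_nonunit hb]
      exact isIntegral_zero
  have hexp : ∀ a : ZMod m, ∑ b, ψ⁻¹ b * e (a * b) = gaussSum ψ⁻¹ e * ψ a := by
    intro a
    have := gaussSum_mulShift_of_isPrimitive e hψ' a
    rw [inv_inv, mul_comm] at this
    rw [← this]
    rfl
  -- The second sum serves only to show that τ divides m in the algebraic integers, hence that τ is
  -- a unit wherever m is.
  refine ⟨gaussSum ψ⁻¹ e, ∑ a, ψ a * e (-a), ?_, ?_, ?_, ?_⟩
  · exact IsIntegral.sum _ fun b _ => (hchar _ _).mul (hroot _)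
  · exact IsIntegral.sum _ fun b _ => (hchar _ _).mul (hroot _)
  · rw [mul_sum]
    calc ∑ a, gaussSum ψ⁻¹ e * (ψ a * e (-a)) = ∑ a, ∑ b, ψ⁻¹ b * e (a * (b - 1)) := by
          refine sum_congr rfl fun a _ => ?_
          rw [← mul_assoc, ← hexp, sum_mul]
          refine sum_congr rfl fun b _ => ?_
          rw [mul_assoc, ← AddChar.map_add_eq_mul]
          ring_nf
      _ = ∑ b, ψ⁻¹ b * ∑ a, e (a * (b - 1)) := by
          rw [sum_comm]
          exact sum_congr rfl fun b _ => (mul_sum _ _ _).symm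
      _ = m := by
          classical
          simp only [AddChar.sum_mulShift _ he, sub_eq_zero]
          rw [sum_eq_single 1 (by intro b _ hb; simp [hb]) (by simp)]
          simp
  · intro a
    rw [← hexp]
    refine Eq.trans ?_ (ψ⁻¹.sum_mul_eq_sum_units (RingHom.id ℂ) (fun b => e (a * b))).symm
    refine sum_congr rfl fun u _ => ?_
    rw [RingHom.id_apply, ← nsmul_eq_mul, AddChar.map_nsmul_eq_pow, heval]

open Finset PowerSeries in
/-- The value `L(-k, χ)` for a primitive character `χ` of modulus `d * p ^ n`, as twice a sum over
primitive `p ^ n`-th roots of unity. -/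
theorem DirichletCharacter.exists_LFunction_neg_formula {p : ℕ} [Fact p.Prime] {d n D : ℕ}
    (hd : d.Coprime p) [NeZero (d * p ^ n)] (χ : DirichletCharacter ℂ (d * p ^ n))
    (hχ : χ.IsPrimitive) {k : ℕ} (hpar : χ (-1) * (-1) ^ k = -1) (hdD : d ∣ D)
    (hpD : p ^ 2 ∣ D) (hDn : ¬ p ^ n ∣ D) {ζ : ℂ} (hζ : IsPrimitiveRoot ζ (p ^ n)) :
    ∃ (θ : DirichletCharacter ℂ d) (ψ : DirichletCharacter ℂ (p ^ n)) (τ τ' : ℂ),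
      χ = changeLevel (dvd_mul_right d (p ^ n)) θ * changeLevel (dvd_mul_left (p ^ n) d) ψ ∧
      ψ.IsPrimitive ∧ IsIntegral ℤ τ ∧ IsIntegral ℤ τ' ∧ τ * τ' = (p ^ n : ℕ) ∧
      τ * χ.LFunction (-(k : ℂ)) = 2 * ∑ u : (ZMod (p ^ n))ˣ, ψ⁻¹ u *
        twistCoeff D (lowerHalf D fun a => if p ∣ a then 0 else θ a) (ζ ^ (u : ZMod (p ^ n)).val) k
      := by
  have hp : p.Prime := Fact.out
  have hd0 : d ≠ 0 := fun h => NeZero.ne (d * p ^ n) (by simp [h])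
  have : NeZero d := ⟨hd0⟩
  have : NeZero (p ^ n) := ⟨pow_ne_zero _ hp.ne_zero⟩
  have hn : n ≠ 0 := by
    rintro rfl
    exact hDn (by simp)
  have hcop : d.Coprime (p ^ n) := hd.pow_right n
  obtain ⟨θ, ψ, hdec⟩ := χ.exists_changeLevel_mul hcop
  have hψ : ψ.IsPrimitive := by
    have h1 := conductor_mul_dvd_lcm_conductor (changeLevel (dvd_mul_right d (p ^ n)) θ)
      (changeLevel (dvd_mul_left (p ^ n) d) ψ)
    rw [← hdec, hχ, conductor_changeLevel, conductor_changeLevel] at h1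
    have h2 : d * p ^ n ∣ d * ψ.conductor :=
      h1.trans (Nat.lcm_dvd (θ.conductor_dvd_level.mul_right _) (dvd_mul_left _ _))
    exact Nat.dvd_antisymm ψ.conductor_dvd_level (Nat.dvd_of_mul_dvd_mul_left (NeZero.pos d) h2)
  obtain ⟨τ, τ', hτ, hτ', hττ', hgauss⟩ := ψ.exists_gauss_expansion hψ hζ
  refine ⟨θ, ψ, τ, τ', hdec, hψ, hτ, hτ', hττ', ?_⟩
  have hval : ∀ a : ℤ, χ a = θ a * ψ a := by
    intro a
    by_cases ha : IsCoprime a ((d * p ^ n : ℕ) : ℤ)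
    · rw [hdec, MulChar.mul_apply, changeLevel_eq_cast_of_dvd' _ _ ha,
        changeLevel_eq_cast_of_dvd' _ _ ha]
    · rw [(χ.apply_eq_zero_iff a).2 ha]
      rw [Nat.cast_mul, IsCoprime.mul_right_iff, not_and_or] at ha
      rcases ha with ha | ha
      · rw [(θ.apply_eq_zero_iff a).2 ha, zero_mul]
      · rw [(ψ.apply_eq_zero_iff a).2 ha, mul_zero]
  set φ : ℕ → ℂ := fun a => if p ∣ a then 0 else θ a with hφ
  have hpD' : p ∣ D := (dvd_pow_self p two_ne_zero).trans hpD
  have hφper : ∀ a, φ (a + D) = φ a := by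
    intro a
    obtain ⟨r, hr⟩ := hdD
    simp only [hφ, (Nat.dvd_add_iff_left hpD').symm]
    rw [hr]
    simp
  have hφ0 : φ 0 = 0 := by simp [hφ]
  -- The midpoint must not contribute. For p = 2 this needs p² ∣ D: then D/2 is still even.
  have hφm : ∀ a, 2 * a = D → φ a = 0 := by
    intro a ha
    have h1 : p ∣ a := by
      obtain ⟨r, hr⟩ := hpD
      rw [hr] at ha
      rcases hp.eq_two_or_odd' with h2 | h2
      · subst h2
        exact ⟨r, by nlinarith⟩
      · have h3 : p ∣ 2 * a := by rw [ha, pow_two, mul_assoc]; exact dvd_mul_right _ _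
        exact (Nat.Coprime.dvd_of_dvd_mul_left (Nat.Coprime.symm
          (Nat.coprime_two_left.2 h2)) h3)
    simp [hφ, h1]
  have hφs : ∀ a ≤ D, φ (D - a) = θ (-1) * φ a := by
    intro a ha
    have h1 : p ∣ D - a ↔ p ∣ a := by
      rw [Nat.dvd_sub_iff_right ha hpD']
    obtain ⟨r, hr⟩ := hdD
    have h2 : ((D - a : ℕ) : ZMod d) = -1 * (a : ZMod d) := by
      rw [Nat.cast_sub ha, hr]
      simp
    simp only [hφ, h1, h2, map_mul, mul_ite, mul_zero]
  have hne : ∀ u : (ZMod (p ^ n))ˣ, (ζ ^ (u : ZMod (p ^ n)).val) ^ D ≠ 1 := by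
    intro u h
    have hu := hζ.pow_of_coprime _ (ZMod.val_coe_unit_coprime u)
    exact hDn (hu.dvd_of_pow_eq_one D h)
  have hχ1 : χ ≠ 1 := by
    rintro rfl
    have h1 := (isPrimitive_def _).1 hχ
    rw [conductor_one] at h1
    have h2 : p ∣ 1 := by rw [h1]; exact (dvd_pow_self p hn).mul_left d
    exact hp.one_lt.ne' (Nat.dvd_one.1 h2)
  have hF : (1 - exp ℂ ^ (D * p ^ n)) * χ.LSer =
      ∑ a ∈ range (D * p ^ n), C (χ a) * exp ℂ ^ a := by
    obtain ⟨r, hr⟩ := hdD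
    have h1 := sum_range_mul_periodic (fun a => (C (χ a) : PowerSeries ℂ)) (d * p ^ n)
      (fun a => by rw [Nat.cast_add, ZMod.natCast_self, add_zero]) (exp ℂ) r
    have h3 : d * p ^ n * r = D * p ^ n := by rw [hr]; ring
    rw [← χ.LSer_mul hχ1, h3] at h1
    have h4 : (1 - exp ℂ ^ (d * p ^ n) : PowerSeries ℂ) ≠ 0 := by
      intro h
      have h5 := congrArg (coeff 1) h
      rw [exp_pow_eq_rescale_exp, map_sub, coeff_rescale, coeff_exp] at h5
      simp [coeff_one, hd0, hp.ne_zero] at h5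
    refine mul_right_cancel₀ h4 ?_
    rw [h1]
    ring
  -- After multiplication by 1 - e^{D p^n t}, this is the Gauss expansion of ψ applied to the
  -- coefficient of each e^{at}.
  have hser : C τ * χ.LSer = ∑ u : (ZMod (p ^ n))ˣ, C (ψ⁻¹ u) *
      twistSer D φ (ζ ^ (u : ZMod (p ^ n)).val) := by
    have hD0 : D ≠ 0 := fun h => hDn (by simp [h])
    have h4 : (1 - exp ℂ ^ (D * p ^ n) : PowerSeries ℂ) ≠ 0 := by
      intro h
      have h5 := congrArg (coeff 1) h
      rw [exp_pow_eq_rescale_exp, map_sub, coeff_rescale, coeff_exp] at h5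
      simp [coeff_one, hD0, hp.ne_zero] at h5
    refine mul_left_cancel₀ h4 ?_
    rw [mul_left_comm, hF, mul_sum, mul_sum]
    simp only [mul_left_comm (1 - exp ℂ ^ (D * p ^ n))]
    have h6 : ∀ u : (ZMod (p ^ n))ˣ, (1 - exp ℂ ^ (D * p ^ n)) *
        twistSer D φ (ζ ^ (u : ZMod (p ^ n)).val) =
        ∑ a ∈ range (D * p ^ n), C (φ a * (ζ ^ (u : ZMod (p ^ n)).val) ^ a) * exp ℂ ^ a := by
      intro u
      refine one_sub_exp_pow_mul_twistSer φ hφper (hne u) ?_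
      rw [← pow_mul, mul_comm, pow_mul, hζ.pow_eq_one, one_pow]
    simp only [h6, mul_sum]
    rw [sum_comm]
    refine sum_congr rfl fun a _ => ?_
    simp only [← mul_assoc, ← map_mul, ← sum_mul, ← map_sum]
    congr 2
    have h7 : χ a = φ a * ψ a := by
      have := hval a
      simp only [Int.cast_natCast] at this
      rw [this]
      by_cases hpa : p ∣ a
      · have h8 : ψ a = 0 := by
          have h9 := (ψ.apply_eq_zero_iff (a : ℤ)).2 (by
            rw [Nat.isCoprime_iff_coprime, Nat.coprime_pow_right_iff (Nat.pos_of_ne_zero hn)]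
            exact fun h => (Nat.Prime.coprime_iff_not_dvd hp).1 h.symm hpa)
          simpa using h9
        simp [h8]
      · simp [hφ, hpa]
    rw [h7, mul_left_comm, ← hgauss, mul_sum]
    exact sum_congr rfl fun u _ => by ring
  have hcoeff : τ * χ.LFunction (-(k : ℂ)) = ∑ u : (ZMod (p ^ n))ˣ, ψ⁻¹ u *
      twistCoeff D φ (ζ ^ (u : ZMod (p ^ n)).val) k := by
    have h1 := congrArg (fun g => (k.factorial : ℂ) * coeff k g) hser
    simp only [map_sum, coeff_C_mul, LSer, coeff_mk] at h1
    have hk : (k.factorial : ℂ) ≠ 0 := by exact_mod_cast k.factorial_ne_zero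
    rw [mul_left_comm, mul_div_cancel₀ _ hk, mul_sum] at h1
    rw [h1]
    exact sum_congr rfl fun u _ => by rw [twistCoeff]; ring
  rw [hcoeff]
  have hroot : ∀ u : (ZMod (p ^ n))ˣ, (ζ ^ (u : ZMod (p ^ n)).val)⁻¹ =
      ζ ^ ((-u : (ZMod (p ^ n))ˣ) : ZMod (p ^ n)).val := by
    intro u
    refine inv_eq_of_mul_eq_one_left ?_
    have h1 := AddChar.map_add_eq_mul (AddChar.zmodChar (p ^ n) hζ.pow_eq_one)
      ((-u : (ZMod (p ^ n))ˣ) : ZMod (p ^ n)) u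
    rw [Units.val_neg, neg_add_cancel, AddChar.map_zero_eq_one] at h1
    simp only [AddChar.zmodChar_apply] at h1
    rw [Units.val_neg]
    exact h1.symm
  -- Replacing u by -u inverts the root of unity and costs the sign ψ(-1).
  have hsum : ∑ u : (ZMod (p ^ n))ˣ, ψ⁻¹ u *
      twistCoeff D (lowerHalf D φ) (ζ ^ (u : ZMod (p ^ n)).val)⁻¹ k =
      ψ (-1) * ∑ u : (ZMod (p ^ n))ˣ, ψ⁻¹ u *
        twistCoeff D (lowerHalf D φ) (ζ ^ (u : ZMod (p ^ n)).val) k := by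
    rw [mul_sum]
    refine Fintype.sum_equiv (Equiv.neg _) _ _ fun u => ?_
    rw [hroot, Equiv.neg_apply, ← mul_assoc, Units.val_neg]
    congr 1
    have h1 : ψ (-1) * ψ⁻¹ (-1) = 1 := by
      rw [← MulChar.mul_apply, mul_inv_cancel, MulChar.one_apply isUnit_one.neg]
    rw [neg_eq_neg_one_mul (u : ZMod (p ^ n)), map_mul, ← mul_assoc, h1, one_mul]
  -- The total sign is -1, so the two halves are equal rather than opposite: this is the source of
  -- the factor 2.
  have hparity : θ (-1) * ψ (-1) * (-1) ^ k = -1 := by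
    have := hval (-1)
    push_cast at this
    rw [← this, hpar]
  have hterm : ∀ u : (ZMod (p ^ n))ˣ, ψ⁻¹ u * twistCoeff D φ (ζ ^ (u : ZMod (p ^ n)).val) k =
      ψ⁻¹ u * twistCoeff D (lowerHalf D φ) (ζ ^ (u : ZMod (p ^ n)).val) k -
        θ (-1) * (-1) ^ k * (ψ⁻¹ u *
          twistCoeff D (lowerHalf D φ) (ζ ^ (u : ZMod (p ^ n)).val)⁻¹ k) := by
    intro u
    rw [twistCoeff_eq_lowerHalf φ (pow_ne_zero _ (hζ.ne_zero (NeZero.ne _))) (hne u) hφ0 hφm hφs]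
    ring
  simp only [hterm, sum_sub_distrib, ← mul_sum, hsum]
  linear_combination -(∑ u : (ZMod (p ^ n))ˣ, ψ⁻¹ u *
        twistCoeff D (lowerHalf D φ) (ζ ^ (u : ZMod (p ^ n)).val) k) * hparity

/-! ### Units and roots of unity in ℤ_p -/

section PadicUnits

variable {p : ℕ} [Fact p.Prime]

theorem PadicInt.isUnit_iff_not_dvd (x : ℤ_[p]) : IsUnit x ↔ ¬ (p : ℤ_[p]) ∣ x := by
  rw [← PadicInt.norm_lt_one_iff_dvd, ← PadicInt.not_isUnit_iff, not_not]

theorem PadicInt.p_dvd_natCast_iff (n : ℕ) : (p : ℤ_[p]) ∣ n ↔ p ∣ n := by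
  rw [← PadicInt.norm_lt_one_iff_dvd, PadicInt.norm_natCast_lt_one_iff]

theorem PadicInt.pow_p_dvd_natCast_iff (e n : ℕ) : (p : ℤ_[p]) ^ e ∣ n ↔ p ^ e ∣ n := by
  have h := PadicInt.norm_int_le_pow_iff_dvd (p := p) (k := (n : ℤ)) (n := e)
  rw [PadicInt.norm_le_pow_iff_mem_span_pow, Ideal.mem_span_singleton] at h
  push_cast at h
  rw [h]
  exact_mod_cast Iff.rfl

theorem PadicInt.dvd_pow_sub_one {e : ℕ} {u : ℤ_[p]} (hu : (p : ℤ_[p]) ^ e ∣ u - 1) (m : ℕ) :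
    (p : ℤ_[p]) ^ e ∣ u ^ m - 1 :=
  hu.trans (sub_one_dvd_pow_sub_one u m)

/-- If `u ≡ 1` modulo `p²`, then `u ^ m - 1` is associated to `m * (u - 1)`. -/
theorem PadicInt.pow_sub_one_associated (m : ℕ) :
    ∀ u : ℤ_[p], (p : ℤ_[p]) ^ 2 ∣ u - 1 → Associated ((m : ℤ_[p]) * (u - 1)) (u ^ m - 1) := by
  induction m using Nat.recOnMul with
  | zero => intro u _; simp
  | one => intro u _; simp
  | prime r hr =>
    intro u hu
    -- u^r - 1 is (u - 1) times this sum, which is r modulo p². For r = p this is p times a unit,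
    -- for r ≠ p a unit; working modulo p² instead of p includes p = 2.
    have hS : (p : ℤ_[p]) ^ 2 ∣ (∑ i ∈ Finset.range r, u ^ i) - r := by
      have : (∑ i ∈ Finset.range r, u ^ i) - r = ∑ i ∈ Finset.range r, (u ^ i - 1) := by simp
      rw [this]
      exact Finset.dvd_sum fun i _ => PadicInt.dvd_pow_sub_one hu i
    rw [← geom_sum_mul]
    refine Associated.mul_right ?_ _
    obtain ⟨t, ht⟩ := hS
    rw [sub_eq_iff_eq_add] at ht
    rw [ht]
    by_cases hrp : r = p
    · subst hrp
      have h1 : IsUnit (1 + r * t : ℤ_[r]) := by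
        rw [PadicInt.isUnit_iff_not_dvd, dvd_add_left (dvd_mul_right _ _),
          ← isUnit_iff_dvd_one]
        exact PadicInt.prime_p.not_isUnit
      obtain ⟨v, hv⟩ := h1
      refine ⟨v, ?_⟩
      rw [hv]
      ring
    · have h1 : IsUnit (r : ℤ_[p]) := by
        rw [PadicInt.isUnit_iff_not_dvd, PadicInt.p_dvd_natCast_iff]
        exact fun h => hrp ((Nat.prime_dvd_prime_iff_eq Fact.out hr).1 h).symm
      have h2 : IsUnit ((p : ℤ_[p]) ^ 2 * t + r) := by
        rw [PadicInt.isUnit_iff_not_dvd] at h1 ⊢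
        rwa [← dvd_add_right (a := (p : ℤ_[p])) (b := (p : ℤ_[p]) ^ 2 * t)] at h1
        exact ((dvd_pow_self _ two_ne_zero).mul_right _)
      exact (associated_one_iff_isUnit.2 h1).trans (associated_one_iff_isUnit.2 h2).symm
  | mul a b ha hb =>
    intro u hu
    have h1 := hb (u ^ a) (PadicInt.dvd_pow_sub_one hu a)
    rw [← pow_mul] at h1
    refine Associated.trans ?_ h1
    rw [Nat.cast_mul, mul_comm (a : ℤ_[p]), mul_assoc]
    exact (ha u hu).mul_left _

theorem PadicInt.eq_one_of_pow_eq_one {z : ℤ_[p]} {m : ℕ} (hm : m ≠ 0) (hz : z ^ m = 1)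
    (h : (p : ℤ_[p]) ^ 2 ∣ z - 1) : z = 1 := by
  have h1 := PadicInt.pow_sub_one_associated m z h
  rw [hz, sub_self, associated_zero_iff_eq_zero, mul_eq_zero] at h1
  rcases h1 with h1 | h1
  · exact absurd h1 (by exact_mod_cast hm)
  · exact sub_eq_zero.1 h1

theorem PadicInt.toZModPow_eq_iff (n : ℕ) (x y : ℤ_[p]) :
    PadicInt.toZModPow n x = PadicInt.toZModPow n y ↔ (p : ℤ_[p]) ^ n ∣ x - y := by
  rw [← sub_eq_zero, ← map_sub, ← RingHom.mem_ker, PadicInt.ker_toZModPow,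
    Ideal.mem_span_singleton]

/-- Euler's theorem, as p (p - 1) = φ(p²). This exponent is used throughout since it also kills the
torsion of ℤ_p^× uniformly in p, including ±1 for p = 2. -/
theorem PadicInt.units_pow_sub_one (x : ℤ_[p]ˣ) : (p : ℤ_[p]) ^ 2 ∣ (x : ℤ_[p]) ^ (p * (p - 1)) - 1 := by
  have h := ZMod.pow_totient (Units.map (PadicInt.toZModPow 2 : ℤ_[p] →+* _).toMonoidHom x)
  rw [Nat.totient_prime_pow Fact.out two_pos, show 2 - 1 = 1 from rfl, pow_one] at h
  have h2 := congrArg Units.val h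
  rw [← PadicInt.toZModPow_eq_iff, map_pow, map_one]
  simpa using h2

theorem PadicInt.norm_le_of_pow_dvd {n : ℕ} {x : ℤ_[p]} :
    (p : ℤ_[p]) ^ n ∣ x ↔ ‖x‖ ≤ (p : ℝ) ^ (-n : ℤ) := by
  rw [PadicInt.norm_le_pow_iff_mem_span_pow, Ideal.mem_span_singleton]

/-- A unit whose power of exponent `p (p - 1)` is close to `1` is close to a root of unity. -/
theorem PadicInt.exists_rootOfUnity_near (x : ℤ_[p]ˣ)
    (hx : (p : ℤ_[p]) ^ 3 ∣ (x : ℤ_[p]) ^ (p * (p - 1)) - 1) :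
    ∃ z ∈ rootsOfUnity (p * (p - 1)) ℤ_[p], (p : ℤ_[p]) ^ 2 ∣ (x : ℤ_[p]) - z := by
  have hp : p.Prime := Fact.out
  have hp1 : (1 : ℝ) < p := by exact_mod_cast hp.one_lt
  have hp0 : (0 : ℝ) < p := by linarith
  set F : Polynomial ℤ_[p] := Polynomial.X ^ (p * (p - 1)) - 1 with hF
  have hFx : ∀ y : ℤ_[p], F.aeval y = y ^ (p * (p - 1)) - 1 := by simp [hF]
  have hF' : ‖F.derivative.aeval (x : ℤ_[p])‖ = (p : ℝ) ^ (-1 : ℤ) := by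
    have h1 : F.derivative.aeval (x : ℤ_[p]) =
        ((p : ℤ_[p]) * ((p - 1 : ℕ) : ℤ_[p])) * (x : ℤ_[p]) ^ (p * (p - 1) - 1) := by
      rw [hF, map_sub, Polynomial.derivative_X_pow]
      simp
    rw [h1, norm_mul, norm_mul, norm_pow, PadicInt.norm_units, one_pow, mul_one,
      PadicInt.norm_natCast_p_sub_one, mul_one, PadicInt.norm_p, zpow_neg_one]
  -- The derivative has norm 1/p at x, so Hensel's lemma asks for a value of norm less than p⁻²;
  -- hence the exponent 3.
  have hlt : ‖F.aeval (x : ℤ_[p])‖ < ‖F.derivative.aeval (x : ℤ_[p])‖ ^ 2 := by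
    rw [hF', hFx]
    refine lt_of_le_of_lt (PadicInt.norm_le_of_pow_dvd.1 hx) ?_
    rw [← zpow_natCast, ← zpow_mul]
    exact zpow_lt_zpow_right₀ hp1 (by norm_num)
  obtain ⟨z, hz, hzx, -, -⟩ := hensels_lemma hlt
  rw [hFx, sub_eq_zero] at hz
  have hw : p * (p - 1) ≠ 0 := mul_ne_zero hp.ne_zero (Nat.sub_ne_zero_of_lt hp.one_lt)
  refine ⟨Units.ofPowEqOne z _ hz hw, ?_, ?_⟩
  · rw [mem_rootsOfUnity]
    exact Units.pow_ofPowEqOne hz hw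
  · rw [PadicInt.norm_le_of_pow_dvd, norm_sub_rev]
    rw [hF'] at hzx
    have := (PadicInt.norm_le_pow_iff_norm_lt_pow_add_one (z - (x : ℤ_[p])) (-2)).2
      (by simpa using hzx)
    simpa using this

/-- Raising to the power w removes the roots of unity and gives a^w = b^w in ℤ, so |a| = |b|. Thus
two roots of unity in ℤ_p are linearly dependent over ℚ only if they agree up to sign. -/
theorem PadicInt.eq_or_eq_neg_of_zsmul_eq {z z' : ℤ_[p]ˣ} {w : ℕ} (hw : w ≠ 0)
    (hz : z ∈ rootsOfUnity w ℤ_[p]) (hz' : z' ∈ rootsOfUnity w ℤ_[p]) {a b : ℤ} (ha : a ≠ 0)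
    (h : (a : ℤ_[p]) * z = b * z') : z = z' ∨ z = -z' := by
  rw [mem_rootsOfUnity] at hz hz'
  have h1 : (a : ℤ_[p]) ^ w = b ^ w := by
    have := congrArg (· ^ w) h
    simp only [mul_pow, ← Units.val_pow_eq_pow_val, hz, hz', Units.val_one, mul_one] at this
    exact this
  have h2 : a ^ w = b ^ w := by exact_mod_cast h1
  have h3 : a.natAbs = b.natAbs := by
    refine Nat.pow_left_injective hw ?_
    have := congrArg Int.natAbs h2
    simpa [Int.natAbs_pow] using this
  have ha' : (a : ℤ_[p]) ≠ 0 := by exact_mod_cast ha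
  rcases Int.natAbs_eq_natAbs_iff.1 h3 with h4 | h4
  · left
    subst h4
    exact Units.ext (mul_left_cancel₀ ha' h)
  · right
    refine Units.ext (mul_left_cancel₀ ha' ?_)
    rw [h, h4]
    simp

end PadicUnits

/-! ### Averaging over powers of the Frobenius -/

section FrobeniusAverage

open Finset

theorem pow_eq_one_add_geomSum (q i : ℕ) (hq : 1 ≤ q) :
    q ^ i = 1 + (q - 1) * ∑ j ∈ range i, q ^ j := by
  have h := mul_geom_sum (q : ℤ) i
  zify [hq]
  linarith

/-- The sum times q - 1 is q^{p^r} - 1, which is p^r (q - 1) up to a p-adic unit. -/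
theorem geomSum_prime_pow {p : ℕ} [Fact p.Prime] {q : ℕ} (hq : 1 < q) (hpq : p ^ 2 ∣ q - 1)
    (r : ℕ) : p ^ r ∣ ∑ j ∈ range (p ^ r), q ^ j ∧ ¬ p ^ (r + 1) ∣ ∑ j ∈ range (p ^ r), q ^ j := by
  have h0 : (((q - 1 : ℕ) : ℤ_[p])) = q - 1 := by
    rw [Nat.cast_sub hq.le, Nat.cast_one]
  have h1 := PadicInt.pow_sub_one_associated (p := p) (p ^ r) (q : ℤ_[p]) (by
    rw [← h0, PadicInt.pow_p_dvd_natCast_iff]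
    exact hpq)
  rw [← geom_sum_mul] at h1
  have hne : ((q : ℤ_[p]) - 1) ≠ 0 := by
    rw [← h0]
    exact_mod_cast (Nat.sub_pos_of_lt hq).ne'
  have h2 := h1.of_mul_right (Associated.refl _) hne
  have h3 : ∀ s, p ^ s ∣ ∑ j ∈ range (p ^ r), q ^ j ↔ p ^ s ∣ p ^ r := by
    intro s
    rw [← PadicInt.pow_p_dvd_natCast_iff, ← PadicInt.pow_p_dvd_natCast_iff]
    push_cast at h2 ⊢
    exact h2.symm.dvd_iff_dvd_right
  refine ⟨(h3 r).2 dvd_rfl, fun h => ?_⟩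
  have h4 := (Nat.pow_dvd_pow_iff_le_right (Fact.out : p.Prime).one_lt).1 ((h3 _).1 h)
  omega

theorem sum_range_shift {M : Type*} [AddCommGroup M] (g : ℕ → M) (P : ℕ)
    (hg : ∀ i, g (i + P) = g i) (j : ℕ) : ∑ i ∈ range P, g (i + j) = ∑ i ∈ range P, g i := by
  induction j with
  | zero => simp
  | succ j ih =>
    rw [← ih]
    have h1 := Finset.sum_range_succ' (fun i => g (i + j)) P
    rw [Finset.sum_range_succ, zero_add, add_comm P j, hg j, add_left_inj] at h1
    rw [h1]
    exact Finset.sum_congr rfl fun i _ => by rw [add_right_comm, add_assoc]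

/-- The sum of the conjugates `z ^ q ^ i` of a root of unity. -/
theorem sum_pow_pow_eq {p : ℕ} [Fact p.Prime] {K : Type*} [Field K] [DecidableEq K] {q : ℕ}
    (hq : 1 < q) (hpq : p ^ 2 ∣ q - 1) {n : ℕ} {z : K} (hz : z ^ ((q - 1) * p ^ n) = 1) :
    ∑ i ∈ range (p ^ n), z ^ q ^ i = if z ^ (q - 1) = 1 then (p : K) ^ n * z else 0 := by
  have hp : p.Prime := Fact.out
  set v := z ^ (q - 1) with hv
  have hvn : v ^ p ^ n = 1 := by rw [hv, ← pow_mul, hz]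
  have hzi : ∀ i, z ^ q ^ i = z * v ^ ∑ j ∈ range i, q ^ j := by
    intro i
    rw [pow_eq_one_add_geomSum q i hq.le, pow_add, pow_one, pow_mul]
  split_ifs with h
  · simp [hzi, h]
  · obtain ⟨r, hr, hvr⟩ := (Nat.dvd_prime_pow hp).1 (orderOf_dvd_of_pow_eq_one hvn)
    have hr0 : r ≠ 0 := by
      rintro rfl
      rw [pow_zero, orderOf_eq_one_iff] at hvr
      exact h hvr
    obtain ⟨r, rfl⟩ := Nat.exists_eq_succ_of_ne_zero hr0
    obtain ⟨hS1, hS2⟩ := geomSum_prime_pow hq hpq r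
    -- v has order p^{r+1} and p^r divides S exactly, so v^S is a nontrivial p-th root of unity. As
    -- q ≡ 1 mod p, it is fixed by the q-power map. Shifting i by p^r therefore multiplies the whole
    -- sum by v^S ≠ 1, and the sum is 0.
    set S := ∑ j ∈ range (p ^ r), q ^ j with hS
    have hε1 : v ^ S ≠ 1 := by
      rw [Ne, ← orderOf_dvd_iff_pow_eq_one, hvr]
      exact hS2
    have hεp : (v ^ S) ^ p = 1 := by
      rw [← pow_mul, ← orderOf_dvd_iff_pow_eq_one, hvr, pow_succ]
      exact mul_dvd_mul_right hS1 p
    have hεq : ∀ i, (v ^ S) ^ q ^ i = v ^ S := by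
      intro i
      rw [pow_eq_one_add_geomSum q i hq.le, pow_add, pow_one]
      have h1 : p ∣ (q - 1) * ∑ j ∈ range i, q ^ j :=
        ((dvd_pow_self p two_ne_zero).trans hpq).mul_right _
      obtain ⟨c, hc⟩ := h1
      rw [hc, pow_mul, hεp, one_pow, mul_one]
    have hper : ∀ i, z ^ q ^ (i + p ^ n) = z ^ q ^ i := by
      intro i
      rw [add_comm, pow_add, pow_mul, hzi (p ^ n)]
      obtain ⟨c, hc⟩ := (geomSum_prime_pow hq hpq n).1
      rw [hc, pow_mul v, hvn, one_pow, mul_one]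
    have h1 := sum_range_shift (fun i => z ^ q ^ i) (p ^ n) hper (p ^ r)
    have h2 : ∀ i, z ^ q ^ (i + p ^ r) = v ^ S * z ^ q ^ i := by
      intro i
      rw [add_comm, pow_add, pow_mul, hzi (p ^ r), mul_pow, hεq, mul_comm]
    simp only [h2, ← mul_sum] at h1
    have h3 : (v ^ S - 1) * ∑ i ∈ range (p ^ n), z ^ q ^ i = 0 := by rw [sub_mul, h1]; ring
    exact (mul_eq_zero.1 h3).resolve_left (sub_ne_zero.2 hε1)

/-- Averaging a relation over the powers of the Frobenius. -/
theorem sum_eq_zero_of_frobenius {p ℓ : ℕ} [Fact p.Prime] [Fact ℓ.Prime] (hpl : p ≠ ℓ) {K : Type*}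
    [Field K] [CharP K ℓ] {q f : ℕ} (hqf : q = ℓ ^ f) (hq : 1 < q) (hpq : p ^ 2 ∣ q - 1)
    {G : Type*} [CommGroup G] [Fintype G] [DecidableEq K] (ψ : G →* Kˣ) {n : ℕ}
    (hψ : ∀ x, ψ x ^ ((q - 1) * p ^ n) = 1) (g : G → K) (t : G) (hg : ∀ x, g x ^ q = g (t * x))
    (h : ∑ x, (ψ x : K) * g x = 0) (y : G) :
    ∑ x with (ψ x : K) ^ (q - 1) = 1, (ψ x : K) * g (y * x) = 0 := by
  have hpK : (p : K) ^ n ≠ 0 := by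
    refine pow_ne_zero _ fun h => ?_
    rw [CharP.cast_eq_zero_iff K ℓ] at h
    exact hpl ((Nat.prime_dvd_prime_iff_eq Fact.out Fact.out).1 h).symm
  have hgi : ∀ i x, g x ^ q ^ i = g (t ^ i * x) := by
    intro i
    induction i with
    | zero => simp
    | succ i ih => intro x; rw [pow_succ, pow_mul, ih, hg, pow_succ', mul_assoc]
  -- The i-th power of the Frobenius also moves the argument of g by t^i; reindexing trades this for
  -- a nonzero factor.
  have h1 : ∀ i, ∑ x, (ψ x : K) ^ q ^ i * g x = 0 := by
    intro i
    have h2 := congrArg (· ^ q ^ i) h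
    simp only [hqf, ← pow_mul] at h2
    rw [sum_pow_char_pow, zero_pow (pow_ne_zero _ (Fact.out : ℓ.Prime).ne_zero)] at h2
    simp only [pow_mul, ← hqf, mul_pow, hgi] at h2
    have h3 : ∑ x, (ψ x : K) ^ q ^ i * g (t ^ i * x) =
        ((ψ (t ^ i)⁻¹ : Kˣ) : K) ^ q ^ i * ∑ x, (ψ x : K) ^ q ^ i * g x := by
      rw [mul_sum]
      refine Fintype.sum_equiv (Equiv.mulLeft (t ^ i)) _ _ fun x => ?_
      rw [Equiv.coe_mulLeft, ← mul_assoc, ← mul_pow, ← Units.val_mul, ← map_mul,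
        inv_mul_cancel_left]
    rw [h3] at h2
    exact (mul_eq_zero.1 h2).resolve_left (pow_ne_zero _ (Units.ne_zero _))
  -- Translation by y multiplies each of these relations by a constant depending on i, so each
  -- translate is still 0 and they can be added.
  have h2 : ∑ x, (∑ i ∈ range (p ^ n), ((ψ x : K)) ^ q ^ i) * g (y * x) = 0 := by
    simp only [sum_mul]
    rw [sum_comm]
    refine Finset.sum_eq_zero fun i _ => ?_
    have h3 : ∑ x, (ψ x : K) ^ q ^ i * g (y * x) =
        ((ψ y⁻¹ : Kˣ) : K) ^ q ^ i * ∑ x, (ψ x : K) ^ q ^ i * g x := by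
      rw [mul_sum]
      refine Fintype.sum_equiv (Equiv.mulLeft y) _ _ fun x => ?_
      rw [Equiv.coe_mulLeft, ← mul_assoc, ← mul_pow, ← Units.val_mul, ← map_mul,
        inv_mul_cancel_left]
    rw [h3, h1, mul_zero]
  have h4 : ∀ x, ∑ i ∈ range (p ^ n), ((ψ x : K)) ^ q ^ i =
      if (ψ x : K) ^ (q - 1) = 1 then (p : K) ^ n * ψ x else 0 := fun x =>
    sum_pow_pow_eq hq hpq (by rw [← Units.val_pow_eq_pow_val, hψ, Units.val_one])
  simp only [h4, ite_mul, zero_mul] at h2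
  rw [← Finset.sum_filter] at h2
  simp only [mul_assoc, ← mul_sum] at h2
  exact (mul_eq_zero.1 h2).resolve_left hpK

end FrobeniusAverage

/-! ### The classes on which ψ^(q-1) is trivial -/

section CharacterKernel

open Finset

variable {p : ℕ} [Fact p.Prime]

/-- Reduction of units of `ℤ_p` modulo `p ^ n`. -/
noncomputable def padicRed (p : ℕ) [Fact p.Prime] (n : ℕ) : ℤ_[p]ˣ →* (ZMod (p ^ n))ˣ :=
  Units.map (PadicInt.toZModPow n : ℤ_[p] →+* ZMod (p ^ n)).toMonoidHom

theorem padicRed_val (n : ℕ) (x : ℤ_[p]ˣ) :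
    (padicRed p n x : ZMod (p ^ n)) = PadicInt.toZModPow n (x : ℤ_[p]) := rfl

theorem padicRed_eq_iff (n : ℕ) (x y : ℤ_[p]ˣ) :
    padicRed p n x = padicRed p n y ↔ (p : ℤ_[p]) ^ n ∣ (x : ℤ_[p]) - y := by
  rw [← PadicInt.toZModPow_eq_iff, ← padicRed_val, ← padicRed_val]
  exact ⟨fun h => congrArg _ h, fun h => Units.ext h⟩

theorem padicRed_surjective {n : ℕ} (hn : n ≠ 0) : Function.Surjective (padicRed p n) := by
  intro x
  have : NeZero (p ^ n) := ⟨pow_ne_zero _ (Fact.out : p.Prime).ne_zero⟩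
  have h : IsUnit (((x : ZMod (p ^ n)).val : ℕ) : ℤ_[p]) := by
    rw [PadicInt.isUnit_iff_not_dvd, PadicInt.p_dvd_natCast_iff]
    have := ZMod.val_coe_unit_coprime x
    rw [Nat.coprime_pow_right_iff (Nat.pos_of_ne_zero hn)] at this
    exact (Nat.Prime.coprime_iff_not_dvd Fact.out).1 this.symm
  obtain ⟨X, hX⟩ := h
  refine ⟨X, Units.ext ?_⟩
  rw [padicRed_val, hX, map_natCast, ZMod.natCast_zmod_val]

theorem sq_dvd_one_add_pow_sub {R : Type*} [CommRing R] (a : R) (m : ℕ) :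
    a ^ 2 ∣ (1 + a) ^ m - (1 + m * a) := by
  induction m with
  | zero => simp
  | succ m ih =>
    obtain ⟨c, hc⟩ := ih
    refine ⟨c * (1 + a) + m, ?_⟩
    rw [pow_succ, sub_eq_iff_eq_add.1 hc]
    push_cast
    ring

theorem PadicInt.dvd_of_units_mul {n : ℕ} {x : ℤ_[p]} (u : ℤ_[p]ˣ) :
    (p : ℤ_[p]) ^ n ∣ u * x ↔ (p : ℤ_[p]) ^ n ∣ x := by
  rw [Units.dvd_mul_left]

/-- A character of `ℤ_p^×` of exact level `p ^ n` is faithful modulo `p ^ n` on `1 + p² ℤ_p`. -/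
theorem dvd_sub_one_of_char_eq_one {M : Type*} [Group M] {n : ℕ} (hn : 2 ≤ n) (Ψ : ℤ_[p]ˣ →* M)
    (hΨ : ∀ x y : ℤ_[p]ˣ, (p : ℤ_[p]) ^ n ∣ (x : ℤ_[p]) - y → Ψ x = Ψ y) {u₀ : ℤ_[p]ˣ}
    (hu₀ : (p : ℤ_[p]) ^ (n - 1) ∣ (u₀ : ℤ_[p]) - 1) (hΨu₀ : Ψ u₀ ≠ 1) {u : ℤ_[p]ˣ}
    (hu : (p : ℤ_[p]) ^ 2 ∣ (u : ℤ_[p]) - 1) (hΨu : Ψ u = 1) :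
    (p : ℤ_[p]) ^ n ∣ (u : ℤ_[p]) - 1 := by
  by_contra hcon
  have hne : (u : ℤ_[p]) - 1 ≠ 0 := fun h => hcon (by rw [h]; exact dvd_zero _)
  have hfin : FiniteMultiplicity (p : ℤ_[p]) ((u : ℤ_[p]) - 1) :=
    FiniteMultiplicity.of_prime_left PadicInt.prime_p hne
  obtain ⟨v, hv, hpv⟩ := hfin.exists_eq_pow_mul_and_not_dvd
  set j := multiplicity (p : ℤ_[p]) ((u : ℤ_[p]) - 1)
  have hjn : j < n := by
    by_contra h
    exact hcon (by rw [hv]; exact (pow_dvd_pow _ (not_lt.1 h)).mul_right _)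
  have hvu : IsUnit v := (PadicInt.isUnit_iff_not_dvd v).2 hpv
  -- If u - 1 had valuation j < n, then u^{p^{n-1-j}} = 1 + p^{n-1} c with c a unit. Its powers fill
  -- 1 + p^{n-1} ℤ_p modulo p^n, so u₀ would be one of them and Ψ(u₀) = 1.
  have h1 := PadicInt.pow_sub_one_associated (p ^ (n - 1 - j)) (u : ℤ_[p]) hu
  have h2 : Associated ((p : ℤ_[p]) ^ (n - 1)) ((u : ℤ_[p]) ^ p ^ (n - 1 - j) - 1) := by
    refine Associated.trans ?_ h1
    rw [hv, Nat.cast_pow, ← mul_assoc, ← pow_add, show n - 1 - j + j = n - 1 by omega]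
    exact associated_mul_unit_right _ _ hvu
  obtain ⟨c, hc⟩ := h2
  obtain ⟨c₀, hc₀⟩ := hu₀
  set m := (c₀ * ((c⁻¹ : ℤ_[p]ˣ) : ℤ_[p])).zmodRepr
  have hm : (p : ℤ_[p]) ∣ c₀ - m * c := by
    have h3 := PadicInt.sub_zmodRepr_mem (c₀ * ((c⁻¹ : ℤ_[p]ˣ) : ℤ_[p]))
    rw [PadicInt.maximalIdeal_eq_span_p, Ideal.mem_span_singleton] at h3
    have h4 := h3.mul_right (c : ℤ_[p])
    rwa [sub_mul, mul_assoc, Units.inv_mul, mul_one] at h4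
  refine hΨu₀ ?_
  rw [hΨ u₀ ((u ^ p ^ (n - 1 - j)) ^ m) ?_, map_pow, map_pow, hΨu, one_pow, one_pow]
  obtain ⟨a, ha⟩ := sq_dvd_one_add_pow_sub ((p : ℤ_[p]) ^ (n - 1) * c) m
  obtain ⟨b, hb⟩ := hm
  have h5 : (u : ℤ_[p]) ^ p ^ (n - 1 - j) = 1 + (p : ℤ_[p]) ^ (n - 1) * c := by rw [hc]; ring
  rw [Units.val_pow_eq_pow_val, Units.val_pow_eq_pow_val, h5, sub_eq_iff_eq_add.1 ha,
    sub_eq_iff_eq_add.1 hc₀]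
  have h6 : (p : ℤ_[p]) ^ n = (p : ℤ_[p]) ^ (n - 1) * p := by
    rw [← pow_succ, show n - 1 + 1 = n by omega]
  have h7 : (p : ℤ_[p]) ^ n ∣ ((p : ℤ_[p]) ^ (n - 1)) ^ 2 := by
    rw [← pow_mul]
    exact pow_dvd_pow _ (by omega)
  have h8 : (p : ℤ_[p]) ^ (n - 1) * c₀ + 1 - (((p : ℤ_[p]) ^ (n - 1) * c) ^ 2 * a +
      (1 + m * ((p : ℤ_[p]) ^ (n - 1) * c))) =
      (p : ℤ_[p]) ^ (n - 1) * (c₀ - m * c) - ((p : ℤ_[p]) ^ (n - 1)) ^ 2 * (c ^ 2 * a) := by ring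
  rw [h8]
  refine dvd_sub ?_ (h7.mul_right _)
  rw [hb, ← mul_assoc, ← h6]
  exact dvd_mul_right _ _

/-- The kernel of `ψ ^ (q - 1)` for a character `ψ` of exact level `p ^ n`. -/
theorem sum_ker_eq_sum_rootsOfUnity {K : Type*} [Field K] [DecidableEq K] {q e n : ℕ}
    (hqe : p ^ e ∣ q - 1) (hqe' : ¬ p ^ (e + 1) ∣ q - 1) (hn : e + 3 ≤ n)
    (hw : ∀ z : K, z ^ (p * (p - 1)) = 1 → z ^ (q - 1) = 1) (ψ : (ZMod (p ^ n))ˣ →* Kˣ)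
    {u₀ : ℤ_[p]ˣ} (hu₀ : (p : ℤ_[p]) ^ (n - 1) ∣ (u₀ : ℤ_[p]) - 1) (hψ : ψ (padicRed p n u₀) ≠ 1)
    [Fintype (rootsOfUnity (p * (p - 1)) ℤ_[p])] [Fintype (ZMod (p ^ n))ˣ]
    (U : ℕ → ℤ_[p]ˣ) (hU : ∀ j, (U j : ℤ_[p]) = 1 + (p : ℤ_[p]) ^ (n - e) * j)
    (F : (ZMod (p ^ n))ˣ → K) :
    ∑ x with (ψ x : K) ^ (q - 1) = 1, F x =
      ∑ δ : rootsOfUnity (p * (p - 1)) ℤ_[p], ∑ j ∈ range (p ^ e), F (padicRed p n (δ * U j)) := by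
  have hp : p.Prime := Fact.out
  have hwne : p * (p - 1) ≠ 0 := mul_ne_zero hp.ne_zero (Nat.sub_ne_zero_of_lt hp.one_lt)
  set Ψ : ℤ_[p]ˣ →* Kˣ := ψ.comp (padicRed p n) with hΨdef
  have hΨ : ∀ x y : ℤ_[p]ˣ, (p : ℤ_[p]) ^ n ∣ (x : ℤ_[p]) - y → Ψ x = Ψ y := by
    intro x y h
    rw [hΨdef, MonoidHom.comp_apply, (padicRed_eq_iff n x y).2 h, MonoidHom.comp_apply]
  have hfaith : ∀ u : ℤ_[p]ˣ, (p : ℤ_[p]) ^ 2 ∣ (u : ℤ_[p]) - 1 → Ψ u = 1 →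
      (p : ℤ_[p]) ^ n ∣ (u : ℤ_[p]) - 1 := fun u hu h =>
    dvd_sub_one_of_char_eq_one (by omega) Ψ hΨ hu₀ hψ hu h
  have hqne : q - 1 ≠ 0 := fun h => hqe' (by rw [h]; exact dvd_zero _)
  have hassoc : Associated ((q - 1 : ℕ) : ℤ_[p]) ((p : ℤ_[p]) ^ e) := by
    obtain ⟨c, hc⟩ := hqe
    have hc' : IsUnit (c : ℤ_[p]) := by
      rw [PadicInt.isUnit_iff_not_dvd, PadicInt.p_dvd_natCast_iff]
      rintro ⟨c', rfl⟩
      exact hqe' ⟨c', by rw [hc, pow_succ, mul_assoc]⟩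
    rw [hc, Nat.cast_mul, Nat.cast_pow]
    exact associated_mul_unit_left _ _ hc'
  -- Up to a unit, u^{q-1} - 1 is (q - 1)(u - 1), hence p^e (u - 1).
  have hpow : ∀ u : ℤ_[p], (p : ℤ_[p]) ^ 2 ∣ u - 1 →
      ((p : ℤ_[p]) ^ n ∣ u ^ (q - 1) - 1 ↔ (p : ℤ_[p]) ^ (n - e) ∣ u - 1) := by
    intro u hu
    have h1 := (hassoc.symm.mul_right (u - 1)).trans (PadicInt.pow_sub_one_associated (q - 1) u hu)
    rw [← h1.dvd_iff_dvd_right]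
    conv_lhs => rw [show n = e + (n - e) by omega, pow_add]
    exact mul_dvd_mul_iff_left (pow_ne_zero _ PadicInt.prime_p.ne_zero)
  have hΨq : ∀ x : ℤ_[p]ˣ, (ψ (padicRed p n x) : K) ^ (q - 1) = 1 ↔ Ψ (x ^ (q - 1)) = 1 := by
    intro x
    rw [map_pow, ← Units.val_pow_eq_pow_val, Units.val_eq_one]
    rfl
  have hroot : ∀ z ∈ rootsOfUnity (p * (p - 1)) ℤ_[p], Ψ (z ^ (q - 1)) = 1 := by
    intro z hz
    rw [mem_rootsOfUnity] at hz
    rw [← hΨq]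
    refine hw _ ?_
    rw [← Units.val_pow_eq_pow_val, ← map_pow, ← map_pow, hz, map_one, map_one, Units.val_one]
  have h2ne : (p : ℤ_[p]) ^ 2 ∣ (p : ℤ_[p]) ^ (n - e) := pow_dvd_pow _ (by omega)
  symm
  rw [← Finset.sum_product']
  refine Finset.sum_nbij (fun a => padicRed p n (a.1 * U a.2)) ?_ ?_ ?_ (fun _ _ => rfl)
  · rintro ⟨δ, j⟩ -
    simp only [mem_filter, mem_univ, true_and]
    rw [hΨq, mul_pow, map_mul, hroot _ δ.2, one_mul, ← map_one Ψ]
    refine hΨ _ _ ?_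
    rw [Units.val_pow_eq_pow_val, Units.val_one, hpow, hU]
    · simp
    · rw [hU, add_sub_cancel_left]
      exact h2ne.mul_right _
  · rintro ⟨δ, j⟩ hj ⟨δ', j'⟩ hj' h
    simp only [coe_product, coe_univ, coe_range, Set.mem_prod, Set.mem_univ, Set.mem_Iio,
      true_and] at hj hj'
    rw [padicRed_eq_iff] at h
    simp only [Units.val_mul, hU] at h
    have h1 : (p : ℤ_[p]) ^ 2 ∣ (δ : ℤ_[p]ˣ) - ((δ' : ℤ_[p]ˣ) : ℤ_[p]) := by
      have h2 : (p : ℤ_[p]) ^ 2 ∣ (p : ℤ_[p]) ^ n := pow_dvd_pow _ (by omega)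
      have h3 := dvd_sub (h2.trans h) (h2ne.mul_right
        (((δ : ℤ_[p]ˣ) : ℤ_[p]) * j - ((δ' : ℤ_[p]ˣ) : ℤ_[p]) * j'))
      convert h3 using 1
      ring
    have h4 : δ = δ' := by
      refine Subtype.ext ?_
      have h5 : ((δ : ℤ_[p]ˣ) * (δ' : ℤ_[p]ˣ)⁻¹) ^ (p * (p - 1)) = 1 :=
        (mem_rootsOfUnity _ _).1 (mul_mem δ.2 (inv_mem δ'.2))
      have h6 := PadicInt.eq_one_of_pow_eq_one hwne
        (z := (((δ : ℤ_[p]ˣ) * (δ' : ℤ_[p]ˣ)⁻¹ : ℤ_[p]ˣ) : ℤ_[p]))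
        (by rw [← Units.val_pow_eq_pow_val, h5, Units.val_one]) (by
          rw [← PadicInt.dvd_of_units_mul (δ' : ℤ_[p]ˣ)]
          convert h1 using 1
          rw [Units.val_mul, mul_sub, mul_one, mul_left_comm, Units.mul_inv, mul_one])
      rw [Units.val_eq_one] at h6
      exact mul_inv_eq_one.1 h6
    subst h4
    have h7 : (p : ℤ_[p]) ^ e ∣ (j : ℤ_[p]) - j' := by
      have h8 : ((δ : ℤ_[p]ˣ) : ℤ_[p]) * (1 + (p : ℤ_[p]) ^ (n - e) * j) -
          (δ : ℤ_[p]ˣ) * (1 + (p : ℤ_[p]) ^ (n - e) * j') =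
          (δ : ℤ_[p]ˣ) * ((p : ℤ_[p]) ^ (n - e) * (j - j')) := by ring
      rw [h8, PadicInt.dvd_of_units_mul] at h
      conv_lhs at h => rw [show n = n - e + e by omega, pow_add]
      exact (mul_dvd_mul_iff_left (pow_ne_zero _ PadicInt.prime_p.ne_zero)).1 h
    have h9 : (p : ℤ_[p]) ^ e ∣ (((j : ℤ) - j' : ℤ) : ℤ_[p]) := by push_cast; exact h7
    rw [PadicInt.pow_p_dvd_int_iff] at h9
    have h10 : j = j' := by
      have h11 : (j : ℤ) ≡ j' [ZMOD ((p ^ e : ℕ) : ℤ)] :=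
        (Int.modEq_iff_dvd.2 (by push_cast; exact h9)).symm
      exact Nat.ModEq.eq_of_lt_of_lt ((Int.natCast_modEq_iff).1 h11) hj hj'
    rw [h10]
  · intro x hx
    simp only [coe_filter, mem_univ, true_and, Set.mem_ofPred_eq] at hx
    obtain ⟨X, rfl⟩ := padicRed_surjective (by omega) x
    rw [hΨq] at hx
    -- The power X^{p(p-1)} lies in 1 + p² ℤ_p, where ψ is faithful modulo p^n. As n - e ≥ 3, it is
    -- close enough to 1 for a root of unity z near X to exist.
    have h1 : (p : ℤ_[p]) ^ (n - e) ∣ (X : ℤ_[p]) ^ (p * (p - 1)) - 1 := by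
      rw [← hpow _ (PadicInt.units_pow_sub_one X)]
      have := hfaith ((X ^ (p * (p - 1))) ^ (q - 1)) (by
        rw [Units.val_pow_eq_pow_val, Units.val_pow_eq_pow_val]
        exact PadicInt.dvd_pow_sub_one (PadicInt.units_pow_sub_one X) _) (by
        rw [← pow_mul, mul_comm, pow_mul, map_pow, hx, one_pow])
      simpa only [Units.val_pow_eq_pow_val] using this
    obtain ⟨z, hz, hXz⟩ := PadicInt.exists_rootOfUnity_near X
      ((pow_dvd_pow _ (by omega)).trans h1)
    have h2 : (p : ℤ_[p]) ^ 2 ∣ ((z⁻¹ * X : ℤ_[p]ˣ) : ℤ_[p]) - 1 := by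
      rw [← PadicInt.dvd_of_units_mul z]
      convert hXz using 1
      rw [Units.val_mul, mul_sub, mul_one, Units.mul_inv_cancel_left]
    have h3 : (p : ℤ_[p]) ^ (n - e) ∣ ((z⁻¹ * X : ℤ_[p]ˣ) : ℤ_[p]) - 1 := by
      rw [← hpow _ h2]
      have := hfaith ((z⁻¹ * X) ^ (q - 1)) (by
        rw [Units.val_pow_eq_pow_val]
        exact PadicInt.dvd_pow_sub_one h2 _) (by
        rw [mul_pow, map_mul, hx, mul_one]
        exact hroot _ (inv_mem hz))
      simpa only [Units.val_pow_eq_pow_val] using this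
    obtain ⟨t, ht⟩ := h3
    -- z⁻¹X = 1 + p^{n-e} t, and modulo p^n only t modulo p^e matters.
    refine ⟨(⟨z, hz⟩, t.appr e), ?_, ?_⟩
    · simp only [coe_product, coe_univ, coe_range, Set.mem_prod, Set.mem_univ, Set.mem_Iio,
        true_and]
      exact PadicInt.appr_lt t e
    · simp only
      rw [padicRed_eq_iff]
      have h4 : ((z * U (t.appr e) : ℤ_[p]ˣ) : ℤ_[p]) - X =
          z * ((1 + (p : ℤ_[p]) ^ (n - e) * t.appr e) - (z⁻¹ * X : ℤ_[p]ˣ)) := by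
        rw [Units.val_mul, hU, mul_sub, Units.val_mul, Units.mul_inv_cancel_left]
      rw [h4, PadicInt.dvd_of_units_mul, sub_eq_iff_eq_add.1 ht]
      have h5 : 1 + (p : ℤ_[p]) ^ (n - e) * (t.appr e : ℤ_[p]) - ((p : ℤ_[p]) ^ (n - e) * t + 1) =
          -((p : ℤ_[p]) ^ (n - e) * (t - t.appr e)) := by ring
      rw [h5, dvd_neg]
      conv_lhs => rw [show n = n - e + e by omega, pow_add]
      exact mul_dvd_mul_left _ (Ideal.mem_span_singleton.1 (PadicInt.appr_spec e t))

end CharacterKernel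

/-! ### Clearing denominators in the group algebra -/

namespace AddMonoidAlgebra

open Finset
open scoped Pointwise

section Denominators

variable {K A ι : Type*} [Field K] [AddCommGroup A]

/-- The element `1 - X ^ g` is not a zero divisor when `g` has infinite order. -/
theorem eq_zero_of_one_sub_single_mul_eq_zero {g : A} (hg : ∀ m : ℤ, m • g = 0 → m = 0)
    {x : AddMonoidAlgebra K A} (hx : (1 - single g 1) * x = 0) : x = 0 := by
  have h1 : ∀ h, x.coeff h = x.coeff (-g + h) := by
    intro h
    have := congrArg (fun y => y.coeff h) hx
    rw [sub_mul, one_mul] at this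
    simp only [coeff_sub, Finsupp.sub_apply, coeff_single_mul_apply, one_mul, coeff_zero,
      Finsupp.zero_apply] at this
    exact sub_eq_zero.1 this
  -- The coefficients are constant along the orbits of translation by g; these are infinite, while
  -- the support is finite.
  have h2 : ∀ (m : ℕ) h, x.coeff h = x.coeff (h - m • g) := by
    intro m
    induction m with
    | zero => simp
    | succ m ih =>
      intro h
      rw [ih, h1]
      congr 1
      rw [succ_nsmul]
      abel
  ext h
  by_contra hne
  have hinj : Function.Injective fun m : ℕ => h - m • g := by
    intro m m' hmm
    have h3 : ((m : ℤ) - m') • g = 0 := by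
      have : m • g = m' • g := sub_right_injective hmm
      rw [sub_smul, natCast_zsmul, natCast_zsmul, this, sub_self]
    have := hg _ h3
    omega
  refine Set.infinite_range_of_injective hinj (Set.Finite.subset x.coeff.support.finite_toSet ?_)
  rintro _ ⟨m, rfl⟩
  simp only [mem_coe, Finsupp.mem_support_iff]
  rw [← h2]
  simpa using hne

variable (D : ℕ)

/-- The polynomial `∑ c a X ^ (a z)`, a sum over `a < D`. -/
noncomputable def segment (z : A) (c : ℕ → K) : AddMonoidAlgebra K A :=
  ∑ a ∈ range D, single (a • z) (c a)

/-- The numerator of `∑ (segment D (z i) (C i)) / (1 - X ^ (D z i))`, a sum over `i ∈ B` and the two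
further directions `g` and `-g`. -/
noncomputable def commonNumerator (B : Finset ι) (z : ι → A) (g : A) (C : ι → ℕ → K)
    (c₁ c₂ : ℕ → K) [DecidableEq ι] : AddMonoidAlgebra K A :=
  ∑ i ∈ B, (1 - single (D • g) 1) *
      (segment D (z i) (C i) * ∏ j ∈ B.erase i, (1 - single (D • z j) 1)) +
    (segment D g c₁ - single (D • g) 1 * segment D (-g) c₂) * ∏ j ∈ B, (1 - single (D • z j) 1)

variable {D}

theorem mapDomainRingHom_segment {A' : Type*} [AddCommGroup A'] (f : A →+ A') (z : A)
    (c : ℕ → K) : mapDomainRingHom K f (segment D z c) = segment D (f z) c := by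
  simp [segment, map_sum]

theorem lift_segment (F : Multiplicative A →* K) (z : A) (c : ℕ → K) :
    lift K K A F (segment D z c) = ∑ a ∈ range D, c a * F (.ofAdd z) ^ a := by
  simp [segment, map_sum, lift_single, ofAdd_nsmul]

theorem mapDomainRingHom_one_sub {A' : Type*} [AddCommGroup A'] (f : A →+ A') (z : A) :
    mapDomainRingHom K f (1 - single (D • z) 1) = 1 - single (D • f z) 1 := by
  simp [map_sub]

theorem lift_one_sub (F : Multiplicative A →* K) (z : A) :
    lift K K A F (1 - single (D • z) 1) = 1 - F (.ofAdd z) ^ D := by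
  rw [map_sub, map_one, lift_single, one_smul, ofAdd_nsmul, map_pow]

variable [DecidableEq ι]

/-- The vanishing of the numerator gives relations between the coefficients for `g` and `-g`. -/
theorem eq_of_commonNumerator_eq_zero {B : Finset ι} {z : ι → A} {g : A} {C : ι → ℕ → K}
    {c₁ c₂ : ℕ → K} (hg : ∀ m : ℤ, m • g = 0 → m = 0)
    (hz : ∀ i ∈ B, ∀ m : ℤ, m • z i ∈ AddSubgroup.zmultiples g → m = 0)
    (h : commonNumerator D B z g C c₁ c₂ = 0) {a : ℕ} (ha : 0 < a) (haD : a < D) :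
    c₁ a = c₂ (D - a) := by
  classical
  have hD : D ≠ 0 := by omega
  -- Modulo X^{D g} = 1 every term indexed by B dies, since it has the factor 1 - X^{D g}; only the
  -- terms of g and -g survive.
  let π := QuotientAddGroup.mk' (AddSubgroup.zmultiples (D • g))
  have hπg : D • π g = 0 := by
    rw [← map_nsmul]
    exact (QuotientAddGroup.eq_zero_iff _).2 (AddSubgroup.mem_zmultiples _)
  have h1 := congrArg (mapDomainRingHom K π) h
  rw [commonNumerator, map_add, map_sum, Finset.sum_eq_zero, zero_add, map_zero, map_mul,
    map_prod, map_sub, map_mul, mapDomainRingHom_segment, mapDomainRingHom_segment,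
    mapDomainRingHom_apply, mapDomain_single, map_nsmul, hπg, ← one_def, one_mul] at h1
  swap
  · intro i _
    rw [map_mul, mapDomainRingHom_one_sub, hπg, ← one_def, sub_self, zero_mul]
  -- No z j has a nonzero multiple in ℤ g, so D z j still has infinite order in the quotient and its
  -- factor can be cancelled.
  have key : ∀ B' ⊆ B, ∀ x : AddMonoidAlgebra K (A ⧸ AddSubgroup.zmultiples (D • g)),
      x * ∏ j ∈ B', mapDomainRingHom K π (1 - single (D • z j) 1) = 0 → x = 0 := by
    intro B'
    induction B' using Finset.induction_on with
    | empty => intro _ x hx; simpa using hx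
    | insert i s hi ih =>
      intro hs x hx
      rw [Finset.prod_insert hi, mul_left_comm, mapDomainRingHom_one_sub] at hx
      refine ih (fun j hj => hs (mem_insert_of_mem hj)) x
        (eq_zero_of_one_sub_single_mul_eq_zero ?_ hx)
      intro m hm
      rw [← map_nsmul, ← map_zsmul] at hm
      have h2 := (QuotientAddGroup.eq_zero_iff _).1 hm
      have h3 : (m * D) • z i ∈ AddSubgroup.zmultiples g := by
        rw [mul_smul, natCast_zsmul]
        refine (AddSubgroup.zmultiples_le_of_mem ?_) h2
        exact nsmul_mem (AddSubgroup.mem_zmultiples _) _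
      have h4 := hz i (hs (mem_insert_self _ _)) _ h3
      rcases mul_eq_zero.1 h4 with h5 | h5
      · exact h5
      · omega
  have h2 := congrArg (fun x => x.coeff (a • π g)) (key B subset_rfl _ h1)
  -- The image of g has order exactly D, so the monomials X^{b g} with 0 ≤ b < D are distinct, and
  -- the coefficient at a g sees only c₁(a) and c₂(D - a).
  have hcong : ∀ m : ℤ, m • π g = 0 → (D : ℤ) ∣ m := by
    intro m hm
    rw [← map_zsmul] at hm
    obtain ⟨t, ht⟩ := AddSubgroup.mem_zmultiples_iff.1 ((QuotientAddGroup.eq_zero_iff _).1 hm)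
    have h3 : (t * D - m) • g = 0 := by
      rw [sub_smul, mul_smul, natCast_zsmul, ht, sub_self]
    exact ⟨t, by linarith [hg _ h3]⟩
  have e1 : ∀ b ∈ range D, b ≠ a →
      (Finsupp.single (b • π g) (c₁ b)) (a • π g) = 0 := by
    intro b hb hba
    refine Finsupp.single_eq_of_ne fun h3 => hba ?_
    have h4 := hcong ((b : ℤ) - a) (by
      rw [sub_smul, natCast_zsmul, natCast_zsmul, h3, sub_self])
    have h5 := mem_range.1 hb
    have h6 := Int.eq_zero_of_abs_lt_dvd h4 (by rw [abs_lt]; omega)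
    omega
  have e2 : ∀ b ∈ range D, b ≠ D - a →
      (Finsupp.single (b • -π g) (c₂ b)) (a • π g) = 0 := by
    intro b hb hba
    refine Finsupp.single_eq_of_ne fun h3 => hba ?_
    have h4 := hcong ((b : ℤ) + a - D) (by
      rw [sub_smul, add_smul, natCast_zsmul, natCast_zsmul, natCast_zsmul, hπg, h3]
      simp)
    have h5 := mem_range.1 hb
    have h6 := Int.eq_zero_of_abs_lt_dvd h4 (by rw [abs_lt]; omega)
    omega
  have e3 : (D - a) • -π g = a • π g := by
    have : (D - a) • π g + a • π g = 0 := by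
      rw [← add_smul, Nat.sub_add_cancel haD.le, hπg]
    rw [smul_neg, eq_comm, ← add_eq_zero_iff_eq_neg, add_comm, this]
  simp only [segment, coeff_sub, coeff_sum, coeff_single, Finsupp.sub_apply,
    Finsupp.finsetSum_apply, coeff_zero, Finsupp.zero_apply, map_neg] at h2
  rw [Finset.sum_eq_single a e1 (fun h3 => absurd (mem_range.2 haD) h3),
    Finset.sum_eq_single (D - a) e2 (fun h3 => absurd (mem_range.2 (by omega)) h3), e3,
    Finsupp.single_eq_same, Finsupp.single_eq_same] at h2
  exact sub_eq_zero.1 h2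

theorem lift_commonNumerator (F : Multiplicative A →* K) {B : Finset ι} {z : ι → A} {g : A}
    {C : ι → ℕ → K} {c₁ c₂ : ℕ → K} (hg : F (.ofAdd g) ^ D ≠ 1)
    (hz : ∀ i ∈ B, F (.ofAdd (z i)) ^ D ≠ 1)
    (h : ∑ i ∈ B, (∑ a ∈ range D, C i a * F (.ofAdd (z i)) ^ a) / (1 - F (.ofAdd (z i)) ^ D) +
      ((∑ a ∈ range D, c₁ a * F (.ofAdd g) ^ a) / (1 - F (.ofAdd g) ^ D) +
      (∑ a ∈ range D, c₂ a * F (.ofAdd (-g)) ^ a) / (1 - F (.ofAdd (-g)) ^ D)) = 0) :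
    lift K K A F (commonNumerator D B z g C c₁ c₂) = 0 := by
  have hz' : ∀ i ∈ B, 1 - F (.ofAdd (z i)) ^ D ≠ 0 := fun i hi =>
    sub_ne_zero.2 (hz i hi).symm
  have hg' : 1 - F (.ofAdd g) ^ D ≠ 0 := sub_ne_zero.2 hg.symm
  have hinv : F (.ofAdd (-g)) = (F (.ofAdd g))⁻¹ := by
    rw [ofAdd_neg, ← one_mul (F (.ofAdd g))⁻¹, eq_mul_inv_iff_mul_eq₀, ← map_mul, inv_mul_cancel,
      map_one]
    exact ((Group.isUnit (Multiplicative.ofAdd g)).map F).ne_zero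
  have hFg : F (.ofAdd g) ≠ 0 := ((Group.isUnit (Multiplicative.ofAdd g)).map F).ne_zero
  -- The denominator for -g is that for g up to sign and a monomial. This explains the sign and the
  -- factor X^{D g} in `commonNumerator`.
  have hneg : (1 - F (.ofAdd (-g)) ^ D) = -(1 - F (.ofAdd g) ^ D) / F (.ofAdd g) ^ D := by
    rw [hinv, inv_pow]
    field_simp
    ring
  have h2 := congrArg
    (· * ((1 - F (.ofAdd g) ^ D) * ∏ j ∈ B, (1 - F (.ofAdd (z j)) ^ D))) h
  simp only [zero_mul] at h2
  rw [← h2, commonNumerator, map_add, map_sum, add_mul, Finset.sum_mul]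
  congr 1
  · refine Finset.sum_congr rfl fun i hi => ?_
    rw [map_mul, map_mul, map_prod, lift_one_sub, lift_segment, ← Finset.mul_prod_erase B _ hi]
    simp only [lift_one_sub]
    field_simp [hz' i hi]
  · rw [map_mul, map_sub, map_mul, map_prod, lift_segment, lift_segment, lift_single, hneg,
      one_smul, ofAdd_nsmul, map_pow]
    simp only [lift_one_sub]
    field_simp
    ring

end Denominators

theorem support_coeff_sum_subset {K A ι : Type*} [Field K] [DecidableEq A]
    {s : Finset ι} {x : ι → AddMonoidAlgebra K A} {S : Finset A}
    (h : ∀ i ∈ s, (x i).coeff.support ⊆ S) : (∑ i ∈ s, x i).coeff.support ⊆ S := by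
  rw [coeff_sum]
  refine Finsupp.support_finsetSum.trans ?_
  exact Finset.biUnion_subset.2 h

theorem support_coeff_single_subset {K A : Type*} [Field K] {a : A} {r : K} {S : Finset A}
    (h : a ∈ S) :
    (single a r).coeff.support ⊆ S := by
  rw [coeff_single]
  exact Finsupp.support_single_subset.trans (singleton_subset_iff.2 h)

section Support

variable {K A ι : Type*} [Field K] [AddCommGroup A] [DecidableEq A]

theorem support_coeff_add_subset (x y : AddMonoidAlgebra K A) :
    (x + y).coeff.support ⊆ x.coeff.support ∪ y.coeff.support := by
  rw [coeff_add]
  exact Finsupp.support_add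

theorem support_coeff_mul_subset_of_subset {x y : AddMonoidAlgebra K A} {S T : Finset A}
    (hx : x.coeff.support ⊆ S) (hy : y.coeff.support ⊆ T) : (x * y).coeff.support ⊆ S + T :=
  (support_coeff_mul_subset x y).trans (Finset.add_subset_add hx hy)

theorem support_coeff_prod_subset {s : Finset ι} {x : ι → AddMonoidAlgebra K A} {S : ι → Finset A}
    (h : ∀ i ∈ s, (x i).coeff.support ⊆ S i) : (∏ i ∈ s, x i).coeff.support ⊆ ∑ i ∈ s, S i := by
  classical
  induction s using Finset.induction_on with
  | empty =>
    rw [prod_empty, sum_empty, one_def, coeff_single]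
    exact Finsupp.support_single_subset
  | insert i s hi ih =>
    rw [prod_insert hi, sum_insert hi]
    exact support_coeff_mul_subset_of_subset (h i (mem_insert_self _ _))
      (ih fun j hj => h j (mem_insert_of_mem hj))

/-- The finite set `{0, z, 2 z, …, D z}`. -/
def multiples (D : ℕ) (z : A) : Finset A := (range (D + 1)).image fun a => a • z

theorem support_coeff_segment_subset (D : ℕ) (z : A) (c : ℕ → K) :
    (segment D z c).coeff.support ⊆ multiples D z := by
  refine support_coeff_sum_subset fun a ha => support_coeff_single_subset ?_
  exact mem_image_of_mem _ (mem_range.2 (by have := mem_range.1 ha; omega))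

theorem support_coeff_sub_subset (x y : AddMonoidAlgebra K A) {S : Finset A}
    (hx : x.coeff.support ⊆ S) (hy : y.coeff.support ⊆ S) : (x - y).coeff.support ⊆ S := by
  rw [coeff_sub]
  exact Finsupp.support_sub.trans (union_subset hx hy)

theorem support_coeff_one_sub_subset (D : ℕ) (z : A) :
    (1 - single (D • z) (1 : K)).coeff.support ⊆ multiples D z := by
  refine support_coeff_sub_subset _ _ ?_ ?_
  · rw [one_def]
    exact support_coeff_single_subset (mem_image.2 ⟨0, by simp, by simp⟩)
  · exact support_coeff_single_subset (mem_image_of_mem _ (mem_range.2 (Nat.lt_succ_self D)))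

/-- The bound is independent of the coefficients, so one separating level serves for all characters
and all n. -/
theorem support_coeff_commonNumerator_subset [DecidableEq ι] (D : ℕ) (B : Finset ι) (z : ι → A)
    (g : A) (C : ι → ℕ → K) (c₁ c₂ : ℕ → K) :
    (commonNumerator D B z g C c₁ c₂).coeff.support ⊆
      multiples D g + ∑ i ∈ B, multiples D (z i) := by
  refine (support_coeff_add_subset _ _).trans (union_subset ?_ ?_)
  · refine support_coeff_sum_subset fun i hi => ?_
    refine support_coeff_mul_subset_of_subset (support_coeff_one_sub_subset D g) ?_
    rw [← Finset.add_sum_erase B _ hi]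
    exact support_coeff_mul_subset_of_subset (support_coeff_segment_subset _ _ _)
      (support_coeff_prod_subset fun j _ => support_coeff_one_sub_subset D _)
  · refine support_coeff_mul_subset_of_subset ?_
      (support_coeff_prod_subset fun j _ => support_coeff_one_sub_subset D _)
    refine support_coeff_sub_subset _ _ (support_coeff_segment_subset _ _ _) ?_
    rw [segment, Finset.mul_sum]
    refine support_coeff_sum_subset fun a ha => ?_
    rw [single_mul_single]
    refine support_coeff_single_subset (mem_image.2 ⟨D - a, mem_range.2 (by omega), ?_⟩)
    have ha' := (mem_range.1 ha).le
    rw [smul_neg, ← sub_eq_add_neg, eq_sub_iff_add_eq, ← add_smul, Nat.sub_add_cancel ha']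

/-- A sum of characters that vanishes on the class of `1` vanishes identically. -/
theorem eq_zero_of_lift_eq_zero {R : Type*} [CommRing R] (e₀ : AddChar R K) (t : R)
    {x : AddMonoidAlgebra K R}
    (ht : ∀ a ∈ x.coeff.support, ∀ b ∈ x.coeff.support, e₀ (t * (a - b)) = 1 → a = b)
    (h : ∀ i : R, lift K K R (AddChar.toMonoidHom (e₀.mulShift (1 + t * i))) x = 0) : x = 0 := by
  classical
  -- Evaluation at 1 + t i gives ∑ x_a e₀(a) e₀(t a i). As functions of i, the characters in this
  -- sum are distinct by `ht`, hence linearly independent.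
  let χ : R → (Multiplicative R →* K) := fun a => AddChar.toMonoidHom (e₀.mulShift (t * a))
  have hχ : ∀ a i, χ a (.ofAdd i) = e₀ (t * a * i) := fun a i => rfl
  have hinj : Set.InjOn χ x.coeff.support := by
    intro a ha b hb hab
    refine ht a ha b hb ?_
    have h1 := DFunLike.congr_fun hab (.ofAdd 1)
    rw [hχ, hχ, mul_one, mul_one] at h1
    have h2 : e₀ (t * (a - b)) * e₀ (t * b) = 1 * e₀ (t * b) := by
      rw [← AddChar.map_add_eq_mul, ← mul_add, sub_add_cancel, h1, one_mul]
    exact mul_right_cancel₀ (e₀.val_isUnit _).ne_zero h2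
  have hli := ((linearIndependent_monoidHom (Multiplicative R) K).comp
    (fun a : x.coeff.support => χ a) fun a b hab => Subtype.ext (hinj a.2 b.2 hab))
  rw [Fintype.linearIndependent_iff] at hli
  have h0 := hli (fun a => x.coeff a * e₀ a) (by
    funext i
    have h1 := h i.toAdd
    rw [lift_apply, Finsupp.sum, ← Finset.sum_coe_sort] at h1
    simp only [Finset.sum_apply, Pi.smul_apply, smul_eq_mul, Pi.zero_apply, Function.comp]
    rw [← h1]
    refine Finset.sum_congr rfl fun a _ => ?_
    rw [smul_eq_mul, mul_assoc]
    congr 1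
    change e₀ a * e₀ (t * a * i.toAdd) = e₀ ((1 + t * i.toAdd) * a)
    rw [← AddChar.map_add_eq_mul]
    congr 1
    ring)
  ext a
  by_cases ha : a ∈ x.coeff.support
  · have h1 := h0 ⟨a, ha⟩
    simpa using (mul_eq_zero.1 h1).resolve_right (e₀.val_isUnit _).ne_zero
  · simpa using ha

end Support

end AddMonoidAlgebra

/-! ### The symmetry forced by a vanishing twisted sum -/

section TwistedSums

open Finset
open scoped Pointwise

variable {p : ℕ} [Fact p.Prime] {K : Type*} [Field K]

/-- The additive character of `ℤ_p` of level `p ^ n` that sends `1` to `ζ`. -/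
noncomputable def padicAddChar (n : ℕ) {ζ : K} (hζ : ζ ^ p ^ n = 1) : AddChar ℤ_[p] K :=
  (AddChar.zmodChar (p ^ n) hζ).compAddMonoidHom
    (PadicInt.toZModPow n : ℤ_[p] →+* ZMod (p ^ n)).toAddMonoidHom

theorem padicAddChar_apply (n : ℕ) {ζ : K} (hζ : ζ ^ p ^ n = 1) (x : ℤ_[p]) :
    padicAddChar n hζ x = ζ ^ (PadicInt.toZModPow n x).val := rfl

theorem padicAddChar_eq_one_iff (n : ℕ) {ζ : K} (hζ : IsPrimitiveRoot ζ (p ^ n)) (x : ℤ_[p]) :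
    padicAddChar n hζ.pow_eq_one x = 1 ↔ (p : ℤ_[p]) ^ n ∣ x := by
  have h0 := PadicInt.toZModPow_eq_iff n x 0
  rw [map_zero, sub_zero] at h0
  rw [padicAddChar_apply, hζ.pow_eq_one_iff_dvd, ← h0, ← ZMod.val_eq_zero]
  exact ⟨fun h => Nat.eq_zero_of_dvd_of_lt h (ZMod.val_lt _), fun h => by rw [h]; exact dvd_zero _⟩

theorem geom_sum_of_pow_eq_one {m : ℕ} {r : K} [DecidableEq K] (hr : r ^ m = 1) :
    ∑ j ∈ range m, r ^ j = if r = 1 then (m : K) else 0 := by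
  split_ifs with h
  · simp [h]
  · rw [geom_sum_eq h, hr, sub_self, zero_div]

theorem PadicInt.exists_separating_level (E : Finset ℤ_[p]) :
    ∃ N : ℕ, ∀ n, N ≤ n → ∀ a ∈ E, ∀ b ∈ E, (p : ℤ_[p]) ^ n ∣ a - b → a = b := by
  have h : ∀ x : ℤ_[p], ∃ N : ℕ, ∀ n, N ≤ n → (p : ℤ_[p]) ^ n ∣ x → x = 0 := by
    intro x
    by_cases hx : x = 0
    · exact ⟨0, fun _ _ _ => hx⟩
    · obtain ⟨N, hN⟩ := FiniteMultiplicity.of_prime_left (PadicInt.prime_p (p := p)) hx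
      exact ⟨N + 1, fun n hn hd => absurd ((pow_dvd_pow _ hn).trans hd) hN⟩
  choose N hN using h
  refine ⟨E.sup fun a => E.sup fun b => N (a - b), fun n hn a ha b hb hab => ?_⟩
  refine sub_eq_zero.1 (hN (a - b) n (le_trans ?_ hn) hab)
  exact (Finset.le_sup (f := fun b => N (a - b)) hb).trans
    (Finset.le_sup (f := fun a => E.sup fun b => N (a - b)) ha)

/-- The rational function `(∑ c a w ^ a) / (1 - w ^ D)`. -/
noncomputable def periodicRat (D : ℕ) (c : ℕ → K) (w : K) : K :=
  (∑ a ∈ range D, c a * w ^ a) / (1 - w ^ D)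

/-- With coefficients fixed by the q-Frobenius, raising to the power q only moves the argument; on w
= ζ^u it multiplies u by q. -/
theorem periodicRat_pow {ℓ q f : ℕ} [Fact ℓ.Prime] [CharP K ℓ] (hqf : q = ℓ ^ f) (D : ℕ)
    {c : ℕ → K} (hc : ∀ a, c a ^ q = c a) (w : K) :
    periodicRat D c w ^ q = periodicRat D c (w ^ q) := by
  subst hqf
  rw [periodicRat, periodicRat, div_pow, sum_pow_char_pow, sub_pow_char_pow, one_pow]
  simp only [mul_pow, hc, ← pow_mul, mul_comm]

/-- The average of `periodicRat` against a character over `1 + p ^ (n - e) ℤ_p`. -/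
theorem sum_mul_periodicRat {m D : ℕ} [DecidableEq K] (hm : m ∣ D) {c : ℕ → K} {r η : K}
    (hr : r ^ m = 1) (hη : η ^ m = 1) (w : K) :
    ∑ j ∈ range m, r ^ j * periodicRat D c (w * η ^ j) =
      m * periodicRat D (fun a => if r * η ^ a = 1 then c a else 0) w := by
  have hηD : ∀ j, (w * η ^ j) ^ D = w ^ D := by
    intro j
    obtain ⟨t, rfl⟩ := hm
    rw [mul_pow, ← pow_mul η, mul_left_comm, pow_mul η, hη, one_pow, mul_one]
  simp only [periodicRat, hηD, mul_div_assoc', ← Finset.sum_div, Finset.mul_sum]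
  rw [Finset.sum_comm]
  congr 1
  refine Finset.sum_congr rfl fun a _ => ?_
  have h1 := geom_sum_of_pow_eq_one (r := r * η ^ a) (m := m) (by
    rw [mul_pow, hr, one_mul, ← pow_mul, mul_comm, pow_mul, hη, one_pow])
  have h2 : ∀ j ∈ range m, r ^ j * (c a * (w * η ^ j) ^ a) = c a * w ^ a * (r * η ^ a) ^ j := by
    intro j _
    rw [mul_pow, mul_pow, ← pow_mul, ← pow_mul, mul_comm j a]
    ring
  rw [Finset.sum_congr rfl h2, ← Finset.mul_sum, h1]
  split_ifs <;> ring

theorem periodicRat_mul_left (D : ℕ) (b : K) (c : ℕ → K) (w : K) :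
    b * periodicRat D c w = periodicRat D (fun a => b * c a) w := by
  rw [periodicRat, periodicRat, mul_div_assoc', Finset.mul_sum]
  simp only [mul_assoc]

open Classical in
/-- The vanishing of a twisted sum of sufficiently high level over a field of characteristic `ℓ`
forces a symmetry of the coefficients. -/
theorem exists_symmetry_of_sum_eq_zero {ℓ : ℕ} [Fact ℓ.Prime] [CharP K ℓ] (hpl : p ≠ ℓ)
    {q f e D : ℕ} (hqf : q = ℓ ^ f) (hq : 1 < q) (he : 2 ≤ e) (hqe : p ^ e ∣ q - 1)
    (hqe' : ¬ p ^ (e + 1) ∣ q - 1) (hD : 0 < D) (hpD : p ^ e ∣ D)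
    (hw : ∀ z : K, z ^ (p * (p - 1)) = 1 → z ^ (q - 1) = 1) :
    ∃ n₀, ∀ n, n₀ ≤ n → ∀ ζ : K, IsPrimitiveRoot ζ (p ^ n) → ∀ ψ : (ZMod (p ^ n))ˣ →* Kˣ,
      ∀ u₀ : ℤ_[p]ˣ, (p : ℤ_[p]) ^ (n - 1) ∣ (u₀ : ℤ_[p]) - 1 → ψ (padicRed p n u₀) ≠ 1 →
      ∀ c : ℕ → K, (∀ a, c a ^ q = c a) →
      ∑ b : (ZMod (p ^ n))ˣ, (ψ b : K) * periodicRat D c (ζ ^ (b : ZMod (p ^ n)).val) = 0 →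
      ∃ s : ℕ, ¬ p ∣ s ∧ ∀ a, 0 < a → a < D → p ^ e ∣ s + a →
        c a = (ψ (-1) : K) * c (D - a) := by
  have hp : p.Prime := Fact.out
  have hwne : p * (p - 1) ≠ 0 := mul_ne_zero hp.ne_zero (Nat.sub_ne_zero_of_lt hp.one_lt)
  have : NeZero (p * (p - 1)) := ⟨hwne⟩
  let Δ := rootsOfUnity (p * (p - 1)) ℤ_[p]
  have : Fintype Δ := Fintype.ofFinite (rootsOfUnity (p * (p - 1)) ℤ_[p])
  have hneg1 : (-1 : ℤ_[p]ˣ) ∈ Δ := by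
    refine (mem_rootsOfUnity _ _).2 (Even.neg_one_pow ?_)
    exact Nat.even_mul_pred_self p
  let m1 : Δ := ⟨-1, hneg1⟩
  let z : Δ → ℤ_[p] := fun δ => ((δ : ℤ_[p]ˣ) : ℤ_[p])
  have hm1 : m1 ≠ 1 := by
    intro h
    have h1 : ((-1 : ℤ_[p]ˣ) : ℤ_[p]) = 1 := congrArg z h
    rw [Units.val_neg, Units.val_one] at h1
    have h2 : ((2 : ℕ) : ℤ_[p]) = 0 := by push_cast; linear_combination -h1
    exact two_ne_zero (Nat.cast_eq_zero.1 h2)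
  -- The torsion units other than ±1, which are exactly those that are not rational.
  let B : Finset Δ := (univ.erase 1).erase m1
  have hsum : ∀ F : Δ → K, ∑ δ, F δ = ∑ δ ∈ B, F δ + (F 1 + F m1) := by
    intro F
    rw [← Finset.add_sum_erase univ F (mem_univ 1),
      ← Finset.add_sum_erase _ F (mem_erase.2 ⟨hm1, mem_univ m1⟩)]
    ring
  obtain ⟨N, hN⟩ := PadicInt.exists_separating_level (p := p)
    (AddMonoidAlgebra.multiples D 1 + ∑ i ∈ B, AddMonoidAlgebra.multiples D (z i))
  -- The summand N separates the support at level n - e, 2e gives 2(n - e) ≥ n, 3 allows n ≥ e + 3,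
  -- and D ensures p^n ∤ D.
  refine ⟨N + 2 * e + 3 + D, fun n hn ζ hζ ψ u₀ hu₀ hψu₀ c hc hS => ?_⟩
  set e₀ := padicAddChar n hζ.pow_eq_one with he₀
  have he₀1 : ∀ x, e₀ x = 1 ↔ (p : ℤ_[p]) ^ n ∣ x := padicAddChar_eq_one_iff n hζ
  have he₀pow : ∀ x (m : ℕ), e₀ x ^ m = e₀ (m * x) := by
    intro x m
    rw [← nsmul_eq_mul, AddChar.map_nsmul_eq_pow]
  have he₀D : ∀ X : ℤ_[p]ˣ, e₀ X ^ D ≠ 1 := by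
    intro X h
    rw [he₀pow, he₀1, mul_comm, PadicInt.dvd_of_units_mul, PadicInt.pow_p_dvd_natCast_iff] at h
    have h1 := Nat.le_of_dvd hD h
    have h2 : n < p ^ n := Nat.lt_pow_self hp.one_lt
    omega
  have hpn : (p : ℤ_[p]) ^ n = (p : ℤ_[p]) ^ (n - e) * (p : ℤ_[p]) ^ e := by
    rw [← pow_add, Nat.sub_add_cancel (by omega)]
  -- the units `1 + p ^ (n - e) j`
  have hUex : ∀ j : ℕ, ∃ u : ℤ_[p]ˣ, (u : ℤ_[p]) = 1 + (p : ℤ_[p]) ^ (n - e) * j := by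
    intro j
    have : IsUnit (1 + (p : ℤ_[p]) ^ (n - e) * j) := by
      rw [PadicInt.isUnit_iff_not_dvd]
      intro h
      have h1 : (p : ℤ_[p]) ∣ (p : ℤ_[p]) ^ (n - e) * j :=
        (dvd_pow_self _ (by omega)).mul_right _
      exact PadicInt.prime_p.not_isUnit (isUnit_of_dvd_one ((dvd_add_left h1).1 h))
    exact ⟨this.unit, rfl⟩
  choose U hU using hUex
  set Ψ : ℤ_[p]ˣ →* Kˣ := ψ.comp (padicRed p n) with hΨdef
  have hΨ : ∀ x y : ℤ_[p]ˣ, (p : ℤ_[p]) ^ n ∣ (x : ℤ_[p]) - y → Ψ x = Ψ y := by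
    intro x y h
    rw [hΨdef, MonoidHom.comp_apply, (padicRed_eq_iff n x y).2 h, MonoidHom.comp_apply]
  set r := Ψ (U 1) with hr
  -- Since 2(n - e) ≥ n, the map j ↦ 1 + p^{n-e} j is multiplicative modulo p^n.
  have hΨU : ∀ j, Ψ (U j) = r ^ j := by
    intro j
    rw [hr, ← map_pow]
    refine (hΨ _ _ ?_).symm
    rw [Units.val_pow_eq_pow_val, hU, hU, Nat.cast_one, mul_one, mul_comm _ (j : ℤ_[p])]
    refine dvd_trans ?_ (sq_dvd_one_add_pow_sub ((p : ℤ_[p]) ^ (n - e)) j)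
    rw [← pow_mul]
    exact pow_dvd_pow _ (by omega)
  have hrpe : r ^ p ^ e = 1 := by
    rw [← hΨU, ← map_one Ψ]
    refine hΨ _ _ ?_
    rw [hU, Units.val_one, add_sub_cancel_left, hpn]
    push_cast
    exact dvd_rfl
  set η := e₀ ((p : ℤ_[p]) ^ (n - e)) with hη
  have hηprim : IsPrimitiveRoot η (p ^ e) := by
    refine ⟨?_, fun m hm => ?_⟩
    · rw [hη, he₀pow, he₀1, hpn, mul_comm]
      push_cast
      exact dvd_rfl
    · rw [hη, he₀pow, he₀1, hpn, mul_comm] at hm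
      exact (PadicInt.pow_p_dvd_natCast_iff e m).1
        ((mul_dvd_mul_iff_right (pow_ne_zero _ PadicInt.prime_p.ne_zero)).1 hm)
  have hηδ : ∀ x : ℤ_[p], e₀ ((p : ℤ_[p]) ^ (n - e) * x) ^ p ^ e = 1 := by
    intro x
    rw [he₀pow, he₀1, hpn]
    push_cast
    exact ⟨x, by ring⟩
  -- the relation for each coset
  let t : (ZMod (p ^ n))ˣ := ZMod.unitOfCoprime q (by
    rw [hqf]
    exact Nat.Coprime.pow _ _ ((Nat.coprime_primes Fact.out Fact.out).2 hpl.symm))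
  let g : (ZMod (p ^ n))ˣ → K := fun b => periodicRat D c (ζ ^ (b : ZMod (p ^ n)).val)
  have hg : ∀ x, g x ^ q = g (t * x) := by
    intro x
    simp only [g]
    rw [periodicRat_pow hqf D hc]
    congr 1
    rw [← pow_mul, ← Nat.mod_add_div ((x : ZMod (p ^ n)).val * q) (p ^ n), pow_add, pow_mul,
      hζ.pow_eq_one, one_pow, mul_one, Units.val_mul, ZMod.coe_unitOfCoprime,
      ← ZMod.val_natCast (p ^ n), Nat.cast_mul, ZMod.natCast_zmod_val, mul_comm]
  have hgred : ∀ X : ℤ_[p]ˣ, g (padicRed p n X) = periodicRat D c (e₀ X) := fun X => rfl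
  have hψq : ∀ x, ψ x ^ ((q - 1) * p ^ n) = 1 := by
    intro x
    have h1 : x ^ (p ^ (n - 1) * (p - 1)) = 1 := by
      rw [← Nat.totient_prime_pow hp (by omega), ZMod.pow_totient]
    have h2 := hw ((ψ x : K) ^ p ^ n) (by
      rw [← pow_mul, ← Units.val_pow_eq_pow_val, ← map_pow,
        show p ^ n * (p * (p - 1)) = p ^ (n - 1) * (p - 1) * p ^ 2 by
          rw [show n = n - 1 + 1 by omega, pow_succ, Nat.add_sub_cancel]; ring,
        pow_mul, h1, one_pow, map_one, Units.val_one])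
    rw [← pow_mul, ← Units.val_pow_eq_pow_val, Units.val_eq_one, mul_comm] at h2
    exact h2
  have hker := sum_eq_zero_of_frobenius hpl hqf hq ((pow_dvd_pow p he).trans hqe) ψ hψq g t hg hS
  have hpK : (p : K) ≠ 0 := by
    intro h
    rw [CharP.cast_eq_zero_iff K ℓ] at h
    exact hpl ((Nat.prime_dvd_prime_iff_eq Fact.out Fact.out).1 h).symm
  -- The sum over j is an orthogonality relation that keeps only the exponents a in a single class
  -- modulo p^e, determined by δ.
  let C : Δ → ℕ → K := fun δ a =>
    (Ψ δ : K) * if (r : K) * e₀ ((p : ℤ_[p]) ^ (n - e) * z δ) ^ a = 1 then c a else 0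
  have hrel : ∀ i : ℤ_[p], ∑ δ : Δ, periodicRat D (C δ) (e₀ ((1 + p ^ e * i) * z δ)) = 0 := by
    intro i
    have hYu : IsUnit (1 + (p : ℤ_[p]) ^ e * i) := by
      rw [PadicInt.isUnit_iff_not_dvd]
      intro h
      have h1 : (p : ℤ_[p]) ∣ (p : ℤ_[p]) ^ e * i := (dvd_pow_self _ (by omega)).mul_right _
      exact PadicInt.prime_p.not_isUnit (isUnit_of_dvd_one ((dvd_add_left h1).1 h))
    obtain ⟨Y, hY⟩ := hYu
    have h1 := hker (padicRed p n Y)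
    rw [sum_ker_eq_sum_rootsOfUnity hqe hqe' (by omega) hw ψ hu₀ hψu₀ U hU] at h1
    have h2 : ∀ δ : Δ, ∑ j ∈ range (p ^ e), (ψ (padicRed p n (δ * U j)) : K) *
        g (padicRed p n Y * padicRed p n (δ * U j)) =
        (p ^ e : ℕ) * periodicRat D (C δ) (e₀ ((1 + p ^ e * i) * z δ)) := by
      intro δ
      have h3 := sum_mul_periodicRat (m := p ^ e) (D := D) hpD (c := c) (r := (r : K))
        (η := e₀ ((p : ℤ_[p]) ^ (n - e) * z δ))
        (by rw [← Units.val_pow_eq_pow_val, hrpe, Units.val_one]) (hηδ _)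
        (e₀ ((1 + p ^ e * i) * z δ))
      have h4 := congrArg ((Ψ δ : K) * ·) h3
      simp only [Finset.mul_sum] at h4
      rw [mul_left_comm, periodicRat_mul_left] at h4
      rw [← h4]
      refine Finset.sum_congr rfl fun j _ => ?_
      rw [← map_mul, hgred]
      have h5 : (ψ (padicRed p n (δ * U j)) : K) = Ψ δ * (r : K) ^ j := by
        rw [← Units.val_pow_eq_pow_val, ← hΨU, ← Units.val_mul, ← map_mul]
        rfl
      rw [h5, mul_assoc]
      congr 3
      -- As Y ≡ 1 mod p^e, the product Y p^{n-e} agrees with p^{n-e} modulo p^n, so the twist by j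
      -- does not depend on i.
      have h6 : ((Y * (δ * U j) : ℤ_[p]ˣ) : ℤ_[p]) = (1 + p ^ e * i) * z δ +
          ((j : ℤ_[p]) * ((p : ℤ_[p]) ^ (n - e) * z δ) + (p : ℤ_[p]) ^ n * (i * z δ * j)) := by
        rw [Units.val_mul, Units.val_mul, hU, hY, hpn]
        ring
      rw [h6, AddChar.map_add_eq_mul, AddChar.map_add_eq_mul,
        (he₀1 ((p : ℤ_[p]) ^ n * (i * z δ * j))).2 (dvd_mul_right _ _), mul_one, he₀pow]
    rw [Finset.sum_congr rfl fun δ _ => h2 δ, ← Finset.mul_sum] at h1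
    refine (mul_eq_zero.1 h1).resolve_left ?_
    push_cast
    exact pow_ne_zero _ hpK
  -- the group algebra
  have hΞ : AddMonoidAlgebra.commonNumerator D B z 1 C (C 1) (C m1) = 0 := by
    refine AddMonoidAlgebra.eq_zero_of_lift_eq_zero e₀ ((p : ℤ_[p]) ^ e) ?_ fun i => ?_
    · intro a ha b hb hab
      have hsub := AddMonoidAlgebra.support_coeff_commonNumerator_subset D B z 1 C (C 1) (C m1)
      rw [he₀1, hpn, mul_comm] at hab
      exact hN (n - e) (by omega) a (hsub ha) b (hsub hb)
        ((mul_dvd_mul_iff_left (pow_ne_zero _ PadicInt.prime_p.ne_zero)).1 hab)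
    · have hYu : IsUnit (1 + (p : ℤ_[p]) ^ e * i) := by
        rw [PadicInt.isUnit_iff_not_dvd]
        intro h
        have h1 : (p : ℤ_[p]) ∣ (p : ℤ_[p]) ^ e * i := (dvd_pow_self _ (by omega)).mul_right _
        exact PadicInt.prime_p.not_isUnit (isUnit_of_dvd_one ((dvd_add_left h1).1 h))
      obtain ⟨Y, hY⟩ := hYu
      have h1 := hrel i
      rw [hsum] at h1
      refine AddMonoidAlgebra.lift_commonNumerator _ ?_ (fun δ _ => ?_) ?_
      · change e₀ ((1 + p ^ e * i) * 1) ^ D ≠ 1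
        rw [mul_one, ← hY]
        exact he₀D Y
      · change e₀ ((1 + p ^ e * i) * z δ) ^ D ≠ 1
        rw [← hY]
        exact he₀D (Y * δ)
      · exact h1
  have hsym := fun (a : ℕ) => AddMonoidAlgebra.eq_of_commonNumerator_eq_zero (a := a)
    (fun m hm => by
      rw [zsmul_eq_mul, mul_one] at hm
      exact_mod_cast hm) (fun δ hδ m hm => by
      obtain ⟨b, hb⟩ := AddSubgroup.mem_zmultiples_iff.1 hm
      by_contra hm0
      rw [zsmul_eq_mul, zsmul_eq_mul] at hb
      rcases PadicInt.eq_or_eq_neg_of_zsmul_eq (z := δ) (z' := 1) hwne δ.2 (one_mem _) hm0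
        (b := b) (by rw [Units.val_one]; exact hb.symm) with h | h
      · exact (mem_erase.1 (mem_erase.1 hδ).2).1 (Subtype.ext h)
      · exact (mem_erase.1 hδ).1 (Subtype.ext h)) hΞ
  -- r is a p^e-th root of unity, so it is a power of η, and r η^a = 1 means that p^e divides s + a.
  obtain ⟨s, hs, hs'⟩ := hηprim.eq_pow_of_pow_eq_one (ξ := (r : K))
    (by rw [← Units.val_pow_eq_pow_val, hrpe, Units.val_one])
  refine ⟨s, fun hps => hψu₀ ?_, fun a ha haD hsa => ?_⟩
  · obtain ⟨v, hv⟩ := hu₀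
    -- If p divided s, then ψ would be trivial on 1 + p^{n-1} ℤ_p, which contains u₀.
    have h1 : r ^ p ^ (e - 1) = 1 := by
      rw [← Units.val_eq_one, Units.val_pow_eq_pow_val, ← hs', ← pow_mul,
        hηprim.pow_eq_one_iff_dvd]
      obtain ⟨s', rfl⟩ := hps
      exact ⟨s', by
        rw [show p ^ e = p * p ^ (e - 1) by rw [← pow_succ', Nat.sub_add_cancel (by omega)]]
        ring⟩
    change Ψ u₀ = 1
    rw [hΨ u₀ (U (p ^ (e - 1) * v.zmodRepr)), hΨU, pow_mul, h1, one_pow]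
    have h2 := PadicInt.sub_zmodRepr_mem v
    rw [PadicInt.maximalIdeal_eq_span_p, Ideal.mem_span_singleton] at h2
    have h3 : (u₀ : ℤ_[p]) - U (p ^ (e - 1) * v.zmodRepr) =
        (p : ℤ_[p]) ^ (n - 1) * (v - v.zmodRepr) := by
      have h4 : (p : ℤ_[p]) ^ (n - 1) = (p : ℤ_[p]) ^ (n - e) * (p : ℤ_[p]) ^ (e - 1) := by
        rw [← pow_add]
        congr 1
        omega
      rw [hU, sub_eq_iff_eq_add.1 hv, h4]
      push_cast
      ring
    rw [h3, show n = n - 1 + 1 by omega, pow_succ, Nat.add_sub_cancel]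
    exact mul_dvd_mul_left _ h2
  · have h1 := hsym a ha haD
    simp only [C] at h1
    have h2 : (r : K) * e₀ ((p : ℤ_[p]) ^ (n - e) * z 1) ^ a = 1 := by
      have h3 : (p : ℤ_[p]) ^ (n - e) * z 1 = (p : ℤ_[p]) ^ (n - e) := mul_one _
      rw [h3, ← hη, ← hs', ← pow_add, hηprim.pow_eq_one_iff_dvd]
      exact hsa
    -- The direction -1 replaces η by η⁻¹, and p^e ∣ D turns the exponent D - a back into a.
    have h3 : (r : K) * e₀ ((p : ℤ_[p]) ^ (n - e) * z m1) ^ (D - a) = 1 := by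
      have h4 : (p : ℤ_[p]) ^ (n - e) * z m1 = -(p : ℤ_[p]) ^ (n - e) := by
        change (p : ℤ_[p]) ^ (n - e) * ((-1 : ℤ_[p]ˣ) : ℤ_[p]) = _
        rw [Units.val_neg, Units.val_one, mul_neg_one]
      have h5 : η * e₀ (-(p : ℤ_[p]) ^ (n - e)) = 1 := by
        rw [hη, ← AddChar.map_add_eq_mul, add_neg_cancel, AddChar.map_zero_eq_one]
      have h6 : η ^ a * η ^ (D - a) = 1 := by
        rw [← pow_add, Nat.add_sub_cancel' haD.le, hηprim.pow_eq_one_iff_dvd]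
        exact hpD
      rw [h4]
      have h7 : η ^ (D - a) * e₀ (-(p : ℤ_[p]) ^ (n - e)) ^ (D - a) = 1 := by
        rw [← mul_pow, h5, one_pow]
      have h8 : (r : K) * η ^ a = 1 := by
        rw [← hs', ← pow_add, hηprim.pow_eq_one_iff_dvd]
        exact hsa
      calc (r : K) * e₀ (-(p : ℤ_[p]) ^ (n - e)) ^ (D - a)
          = r * (η ^ a * η ^ (D - a)) * e₀ (-(p : ℤ_[p]) ^ (n - e)) ^ (D - a) := by
            rw [h6, mul_one]
        _ = (r * η ^ a) * (η ^ (D - a) * e₀ (-(p : ℤ_[p]) ^ (n - e)) ^ (D - a)) := by ring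
        _ = 1 := by rw [h7, h8, one_mul]
    have h4 : (Ψ (1 : Δ) : K) = 1 := by
      rw [OneMemClass.coe_one, map_one, Units.val_one]
    have h5 : Ψ m1 = ψ (-1) := by
      change ψ (padicRed p n (-1)) = ψ (-1)
      congr 1
      refine Units.ext ?_
      rw [padicRed_val, Units.val_neg, Units.val_neg, Units.val_one, Units.val_one, map_neg,
        map_one]
    rw [if_pos h2, if_pos h3, h4, one_mul, h5] at h1
    exact h1

end TwistedSums

/-! ### Reduction modulo the maximal ideal -/

section Reduction

open Finset

/-- A root x ≠ 1 satisfies 1 + x + … + x^{m-1} = 0; if x reduced to 1, this would read m = 0 in the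
residue field. -/
theorem IsLocalRing.residue_ne_one_of_pow_eq_one {R : Type*} [CommRing R] [IsDomain R]
    [IsLocalRing R] {x : R} {m : ℕ} (hx : x ^ m = 1) (hx1 : x ≠ 1)
    (hm : (m : IsLocalRing.ResidueField R) ≠ 0) : IsLocalRing.residue R x ≠ 1 := by
  intro h
  have h1 : (∑ i ∈ range m, x ^ i) * (x - 1) = 0 := by rw [geom_sum_mul, hx, sub_self]
  have h2 := (mul_eq_zero.1 h1).resolve_right (sub_ne_zero.2 hx1)
  have h3 := congrArg (IsLocalRing.residue R) h2
  rw [map_sum, map_zero] at h3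
  simp only [map_pow, h, one_pow, sum_const, card_range, nsmul_eq_mul, mul_one] at h3
  exact hm h3

theorem ValuationSubring.exists_eq_of_isIntegral (O : ValuationSubring ℂ) {x : ℂ}
    (hx : IsIntegral ℤ x) : ∃ y : O, (y : ℂ) = x :=
  IsIntegrallyClosed.isIntegral_iff.1 (hx.tower_top (A := O))

theorem ValuationSubring.exists_eq_of_pow_eq_one (O : ValuationSubring ℂ) {x : ℂ} {m : ℕ}
    (hm : m ≠ 0) (hx : x ^ m = 1) : ∃ y : O, (y : ℂ) = x :=
  O.exists_eq_of_isIntegral (IsIntegral.of_pow (Nat.pos_of_ne_zero hm) (hx ▸ isIntegral_one))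

open IsLocalRing in
/-- The coefficients of `twistSer` are integral, and so is their reduction formula. -/
theorem ValuationSubring.exists_twistCoeff_eq (O : ValuationSubring ℂ) {D : ℕ} (h : ℕ → O) {ω : O}
    (hω : residue O ω ^ D ≠ 1) (hD : (D : ResidueField O) = 0) (k : ℕ) :
    ∃ A : O, (A : ℂ) = twistCoeff D (fun a => (h a : ℂ)) ω k ∧
      residue O A = periodicRat D (fun a => residue O (h a) * (a : ResidueField O) ^ k)
        (residue O ω) := by
  have hunit : IsUnit (1 - ω ^ D) := by
    rw [← residue_ne_zero_iff_isUnit, map_sub, map_one, map_pow]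
    exact sub_ne_zero.2 hω.symm
  have hωC : (ω : ℂ) ^ D ≠ 1 := by
    intro h1
    refine hω ?_
    have h2 : ω ^ D = 1 := Subtype.ext h1
    rw [← map_pow, h2, map_one]
  obtain ⟨u, hu⟩ := hunit
  have hlift : ∀ k, ∃ A : O, (A : ℂ) = twistCoeff D (fun a => (h a : ℂ)) ω k := by
    intro k
    induction k using Nat.strong_induction_on with
    | _ k ih =>
      have h1 : ∃ S : O, (S : ℂ) = ∑ j ∈ range k, (k.choose j : ℂ) * (D : ℂ) ^ (k - j) *
          twistCoeff D (fun a => (h a : ℂ)) ω j := by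
        choose! A hA using ih
        refine ⟨∑ j ∈ range k, (k.choose j : O) * (D : O) ^ (k - j) * A j, ?_⟩
        push_cast
        refine Finset.sum_congr rfl fun j hj => ?_
        rw [hA j (mem_range.1 hj)]
      obtain ⟨S, hS⟩ := h1
      refine ⟨(u⁻¹ : Oˣ) * (∑ a ∈ range D, h a * ω ^ a * (a : O) ^ k + ω ^ D * S), ?_⟩
      have h2 := twistCoeff_rec (fun a => (h a : ℂ)) hωC k
      rw [← hS] at h2
      have h3 : ((u⁻¹ : Oˣ) : O) * (1 - ω ^ D) = 1 := by rw [← hu, Units.inv_mul]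
      have h4 : (((u⁻¹ : Oˣ) : O) : ℂ) * (1 - (ω : ℂ) ^ D) = 1 := by exact_mod_cast h3
      push_cast
      rw [← h2, ← mul_assoc, h4, one_mul]
  choose A hA using hlift
  refine ⟨A k, hA k, ?_⟩
  have hrec : (1 - ω ^ D) * A k = ∑ a ∈ range D, h a * ω ^ a * (a : O) ^ k +
      ω ^ D * ∑ j ∈ range k, (k.choose j : O) * (D : O) ^ (k - j) * A j := by
    refine Subtype.ext ?_
    push_cast
    simp only [hA]
    exact twistCoeff_rec (fun a => (h a : ℂ)) hωC k
  have h1 := congrArg (residue O) hrec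
  -- For j < k the factor D^{k-j} vanishes in the residue field, so the recursion collapses to its
  -- first sum.
  rw [map_mul, map_add, map_mul, map_sum, map_sum,
    Finset.sum_eq_zero (f := fun j => residue O ((k.choose j : O) * (D : O) ^ (k - j) * A j)),
    mul_zero, add_zero, map_sub, map_one, map_pow] at h1
  · rw [periodicRat, eq_div_iff (sub_ne_zero.2 hω.symm), mul_comm, h1]
    refine Finset.sum_congr rfl fun a _ => ?_
    simp only [map_mul, map_pow, map_natCast]
    ring
  · intro j hj
    rw [map_mul, map_mul, map_pow, map_natCast, map_natCast, hD, zero_pow, mul_zero, zero_mul]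
    exact Nat.sub_ne_zero_of_lt (mem_range.1 hj)

/-- Some power `q` of `ℓ` is such that `W`-th roots of unity in characteristic `ℓ` are fixed by the
`q`-Frobenius. -/
theorem exists_pow_sub_one_of_charP {ℓ : ℕ} [Fact ℓ.Prime] {W : ℕ} (hW : W ≠ 0) {m : ℕ}
    (hm : m ∣ W) (hmℓ : m.Coprime ℓ) :
    ∃ f, 1 < ℓ ^ f ∧ m ∣ ℓ ^ f - 1 ∧ ∀ (K : Type) [Field K] [CharP K ℓ] (z : K), z ^ W = 1 →
      z ^ (ℓ ^ f - 1) = 1 := by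
  have hℓ : ℓ.Prime := Fact.out
  obtain ⟨r, W', hW', rfl⟩ := Nat.exists_eq_pow_mul_and_not_dvd hW ℓ hℓ.ne_one
  have hW'0 : W' ≠ 0 := fun h => hW' (h ▸ dvd_zero _)
  have hdvd : W' ∣ ℓ ^ W'.totient - 1 := by
    have h1 := Nat.ModEq.pow_totient ((Nat.Prime.coprime_iff_not_dvd hℓ).2 hW')
    exact (Nat.modEq_iff_dvd' (Nat.one_le_pow _ _ hℓ.pos)).1 h1.symm
  -- W' is the prime-to-ℓ part of W. In characteristic ℓ every W-th root of unity is already a W'-th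
  -- root of unity, and W' divides ℓ^{φ(W')} - 1.
  refine ⟨W'.totient, ?_, ?_, ?_⟩
  · exact Nat.one_lt_pow (Nat.totient_pos.2 (Nat.pos_of_ne_zero hW'0)).ne' hℓ.one_lt
  · exact ((hmℓ.pow_right r).dvd_of_dvd_mul_left hm).trans hdvd
  · intro K _ _ z hz
    obtain ⟨t, ht⟩ := hdvd
    rw [mul_comm, pow_mul] at hz
    have h1 : z ^ W' = 1 := by
      have h2 : (z ^ W' - 1) ^ ℓ ^ r = 0 := by rw [sub_pow_char_pow, hz, one_pow, sub_self]
      exact sub_eq_zero.1 (pow_eq_zero_iff (pow_ne_zero _ hℓ.ne_zero) |>.1 h2)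
    rw [ht, pow_mul, h1, one_pow]

/-- Chinese remainders: a ≡ 1 mod M and a ≡ -s mod p^e, where -s is written (p^e - 1) s to stay in
ℕ. Primality to p comes from p ∤ s. -/
theorem exists_natural_in_progression {p M e s : ℕ} [Fact p.Prime] (hM : M.Coprime p) (hM0 : M ≠ 0)
    (he : e ≠ 0) (hs : ¬ p ∣ s) :
    ∃ a, 0 < a ∧ a < M * p ^ e ∧ p ^ e ∣ s + a ∧ a.Coprime (M * p) := by
  have hp : p.Prime := Fact.out
  have hcop : M.Coprime (p ^ e) := hM.pow_right e
  have hpe : p ^ e ≠ 0 := pow_ne_zero _ hp.ne_zero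
  obtain ⟨a, ha1, ha2⟩ := Nat.chineseRemainder hcop 1 ((p ^ e - 1) * s)
  have hlt : a % (M * p ^ e) < M * p ^ e :=
    Nat.mod_lt _ (Nat.pos_of_ne_zero (mul_ne_zero hM0 hpe))
  have hmod := Nat.mod_modEq a (M * p ^ e)
  set b := a % (M * p ^ e)
  have hb1 : b ≡ 1 [MOD M] := (hmod.of_mul_right _).trans ha1
  have hb2 : b ≡ (p ^ e - 1) * s [MOD p ^ e] := (hmod.of_mul_left _).trans ha2
  have hsb : p ^ e ∣ s + b := by
    rw [← Nat.modEq_zero_iff_dvd]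
    refine (hb2.add_left s).trans ?_
    rw [Nat.modEq_zero_iff_dvd]
    refine ⟨s, ?_⟩
    obtain ⟨t, ht⟩ := Nat.exists_eq_add_of_lt (Nat.pos_of_ne_zero hpe)
    rw [ht]
    simp
    ring
  have hpb : ¬ p ∣ b := fun h => hs ((Nat.dvd_add_left h).1 ((dvd_pow_self p he).trans hsb))
  refine ⟨b, Nat.pos_of_ne_zero fun h => hpb (h ▸ dvd_zero _), hlt, hsb, ?_⟩
  refine Nat.Coprime.mul_right ?_ ((Nat.Prime.coprime_iff_not_dvd hp).2 hpb).symm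
  have := hb1.gcd_eq
  rwa [Nat.gcd_one_left] at this

/-- A primitive Dirichlet character modulo `p ^ n` is not trivial on `1 + p ^ (n - 1)`. -/
theorem DirichletCharacter.IsPrimitive.exists_ne_one {p : ℕ} [Fact p.Prime] {n : ℕ} (hn : n ≠ 0)
    {ψ : DirichletCharacter ℂ (p ^ n)} (hψ : ψ.IsPrimitive) :
    ∃ u : (ZMod (p ^ n))ˣ, ZMod.unitsMap (pow_dvd_pow p (Nat.sub_le n 1)) u = 1 ∧ ψ u ≠ 1 := by
  by_contra hcon
  push Not at hcon
  have hp : p.Prime := Fact.out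
  have h1 : p ^ (n - 1) ∈ ψ.conductorSet := by
    rw [mem_conductorSet_iff, factorsThrough_iff_ker_unitsMap (pow_dvd_pow p (Nat.sub_le n 1))]
    intro u hu
    rw [MonoidHom.mem_ker] at hu ⊢
    exact Units.ext ((MulChar.coe_toUnitHom ψ u).trans (hcon u hu))
  have h2 : ψ.conductor ≤ p ^ (n - 1) := Nat.sInf_le h1
  rw [hψ] at h2
  exact absurd h2 (not_le.2 (Nat.pow_lt_pow_right hp.one_lt (Nat.sub_one_lt hn)))

end Reduction

/-! ### Unit values for large p-power conductor -/

section UnitValues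

open Finset IsLocalRing

theorem DirichletCharacter.apply_pow_totient {d : ℕ} (θ : DirichletCharacter ℂ d) (u : (ZMod d)ˣ) :
    θ u ^ d.totient = 1 := by
  rw [← map_pow, ← Units.val_pow_eq_pow_val, ZMod.pow_totient, Units.val_one, map_one]

theorem DirichletCharacter.exists_valuationSubring_eq (O : ValuationSubring ℂ) {d : ℕ} [NeZero d]
    (θ : DirichletCharacter ℂ d) (a : ZMod d) : ∃ y : O, (y : ℂ) = θ a := by
  by_cases ha : IsUnit a
  · obtain ⟨u, rfl⟩ := ha
    exact O.exists_eq_of_pow_eq_one (Nat.totient_pos.2 (NeZero.pos d)).ne' (θ.apply_pow_totient u)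
  · exact ⟨0, (θ.map_nonunit ha).symm⟩

/-- The reduction of the values of a Dirichlet character on units. -/
theorem DirichletCharacter.exists_monoidHom_eq (O : ValuationSubring ℂ) {d : ℕ} [NeZero d]
    (θ : DirichletCharacter ℂ d) : ∃ P : (ZMod d)ˣ →* O, ∀ u, (P u : ℂ) = θ u := by
  choose y hy using θ.exists_valuationSubring_eq O
  refine ⟨⟨⟨fun u => y u, Subtype.ext ?_⟩, fun u v => Subtype.ext ?_⟩, fun u => hy u⟩
  · rw [hy, Units.val_one, map_one]; rfl
  · push_cast
    rw [hy, hy, hy, map_mul]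

theorem Nat.Coprime.sub_of_dvd {a m D : ℕ} (h : a.Coprime m) (hm : m ∣ D) (ha : a ≤ D) :
    (D - a).Coprime m := by
  refine Nat.eq_one_of_dvd_coprimes h ?_ (Nat.gcd_dvd_right _ _)
  exact (Nat.dvd_sub_iff_right ha ((Nat.gcd_dvd_right _ _).trans hm)).1 (Nat.gcd_dvd_left _ _)

/-- For a primitive character of conductor `d p ^ n` with `n` large, half of the value of the
`L`-function at `-k` is a unit at each place of residue characteristic different from `p`. -/
theorem DirichletCharacter.exists_unit_eq_LFunction_neg (O : ValuationSubring ℂ) {p ℓ : ℕ}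
    [Fact p.Prime] [Fact ℓ.Prime] (hpl : p ≠ ℓ) [CharP (ResidueField O) ℓ] (k : ℕ) {N₀ : ℕ}
    (hN₀ : N₀ ≠ 0) (hN₀p : N₀.Coprime p) :
    ∃ n₁, ∀ n, n₁ ≤ n → ∀ d, d ∣ N₀ → ∀ [NeZero (d * p ^ n)]
      (χ : DirichletCharacter ℂ (d * p ^ n)), χ.IsPrimitive → χ (-1) * (-1) ^ k = -1 →
      ∃ x : Oˣ, ((x : O) : ℂ) = χ.LFunction (-(k : ℂ)) / 2 := by
  have hp : p.Prime := Fact.out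
  have hℓ : ℓ.Prime := Fact.out
  have hwne : p * (p - 1) ≠ 0 := mul_ne_zero hp.ne_zero (Nat.sub_ne_zero_of_lt hp.one_lt)
  -- The factor φ(N₀) puts the values of θ into 𝔽_q, p(p - 1) does so for the torsion of ℤ_p^×, and
  -- p² makes e ≥ 2.
  obtain ⟨f, hq, hp2q, hroot⟩ := exists_pow_sub_one_of_charP (ℓ := ℓ) (m := p ^ 2)
    (W := N₀.totient * p ^ 2 * (p * (p - 1)))
    (mul_ne_zero (mul_ne_zero (Nat.totient_pos.2 (Nat.pos_of_ne_zero hN₀)).ne'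
      (pow_ne_zero _ hp.ne_zero)) hwne)
    ((dvd_mul_left _ _).mul_right _) (((Nat.coprime_primes hp hℓ).2 hpl).pow_left 2)
  replace hroot := hroot (ResidueField O)
  set q := ℓ ^ f with hqf
  obtain ⟨e, q', hq', hqe⟩ := Nat.exists_eq_pow_mul_and_not_dvd (n := q - 1) (by omega) p hp.ne_one
  have hcop' : ∀ j, (p ^ j).Coprime q' := fun j =>
    ((Nat.Prime.coprime_iff_not_dvd hp).2 hq').pow_left j
  have he : 2 ≤ e := by
    rw [hqe] at hp2q
    exact (Nat.pow_dvd_pow_iff_le_right hp.one_lt).1 ((hcop' 2).dvd_of_dvd_mul_right hp2q)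
  have hqe1 : p ^ e ∣ q - 1 := ⟨q', hqe⟩
  have hqe2 : ¬ p ^ (e + 1) ∣ q - 1 := by
    intro h
    rw [hqe] at h
    have := (Nat.pow_dvd_pow_iff_le_right hp.one_lt).1 ((hcop' _).dvd_of_dvd_mul_right h)
    omega
  -- The factor ℓ makes D vanish in the residue field; it also makes numbers prime to M nonzero
  -- there.
  set M := N₀ * ℓ with hM
  have hM0 : M ≠ 0 := mul_ne_zero hN₀ hℓ.ne_zero
  have hMp : M.Coprime p := Nat.Coprime.mul_left hN₀p ((Nat.coprime_primes hℓ hp).2 hpl.symm)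
  set D := M * p ^ e with hD
  have hD0 : D ≠ 0 := mul_ne_zero hM0 (pow_ne_zero _ hp.ne_zero)
  have hDK : (D : ResidueField O) = 0 := by
    rw [CharP.cast_eq_zero_iff (ResidueField O) ℓ]
    exact (dvd_mul_left ℓ N₀).mul_right _
  have hpK : (p : ResidueField O) ≠ 0 := by
    intro h
    rw [CharP.cast_eq_zero_iff (ResidueField O) ℓ] at h
    exact hpl ((Nat.prime_dvd_prime_iff_eq hℓ hp).1 h).symm
  have hpnK : ∀ n, ((p ^ n : ℕ) : ResidueField O) ≠ 0 := fun n => by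
    push_cast
    exact pow_ne_zero _ hpK
  obtain ⟨n₀, hn₀⟩ := exists_symmetry_of_sum_eq_zero (K := ResidueField O) hpl hqf hq he hqe1 hqe2
    (Nat.pos_of_ne_zero hD0) (dvd_mul_left _ _)
    (fun z hz => hroot z (by rw [mul_comm, pow_mul, hz, one_pow]))
  refine ⟨n₀ + D + 3, fun n hn d hd _ χ hχ hpar => ?_⟩
  have : NeZero d := ⟨fun h => hN₀ (Nat.eq_zero_of_zero_dvd (h ▸ hd))⟩
  have hζ := Complex.isPrimitiveRoot_exp (p ^ n) (pow_ne_zero _ hp.ne_zero)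
  set ζ := Complex.exp (2 * Real.pi * Complex.I / (p ^ n : ℕ))
  have hDn : ¬ p ^ n ∣ D := by
    intro h
    have h1 := Nat.le_of_dvd (Nat.pos_of_ne_zero hD0) h
    have h2 : n < p ^ n := Nat.lt_pow_self hp.one_lt
    omega
  obtain ⟨θ, ψ, τ, τ', -, hψ, hτ, hτ', hττ', hL⟩ := exists_LFunction_neg_formula (D := D)
    (hN₀p.coprime_dvd_left hd) χ hχ (k := k) hpar
    ((hd.trans (dvd_mul_right _ _)).mul_right _) ((pow_dvd_pow p he).mul_left _) hDn hζ
  -- integral models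
  obtain ⟨Z, hZ⟩ := O.exists_eq_of_pow_eq_one (pow_ne_zero _ hp.ne_zero) hζ.pow_eq_one
  obtain ⟨T, hT⟩ := O.exists_eq_of_isIntegral hτ
  obtain ⟨T', hT'⟩ := O.exists_eq_of_isIntegral hτ'
  obtain ⟨P, hP⟩ := ψ⁻¹.exists_monoidHom_eq O
  choose t ht using θ.exists_valuationSubring_eq O
  -- τ divides p^n, and p is invertible in O.
  have hTunit : IsUnit T := by
    refine isUnit_of_mul_isUnit_left (y := T') ?_
    have h1 : T * T' = ((p ^ n : ℕ) : O) := by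
      refine Subtype.ext ?_
      push_cast
      rw [hT, hT', hττ']
      push_cast
      rfl
    rw [h1, ← residue_ne_zero_iff_isUnit, map_natCast]
    exact hpnK n
  have hZpow : Z ^ p ^ n = 1 := Subtype.ext (by push_cast; rw [hZ, hζ.pow_eq_one])
  have hZprim : IsPrimitiveRoot (residue O Z) (p ^ n) := by
    refine ⟨by rw [← map_pow, hZpow, map_one], fun i hi => ?_⟩
    by_contra hcon
    refine IsLocalRing.residue_ne_one_of_pow_eq_one (x := Z ^ i) (m := p ^ n)
      (by rw [← pow_mul, mul_comm, pow_mul, hZpow, one_pow]) ?_ (hpnK n)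
      (by rw [map_pow, hi])
    intro h
    refine hcon (hζ.dvd_of_pow_eq_one i ?_)
    rw [← hZ]
    exact_mod_cast congrArg Subtype.val h
  let h : ℕ → O := fun a => if 2 * a < D ∧ ¬ p ∣ a then t a else 0
  have hh : (fun a => (h a : ℂ)) = lowerHalf D fun a => if p ∣ a then 0 else θ a := by
    funext a
    simp only [h, lowerHalf]
    by_cases h1 : 2 * a < D <;> by_cases h2 : p ∣ a <;> simp [h1, h2, ht]
  let c : ℕ → ResidueField O := fun a => residue O (h a) * (a : ResidueField O) ^ k
  have ht1 : ∀ a : ZMod d, IsUnit a → residue O (t a) ^ d.totient = 1 := by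
    rintro _ ⟨u, rfl⟩
    rw [← map_pow, ← map_one (residue O)]
    congr 1
    refine Subtype.ext ?_
    push_cast
    rw [ht, θ.apply_pow_totient]
  have htq : ∀ a : ZMod d, residue O (t a) ^ q = residue O (t a) := by
    intro a
    by_cases ha : IsUnit a
    · have h1 : residue O (t a) ^ (q - 1) = 1 := by
        refine hroot _ ?_
        obtain ⟨r, hr⟩ := Nat.totient_dvd_of_dvd hd
        rw [hr, mul_assoc, mul_assoc, pow_mul, ht1 a ha, one_pow]
      rw [← Nat.sub_add_cancel hq.le, pow_succ, h1, one_mul]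
    · have h1 : t a = 0 := Subtype.ext (by rw [ht, θ.map_nonunit ha]; rfl)
      rw [h1, map_zero, zero_pow (by omega)]
  have hcq : ∀ a, c a ^ q = c a := by
    intro a
    have h1 : (a : ResidueField O) ^ q = a := by
      have := map_natCast (iterateFrobenius (ResidueField O) ℓ f) a
      rwa [iterateFrobenius_def] at this
    simp only [c, h]
    rw [mul_pow, ← pow_mul, mul_comm k, pow_mul, h1]
    congr 1
    split_ifs
    · exact htq _
    · rw [map_zero, zero_pow (by omega)]
  let ψ' : (ZMod (p ^ n))ˣ →* (ResidueField O)ˣ :=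
    ((residue O : O →* ResidueField O).comp P).toHomUnits
  have hψ' : ∀ u, (ψ' u : ResidueField O) = residue O (P u) := fun u => rfl
  have hA : ∀ u : (ZMod (p ^ n))ˣ, ∃ A : O,
      (A : ℂ) = twistCoeff D (fun a => (h a : ℂ)) (ζ ^ (u : ZMod (p ^ n)).val) k ∧
      residue O A = periodicRat D c (residue O Z ^ (u : ZMod (p ^ n)).val) := by
    intro u
    have h1 := O.exists_twistCoeff_eq h (ω := Z ^ (u : ZMod (p ^ n)).val) (D := D) (by
      rw [map_pow, ← pow_mul, Ne, hZprim.pow_eq_one_iff_dvd]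
      intro h2
      refine hDn (Nat.Coprime.dvd_of_dvd_mul_left ?_ h2)
      exact (ZMod.val_coe_unit_coprime u).symm) hDK k
    rw [map_pow] at h1
    push_cast at h1
    rw [hZ] at h1
    exact h1
  choose A hA hA' using hA
  let S : O := ∑ u, P u * A u
  have hS : τ * χ.LFunction (-(k : ℂ)) = 2 * (S : ℂ) := by
    rw [hL]
    congr 1
    simp only [S]
    push_cast
    refine Finset.sum_congr rfl fun u _ => ?_
    rw [hP, hA, hh]
  have hSunit : IsUnit S := by
    rw [← residue_ne_zero_iff_isUnit]
    intro hS0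
    have hS1 : ∑ u : (ZMod (p ^ n))ˣ, (ψ' u : ResidueField O) *
        periodicRat D c (residue O Z ^ (u : ZMod (p ^ n)).val) = 0 := by
      rw [← hS0, map_sum]
      refine Finset.sum_congr rfl fun u _ => ?_
      rw [map_mul, hA', hψ']
    obtain ⟨u, hu, hψu⟩ := hψ.exists_ne_one (by omega)
    obtain ⟨u₀, rfl⟩ := padicRed_surjective (by omega) u
    have hu₀ : (p : ℤ_[p]) ^ (n - 1) ∣ (u₀ : ℤ_[p]) - 1 := by
      rw [← PadicInt.toZModPow_eq_iff, map_one,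
        ← PadicInt.zmod_cast_comp_toZModPow (n - 1) n (Nat.sub_le n 1)]
      exact congrArg Units.val hu
    -- The value of ψ⁻¹ at u₀ is a p-th root of unity different from 1, and it stays different from
    -- 1 modulo ℓ ≠ p.
    have hψu₀ : ψ' (padicRed p n u₀) ≠ 1 := by
      intro h1
      refine IsLocalRing.residue_ne_one_of_pow_eq_one (x := P (padicRed p n u₀)) (m := p) ?_ ?_ hpK
        (by rw [← hψ', h1, Units.val_one])
      · rw [← map_pow, ← map_pow, ← map_one P]
        congr 1
        rw [← map_one (padicRed p n), padicRed_eq_iff, Units.val_pow_eq_pow_val, Units.val_one]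
        refine (PadicInt.pow_sub_one_associated p (u₀ : ℤ_[p])
          ((pow_dvd_pow _ (by omega)).trans hu₀)).dvd_iff_dvd_right.1 ?_
        conv_lhs => rw [show n = 1 + (n - 1) by omega, pow_add, pow_one]
        exact mul_dvd_mul_left _ hu₀
      · intro h2
        refine hψu ?_
        have h3 := congrArg Subtype.val h2
        rw [hP, MulChar.inv_apply_eq_inv'] at h3
        exact inv_eq_one.1 h3
    obtain ⟨s, hs, hsym⟩ := hn₀ n (by omega) _ hZprim ψ' u₀ hu₀ hψu₀ c hcq hS1
    obtain ⟨a, ha0, haD, hsa, hcop⟩ := exists_natural_in_progression hMp hM0 (e := e) (by omega) hs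
    have hrel := hsym a ha0 haD hsa
    have hMpD : M * p ∣ D := mul_dvd_mul_left _ (dvd_pow_self p (by omega))
    have hne : ∀ b : ℕ, b.Coprime (M * p) → 2 * b < D → c b ≠ 0 := by
      intro b hb hbD
      have hbp : ¬ p ∣ b := fun h1 => hp.one_lt.ne' (Nat.eq_one_of_dvd_coprimes hb h1
        (dvd_mul_left _ _))
      have hbd : IsUnit (b : ZMod d) := by
        rw [ZMod.isUnit_iff_coprime]
        exact hb.coprime_dvd_right ((hd.trans (dvd_mul_right _ _)).mul_right _)
      simp only [c, h]
      rw [if_pos ⟨hbD, hbp⟩]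
      refine mul_ne_zero (fun h1 => ?_) (pow_ne_zero _ fun h1 => ?_)
      · have := ht1 _ hbd
        rw [h1, zero_pow (Nat.totient_pos.2 (NeZero.pos d)).ne'] at this
        exact zero_ne_one this
      · rw [CharP.cast_eq_zero_iff (ResidueField O) ℓ] at h1
        exact hℓ.one_lt.ne' (Nat.eq_one_of_dvd_coprimes hb h1
          ((dvd_mul_left _ _).mul_right _))
    have hzero : ∀ b : ℕ, ¬ 2 * b < D → c b = 0 := by
      intro b hb
      simp only [c, h]
      rw [if_neg (fun h1 => hb h1.1), map_zero, zero_mul]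
    -- Otherwise M p would divide 2 a, hence 2, although M p ≥ 4. So exactly one of a and D - a is
    -- in the lower half; both are prime to M p, and the symmetry equates a nonzero value, up to a
    -- unit, with 0.
    have h2a : 2 * a ≠ D := by
      intro h1
      have h2 : M * p ∣ 2 := hcop.symm.dvd_of_dvd_mul_right (h1 ▸ hMpD)
      have h3 := Nat.le_of_dvd two_pos h2
      have h4 : 2 ≤ M := hℓ.two_le.trans (Nat.le_of_dvd (Nat.pos_of_ne_zero hM0) (dvd_mul_left _ _))
      nlinarith [hp.two_le]
    rcases lt_or_gt_of_ne h2a with h1 | h1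
    · rw [hzero (D - a) (by omega), mul_zero] at hrel
      exact hne a hcop h1 hrel
    · rw [hzero a (by omega)] at hrel
      exact (mul_ne_zero (ψ' (-1)).ne_zero
        (hne (D - a) (hcop.sub_of_dvd hMpD haD.le) (by omega))) hrel.symm
  obtain ⟨T₁, rfl⟩ := hTunit
  obtain ⟨S₁, hS₁⟩ := hSunit
  refine ⟨T₁⁻¹ * S₁, ?_⟩
  have hinv : (((T₁⁻¹ : Oˣ) : O) : ℂ) * τ = 1 := by
    rw [← hT]
    exact_mod_cast congrArg Subtype.val (Units.inv_mul T₁)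
  rw [Units.val_mul, hS₁]
  push_cast
  linear_combination (-(((T₁⁻¹ : Oˣ) : O) : ℂ) / 2) * hS + (χ.LFunction (-(k : ℂ)) / 2) * hinv

end UnitValues

/-! ### Characters of Gal(ℚ_∞/ℚ) as Dirichlet characters -/

section Galois

variable {p : ℕ} [Fact p.Prime]

/-- The value of `ψ` at an automorphism that acts on roots of unity by the natural number `a`. -/
theorem QInfChar.apply_restrictNormalHom (ψ : QInfChar p) {σ : Gal(CycPField p/ℚ)} {a : ℕ}
    (ha : a.Coprime p) (hσ : ∀ z : CycPField p, z ^ p ^ ψ.level = 1 → σ z = z ^ a) :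
    (ψ (AlgEquiv.restrictNormalHom (QInf p) σ) : ℂ) = ψ.dirichlet a := by
  have h := ψ.dirichlet_corresponds σ (ZMod.unitOfCoprime a (ha.pow_right _)) fun z hz => by
    rw [hσ z hz, ZMod.coe_unitOfCoprime, ZMod.val_natCast]
    conv_lhs => rw [← Nat.mod_add_div a (p ^ ψ.level), pow_add, pow_mul, hz, one_pow, mul_one]
  rw [h, ZMod.coe_unitOfCoprime]

/-- Every automorphism acts on the roots of unity of order `p ^ m` by a natural number that is
prime to `p` and to a given `M`. -/
theorem CycPField.exists_coprime_pow (σ : Gal(CycPField p/ℚ)) (m : ℕ) {M : ℕ} (hM : M.Coprime p) :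
    ∃ a : ℕ, a.Coprime p ∧ a.Coprime M ∧ ∀ z : CycPField p, z ^ p ^ m = 1 → σ z = z ^ a := by
  obtain ⟨c, -, hc⟩ := CycPField.exists_cycHom p (m + 1)
  have hcop := ZMod.val_coe_unit_coprime (c σ)
  set b := (c σ : ZMod (p ^ (m + 1))).val
  obtain ⟨a, ha1, ha2⟩ := Nat.chineseRemainder (hM.pow_right (m + 1)) 1 b
  refine ⟨a, ?_, ?_, fun z hz => ?_⟩
  · refine Nat.Coprime.coprime_dvd_right (dvd_pow_self p m.succ_ne_zero) ?_
    have := ha2.gcd_eq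
    rwa [hcop] at this
  · have := ha1.gcd_eq
    rwa [Nat.gcd_one_left] at this
  · have hz' : z ^ p ^ (m + 1) = 1 := by rw [pow_succ, pow_mul, hz, one_pow]
    rw [pow_eq_pow_mod a hz', ha2, ← pow_eq_pow_mod b hz']
    exact hc σ z hz'

/-- Every automorphism acts on the relevant p-power roots of unity as an exponent a that may be
chosen prime to M. This restriction allows a comparison only where θ does not vanish. -/
theorem QInfChar.ext_of_dirichlet {ψ ψ' : QInfChar p} {M : ℕ} (hM : M.Coprime p)
    (h : ∀ a : ℕ, a.Coprime p → a.Coprime M → ψ.dirichlet a = ψ'.dirichlet a) : ψ = ψ' := by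
  refine ContinuousMonoidHom.ext fun τ => ?_
  obtain ⟨σ, rfl⟩ := AlgEquiv.restrictNormalHom_surjective (F := ℚ) (K₁ := QInf p) (CycPField p) τ
  obtain ⟨a, hap, haM, ha⟩ := CycPField.exists_coprime_pow σ (max ψ.level ψ'.level) hM
  have key : ∀ m, m ≤ max ψ.level ψ'.level → ∀ z : CycPField p, z ^ p ^ m = 1 → σ z = z ^ a := by
    intro m hm z hz
    refine ha z ?_
    obtain ⟨t, ht⟩ := pow_dvd_pow p hm
    rw [ht, pow_mul, hz, one_pow]
  refine Units.ext ?_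
  rw [ψ.apply_restrictNormalHom hap (key _ (le_max_left _ _)),
    ψ'.apply_restrictNormalHom hap (key _ (le_max_right _ _)), h a hap haM]

/-- The characters of `Gal(ℚ_∞/ℚ)` are even. -/
theorem QInfChar.dirichlet_neg_one (ψ : QInfChar p) : ψ.dirichlet (-1) = 1 := by
  have : NeZero (p ^ ψ.level) := ⟨pow_ne_zero _ (Fact.out : p.Prime).ne_zero⟩
  -- Complex conjugation is σ_{-1}; having finite order, it is in the torsion subgroup and acts
  -- trivially on ℚ_∞.
  let conj : ℂ ≃ₐ[ℚ] ℂ := Complex.conjAe.restrictScalars ℚ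
  let σ : Gal(CycPField p/ℚ) := AlgEquiv.restrictNormalHom (CycPField p) conj
  have hσ : ∀ z : CycPField p, ((σ z : CycPField p) : ℂ) = (starRingEnd ℂ) (z : ℂ) := fun z =>
    AlgEquiv.restrictNormal_commutes conj (CycPField p) z
  have hσ2 : σ ^ 2 = 1 := by
    refine AlgEquiv.ext fun z => Subtype.ext ?_
    rw [pow_two, AlgEquiv.mul_apply, hσ, hσ, Complex.conj_conj, AlgEquiv.one_apply]
  have hmem : σ ∈ cycTorsion p :=
    Subgroup.subset_closure (isOfFinOrder_iff_pow_eq_one.2 ⟨2, two_pos, hσ2⟩)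
  have hres : AlgEquiv.restrictNormalHom (QInf p) σ = 1 := by
    refine AlgEquiv.ext fun x => Subtype.ext ?_
    refine (AlgEquiv.restrictNormal_commutes σ (QInf p) x).trans ?_
    exact (IntermediateField.mem_fixedField_iff _ _).1 x.2 σ hmem
  have h := ψ.dirichlet_corresponds σ (-1) fun z hz => by
    have hz0 : z ≠ 0 := by
      rintro rfl
      rw [zero_pow (NeZero.ne _)] at hz
      exact zero_ne_one hz
    have h1 : z * z ^ ((-1 : (ZMod (p ^ ψ.level))ˣ) : ZMod (p ^ ψ.level)).val = 1 := by
      rw [← pow_succ']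
      have h2 : p ^ ψ.level ∣ ((-1 : (ZMod (p ^ ψ.level))ˣ) : ZMod (p ^ ψ.level)).val + 1 := by
        rw [← ZMod.natCast_eq_zero_iff]
        push_cast
        rw [ZMod.natCast_zmod_val]
        simp
      obtain ⟨t, ht⟩ := h2
      rw [ht, pow_mul, hz, one_pow]
    rw [eq_inv_of_mul_eq_one_right h1]
    refine Subtype.ext ?_
    have h3 : ‖(z : ℂ)‖ = 1 :=
      Complex.norm_eq_one_of_pow_eq_one (congrArg Subtype.val hz) (NeZero.ne _)
    rw [hσ]
    push_cast
    rw [Complex.inv_eq_conj h3]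
  rw [hres, map_one, Units.val_one, Units.val_neg, Units.val_one] at h
  exact h.symm

theorem DirichletCharacter.primitive_mul_apply {m n : ℕ} (θ : DirichletCharacter ℂ m)
    (ψ : DirichletCharacter ℂ n) {a : ℤ} (hm : IsCoprime a m) (hn : IsCoprime a n) :
    DirichletCharacter.primitive_mul θ ψ a = θ a * ψ a := by
  have h : IsCoprime a (m.lcm n) := by
    refine (hm.mul_right hn).of_isCoprime_of_dvd_right ?_
    exact_mod_cast Nat.lcm_dvd_mul m n
  rw [primitive_mul, primitiveCharacter_apply_of_isCoprime _ h, mul, MulChar.mul_apply,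
    changeLevel_eq_cast_of_dvd' _ _ h, changeLevel_eq_cast_of_dvd' _ _ h]

end Galois

/-! ### The place above ℓ and the finiteness of the exceptional set -/

section MainResult

open IsLocalRing

/-- The valuation ring of `ℂ` that an isomorphism with `ℚ̄_ℓ` defines. -/
noncomputable def padicSubring {ℓ : ℕ} [Fact ℓ.Prime] (ι : ℂ ≃+* PadicAlgCl ℓ) :
    ValuationSubring ℂ :=
  (Valued.v : Valuation (PadicAlgCl ℓ) NNReal).valuationSubring.comap (ι : ℂ →+* PadicAlgCl ℓ)

theorem mem_padicSubring_iff {ℓ : ℕ} [Fact ℓ.Prime] (ι : ℂ ≃+* PadicAlgCl ℓ) (x : ℂ) :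
    x ∈ padicSubring ι ↔ ‖ι x‖ ≤ 1 := by
  rw [padicSubring, ValuationSubring.mem_comap, Valuation.mem_valuationSubring_iff]
  rw [← NNReal.coe_le_coe]
  rfl

theorem norm_unit_padicSubring {ℓ : ℕ} [Fact ℓ.Prime] (ι : ℂ ≃+* PadicAlgCl ℓ)
    (x : (padicSubring ι)ˣ) : ‖ι ((x : padicSubring ι) : ℂ)‖ = 1 := by
  have h1 := (mem_padicSubring_iff ι _).1 (x : padicSubring ι).2
  have h2 := (mem_padicSubring_iff ι _).1 ((x⁻¹ : (padicSubring ι)ˣ) : padicSubring ι).2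
  have h3 : ι ((x : padicSubring ι) : ℂ) * ι (((x⁻¹ : (padicSubring ι)ˣ) : padicSubring ι) : ℂ)
      = 1 := by
    rw [← map_mul, ← map_one ι]
    congr 1
    exact_mod_cast congrArg Subtype.val (Units.mul_inv x)
  have h4 := congrArg norm h3
  rw [norm_mul, norm_one] at h4
  nlinarith [norm_nonneg (ι ((x : padicSubring ι) : ℂ)),
    norm_nonneg (ι (((x⁻¹ : (padicSubring ι)ˣ) : padicSubring ι) : ℂ))]

theorem ordEll_unit_padicSubring {ℓ : ℕ} [Fact ℓ.Prime] (ι : ℂ ≃+* PadicAlgCl ℓ)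
    (x : (padicSubring ι)ˣ) : ordEll ℓ (ι ((x : padicSubring ι) : ℂ)) = 0 := by
  have h := norm_unit_padicSubring ι x
  have h0 : ι ((x : padicSubring ι) : ℂ) ≠ 0 := norm_ne_zero_iff.1 (by rw [h]; exact one_ne_zero)
  rw [ordEll, if_neg h0, h, Real.logb_one, neg_zero]
  rfl

instance charP_residueField_padicSubring {ℓ : ℕ} [Fact ℓ.Prime] (ι : ℂ ≃+* PadicAlgCl ℓ) :
    CharP (ResidueField (padicSubring ι)) ℓ := by
  have hℓ : ℓ.Prime := Fact.out
  have h : (ℓ : ResidueField (padicSubring ι)) = 0 := by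
    by_contra hne
    rw [← map_natCast (residue (padicSubring ι)), ← Ne, residue_ne_zero_iff_isUnit] at hne
    obtain ⟨u, hu⟩ := hne
    have h1 := norm_unit_padicSubring ι u
    rw [hu] at h1
    push_cast at h1
    rw [map_natCast] at h1
    have h2 := PadicAlgCl.valuation_p ℓ
    rw [PadicAlgCl.valuation_def] at h2
    have h3 : ‖(ℓ : PadicAlgCl ℓ)‖ = 1 / (ℓ : ℝ) := by
      rw [← coe_nnnorm, h2]
      push_cast
      rfl
    rw [h1, eq_div_iff (by exact_mod_cast hℓ.ne_zero), one_mul] at h3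
    exact hℓ.one_lt.ne' (by exact_mod_cast h3)
  exact ringChar.of_eq (CharP.ringChar_of_prime_eq_zero hℓ h)

/-- At a valuation ring of residue characteristic `ℓ ≠ p`, all but finitely many of the values
`L(-k, θψ) / 2` are units. -/
theorem finite_setOf_not_unit (O : ValuationSubring ℂ) {p ℓ : ℕ} [Fact p.Prime] [Fact ℓ.Prime]
    (hpl : p ≠ ℓ) [CharP (ResidueField O) ℓ] (k : ℕ) {N : ℕ} [NeZero N]
    (θ : DirichletCharacter ℂ N) (hθ : θ (-1) * (-1) ^ k = -1) :
    {ψ : QInfChar p | ¬ ∃ x : Oˣ, ((x : O) : ℂ) = twistedLValue θ ψ k / 2}.Finite := by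
  have hp : p.Prime := Fact.out
  obtain ⟨v, N₀, hpN₀, hN⟩ := Nat.exists_eq_pow_mul_and_not_dvd (NeZero.ne N) p hp.ne_one
  have hN₀p : N₀.Coprime p := ((Nat.Prime.coprime_iff_not_dvd hp).2 hpN₀).symm
  have hN₀ : N₀ ≠ 0 := fun h => hpN₀ (h ▸ dvd_zero _)
  obtain ⟨n₁, hn₁⟩ := DirichletCharacter.exists_unit_eq_LFunction_neg O hpl k hN₀ hN₀p
  have : NeZero (N₀ * p ^ n₁) := ⟨mul_ne_zero hN₀ (pow_ne_zero _ hp.ne_zero)⟩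
  have hne : ∀ ψ : QInfChar p, (DirichletCharacter.mul θ ψ.dirichlet).conductor ≠ 0 := by
    intro ψ
    have : NeZero (Nat.lcm N (p ^ ψ.level)) :=
      ⟨Nat.lcm_ne_zero (NeZero.ne N) (pow_ne_zero _ hp.ne_zero)⟩
    exact DirichletCharacter.conductor_ne_zero _
  have hcond : ∀ ψ : QInfChar p, ∃ d n, d ∣ N₀ ∧
      (DirichletCharacter.mul θ ψ.dirichlet).conductor = d * p ^ n := by
    intro ψ
    obtain ⟨n, d, hd, hf⟩ := Nat.exists_eq_pow_mul_and_not_dvd (hne ψ) p hp.ne_one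
    refine ⟨d, n, ?_, by rw [hf, mul_comm]⟩
    have h1 : d ∣ N₀ * p ^ (v + ψ.level) := by
      have h2 := (DirichletCharacter.conductor_dvd_level
        (DirichletCharacter.mul θ ψ.dirichlet)).trans (Nat.lcm_dvd_mul _ _)
      refine ((dvd_mul_left d (p ^ n)).trans (hf ▸ h2)).trans (dvd_of_eq ?_)
      rw [hN, pow_add]
      ring
    exact (((Nat.Prime.coprime_iff_not_dvd hp).2 hd).symm.pow_right _).dvd_of_dvd_mul_right h1
  have hgood : ∀ f d n (_ : NeZero f) (χ : DirichletCharacter ℂ f), f = d * p ^ n → d ∣ N₀ →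
      n₁ ≤ n → χ.IsPrimitive → χ (-1) * (-1) ^ k = -1 →
      ∃ x : Oˣ, ((x : O) : ℂ) = χ.LFunction (-(k : ℂ)) / 2 := by
    rintro f d n _ χ rfl hd hn hχ hpar
    exact hn₁ n hn d hd χ hχ hpar
  -- An exceptional ψ must have n < n₁, so the conductor of θψ divides a fixed number.
  have hbad : ∀ ψ : QInfChar p, (¬ ∃ x : Oˣ, ((x : O) : ℂ) = twistedLValue θ ψ k / 2) →
      (DirichletCharacter.mul θ ψ.dirichlet).conductor ∣ N₀ * p ^ n₁ := by
    intro ψ hψ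
    obtain ⟨d, n, hd, hf⟩ := hcond ψ
    by_cases hn : n₁ ≤ n
    · refine absurd (hgood _ d n ⟨hne ψ⟩ (DirichletCharacter.primitive_mul θ ψ.dirichlet) hf hd hn
        (DirichletCharacter.primitiveCharacter_isPrimitive _) ?_) hψ
      have h1 := DirichletCharacter.primitive_mul_apply θ ψ.dirichlet (a := -1)
        isCoprime_one_left.neg_left isCoprime_one_left.neg_left
      push_cast at h1
      rw [h1, ψ.dirichlet_neg_one, mul_one, hθ]
    · rw [hf]
      exact mul_dvd_mul hd (pow_dvd_pow p (by omega))
  -- There are finitely many characters of this fixed modulus, and θψ determines ψ on integers prime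
  -- to p and N₀, where θ can be cancelled.
  let F : {ψ : QInfChar p | ¬ ∃ x : Oˣ, ((x : O) : ℂ) = twistedLValue θ ψ k / 2} →
      DirichletCharacter ℂ (N₀ * p ^ n₁) := fun ψ =>
    DirichletCharacter.changeLevel (hbad ψ.1 ψ.2)
      (DirichletCharacter.primitive_mul θ ψ.1.dirichlet)
  refine Set.finite_coe_iff.1 (Finite.of_injective F ?_)
  rintro ⟨ψ, hψ⟩ ⟨ψ', hψ'⟩ h
  refine Subtype.ext (QInfChar.ext_of_dirichlet hN₀p fun a hap haN => ?_)
  have hco : IsCoprime (a : ℤ) ((N₀ * p ^ n₁ : ℕ) : ℤ) :=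
    Nat.isCoprime_iff_coprime.2 (haN.mul_right (hap.pow_right _))
  have hcoN : IsCoprime (a : ℤ) (N : ℤ) :=
    Nat.isCoprime_iff_coprime.2 (by rw [hN]; exact (hap.pow_right _).mul_right haN)
  have h1 := DFunLike.congr_fun h ((a : ℤ) : ZMod (N₀ * p ^ n₁))
  simp only [F] at h1
  rw [DirichletCharacter.changeLevel_eq_cast_of_dvd' _ _ hco,
    DirichletCharacter.changeLevel_eq_cast_of_dvd' _ _ hco,
    DirichletCharacter.primitive_mul_apply θ ψ.dirichlet hcoN
      (Nat.isCoprime_iff_coprime.2 (hap.pow_right _)),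
    DirichletCharacter.primitive_mul_apply θ ψ'.dirichlet hcoN
      (Nat.isCoprime_iff_coprime.2 (hap.pow_right _))] at h1
  have hθa : θ ((a : ℤ) : ZMod N) ≠ 0 := by
    have hu : IsUnit ((a : ℤ) : ZMod N) := by
      rw [← ZMod.coe_unitOfIsCoprime _ hcoN]
      exact Units.isUnit _
    exact (hu.map θ).ne_zero
  simpa using mul_left_cancel₀ hθa h1

end MainResult

theorem mainTheorem1 (p ℓ : ℕ) [Fact p.Prime] [Fact ℓ.Prime] (hpl : p ≠ ℓ)
    (ι : ℂ ≃+* PadicAlgCl ℓ) (k : ℕ) (N : ℕ) [NeZero N] (θ : DirichletCharacter ℂ N)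
    (hθ : θ (-1) * (-1) ^ k = -1) :
    ({ψ : QInfChar p | 0 < ordEll ℓ (ι (twistedLValue θ ψ k / 2))}.Finite ∧
      (¬ ℓ ∣ θ.conductor →
        {ψ : QInfChar p | ordEll ℓ (ι (twistedLValue θ ψ k / 2)) ≠ 0}.Finite)) ∧
    (ℓ ≠ 2 →
      {ψ : QInfChar p | 0 < ordEll ℓ (ι (twistedLValue θ ψ k))}.Finite ∧
      (¬ ℓ ∣ θ.conductor →
        {ψ : QInfChar p | ordEll ℓ (ι (twistedLValue θ ψ k)) ≠ 0}.Finite)) := by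
  have hfin := finite_setOf_not_unit (padicSubring ι) hpl k θ hθ
  have h1 : {ψ : QInfChar p | ordEll ℓ (ι (twistedLValue θ ψ k / 2)) ≠ 0}.Finite := by
    refine hfin.subset fun ψ hψ => ?_
    rintro ⟨x, hx⟩
    exact hψ (by rw [← hx, ordEll_unit_padicSubring])
  refine ⟨⟨h1.subset fun ψ hψ => ne_of_gt hψ, fun _ => h1⟩, fun hℓ2 => ?_⟩
  have h2 : {ψ : QInfChar p | ordEll ℓ (ι (twistedLValue θ ψ k)) ≠ 0}.Finite := by
    refine hfin.subset fun ψ hψ => ?_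
    rintro ⟨x, hx⟩
    -- For ℓ ≠ 2 the factor 2 is a unit at ℓ, so the exceptional set for L(-k, θψ) lies in the one
    -- for L(-k, θψ)/2.
    have h2u : IsUnit (2 : padicSubring ι) := by
      rw [← IsLocalRing.residue_ne_zero_iff_isUnit]
      intro h
      have h3 : ((2 : ℕ) : IsLocalRing.ResidueField (padicSubring ι)) = 0 := by
        rw [← h]
        exact (map_natCast (IsLocalRing.residue (padicSubring ι)) 2).symm
      rw [CharP.cast_eq_zero_iff _ ℓ] at h3
      exact hℓ2 ((Nat.prime_dvd_prime_iff_eq Fact.out Nat.prime_two).1 h3)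
    obtain ⟨u, hu⟩ := h2u
    refine hψ ?_
    rw [← ordEll_unit_padicSubring ι (u * x)]
    congr 2
    rw [Units.val_mul, hu]
    push_cast
    rw [hx]
    exact (mul_div_cancel₀ _ two_ne_zero).symm
  exact ⟨h2.subset fun ψ hψ => ne_of_gt hψ, fun _ => h2⟩
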